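/- \textbf{Setting.} All objects are smooth. A \emph{Weyl structure} on a 3-manifold $B$ is a conformal (Riemannian) structure $\mathsf c$ with a torsion-free connection $D$ on $TB$ preserving it; in a gauge (a length scale $\mu$ with $D\mu=\omega\mu$) it is given by the metric $g=\mu^{-2}\mathsf c$ and the $1$-form $\omega$, with $Dg=-2\omega\otimes g$. It is \emph{Einstein--Weyl} if the symmetric traceless part of the Ricci tensor of $D$ vanishes, and an Einstein--Weyl structure is \emph{hyperCR} if there are an orthonormal frame $\chi_1,\chi_2,\chi_3$ of the weightless tangent bundle $L^{-1}TB$ ($L$ the bundle of densities of weight $1$) and a section $\kappa$ of $L^{-1}$ with $D\chi_i=\kappa\,{*\chi_i}$ for $i=1,2,3$ (Hodge star for the orientation of the frame); the elements $\sum_i c_i\chi_i$, with $c_i$ constants and $\sum_i c_i^2=1$, are then called \emph{hyperCR congruences}. Let $N$ be a trivial spinor-vortex space, i.e. a Riemann surface (an oriented conformal surface), and let $\pi\colon P\to N$ be a circle bundle (associated to a principal $\mathrm{Diff}(S^1)$-bundle). A $\mathrm{Diff}(S^1)$ \emph{Hitchin field} on an open set $\Omega\subseteq P$ (on all of $N$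 if $\Omega=P$) consists of a connection $A$, with horizontal lift $X\mapsto X^A$, and a $(1,0)$-form $\varphi$ on $N$ with values in complex vertical vector fields on $\Omega$, such that for all vector fields $X,Y$ on $N$ $$[X^A,Y^A]-[X,Y]^A=\tfrac14\bigl([\varphi(X),\overline{\varphi}(Y)]-[\varphi(Y),\overline{\varphi}(X)]\bigr),\qquad [X^A,\varphi(Y)]-[Y^A,\varphi(X)]-\varphi([X,Y])=0 .$$ These are Hitchin's equations $F^A=[\varphi,\overline\varphi]$, $\overline\partial{}^A\varphi=0$ for the Lie algebra $\mathrm{Vect}(S^1)$, whose bracket is minus the bracket of vector fields; in a local trivialization with fibre coordinate $t$ they read $$d_NA+\dot A\wedge A=\tfrac14(\dot\varphi\wedge\overline\varphi-\varphi\wedge\dot{\overline\varphi}),\qquad d_N\varphi+\dot A\wedge\varphi-A\wedge\dot\varphi=0 .$$ On the set $U\subseteq\Omega$ where $\varphi\neq0$, the Hitchin field defines the Weyl structure which, in such a trivialization, has $$g=\varphi\overline\varphi+(dt+A)^2,\qquad \omega=\dot A-\tau\,(dt+A),\qquad \tau=\operatorname{Re}(\dot\varphi/\varphi).$$ More generally,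 with a nowhere-vanishing smooth vertical vector field $T$ on $U$ in place of $\partial_t$ the analogous formulae give the same Weyl structure in the gauge determined by $T$. We assume that such a field $T$ exists on $U$; this is automatic locally and, by a partition of unity, for paracompact manifolds when the fibres are consistently oriented. \textbf{Theorem.} (1) Let $(A,\varphi)$ be a $\mathrm{Diff}(S^1)$ Hitchin field over a Riemann surface $N$, defined on an open subset $\Omega$ of a circle bundle $\pi\colon P\to N$. Then $U=\{\varphi\ne0\}$ is open, the above formulae define a Weyl structure on $U$, this Weyl structure is Einstein--Weyl and hyperCR, and one of its hyperCR congruences is tangent to the fibres of $\pi$, i.e. defines the foliation over $N$. (2) Every hyperCR Einstein--Weyl space arises locally in this way, with any of its hyperCR congruences: if $(B,\mathsf c,D)$ is a hyperCR Einstein--Weyl 3-manifold and $\chi$ is one of its hyperCR congruences, then each $b\in B$ has an open neighbourhood $V$ with a diffeomorphism $f$ of $V$ onto an open subset $\Omega$ of $N\times S^1$, for some Riemann surface $N$, and there is a $\mathrm{Diff}(S^1)$ Hitchin field $(A,\varphi)$ on $\Omega$ with $\varphi\neq0$ everywhere, such that $f$ identifies the Weyl structure of $V$ with the one defined by $(A,\varphi)$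 and takes the foliation of $V$ generated by $\chi$ to the fibres over $N$. Thus the hyperCR Einstein--Weyl equation is (locally) equivalent to the $\mathrm{Diff}(S^1)$ Hitchin equation. -/

import Mathlib

open scoped Manifold ContDiff Topology

noncomputable section

namespace HyperCR

section Fields

variable {E : Type*} [NormedAddCommGroup E] [NormedSpace ℝ E]
  {H : Type*} [TopologicalSpace H] (I : ModelWithCorners ℝ E H)
  {M : Type*} [TopologicalSpace M] [ChartedSpace H M]

/-- The vector field `X` is smooth at `p`. -/
def SmoothVF [IsManifold I ∞ M] (X : Π q : M, TangentSpace I q) (p : M) : Prop :=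
  ContMDiffAt I I.tangent ∞ (fun q => (⟨q, X q⟩ : TangentBundle I M)) p

/-- The real function `f` is smooth at `p`. -/
def SmoothFn (f : M → ℝ) (p : M) : Prop :=
  ContMDiffAt I 𝓘(ℝ) ∞ f p

end Fields

/-! ### Weyl structures, in a gauge -/

section Weyl

variable {E : Type*} [NormedAddCommGroup E] [NormedSpace ℝ E]
  {H : Type*} [TopologicalSpace H] (I : ModelWithCorners ℝ E H)
  {M : Type*} [TopologicalSpace M] [ChartedSpace H M] [IsManifold I ∞ M]

/-- A Weyl structure `(c, D)` on the open subset `U` of `M`, written in a gauge, i.e. with respect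
to a length scale `μ`: the representative metric `g = μ⁻² c` and the Weyl `1`-form `ω = weylForm`, with
`D μ = ω μ`. (A change of gauge `μ ↦ f μ` gives `(f⁻² g, ω + d log f)`; the bundles of densities
are trivial, so a Weyl structure always has such a description.) -/
structure WeylStructure (U : Set M) where
  g : Π p : M, TangentSpace I p →L[ℝ] TangentSpace I p →L[ℝ] ℝ
  weylForm : Π p : M, TangentSpace I p →L[ℝ] ℝ
  symm : ∀ p ∈ U, ∀ v w, g p v w = g p w v
  pos : ∀ p ∈ U, ∀ v, v ≠ 0 → 0 < g p v v
  smooth_g : ∀ p ∈ U, ∀ X Y : (Π q : M, TangentSpace I q), SmoothVF I X p → SmoothVF I Y p →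
    SmoothFn I (fun q => g q (X q) (Y q)) p
  smooth_weylForm : ∀ p ∈ U, ∀ X : (Π q : M, TangentSpace I q), SmoothVF I X p →
    SmoothFn I (fun q => weylForm q (X q)) p

variable {I}

/-- `D` is the Weyl connection on `U` of the Weyl structure: the torsion-free connection on the
tangent bundle which is conformal, with `D g = -2 ω ⊗ g`. Here `D Y p (X p)` is `(D_X Y)(p)`.
By the Koszul formula it exists and is unique. -/
structure WeylStructure.IsWeylConnection {U : Set M} (W : WeylStructure I U)
    (D : (Π q : M, TangentSpace I q) → (Π q : M, TangentSpace I q →L[ℝ] TangentSpace I q)) :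
    Prop where
  isCovariantDerivative : IsCovariantDerivativeOn E D U
  smooth : ∀ p ∈ U, ∀ X Y : (Π q : M, TangentSpace I q), SmoothVF I X p → SmoothVF I Y p →
    SmoothVF I (fun q => D Y q (X q)) p
  torsion_free : ∀ p ∈ U, ∀ X Y : (Π q : M, TangentSpace I q), SmoothVF I X p → SmoothVF I Y p →
    D Y p (X p) - D X p (Y p) = VectorField.mlieBracket I X Y p
  conformal : ∀ p ∈ U, ∀ Y Z : (Π q : M, TangentSpace I q), SmoothVF I Y p → SmoothVF I Z p →
    ∀ v : TangentSpace I p,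
      mvfderiv I (fun q => W.g q (Y q) (Z q)) p v
        - W.g p (D Y p v) (Z p) - W.g p (Y p) (D Z p v) = -2 * W.weylForm p v * W.g p (Y p) (Z p)

/-- The curvature `R_{X,Y} Z = D_X D_Y Z - D_Y D_X Z - D_{[X,Y]} Z` at `p`. -/
def curvature
    (D : (Π q : M, TangentSpace I q) → (Π q : M, TangentSpace I q →L[ℝ] TangentSpace I q))
    (X Y Z : Π q : M, TangentSpace I q) (p : M) : TangentSpace I p :=
  D (fun q => D Z q (Y q)) p (X p) - D (fun q => D Z q (X q)) p (Y p)
    - D Z p (VectorField.mlieBracket I X Y p)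

/-- The Ricci tensor `Ric(Y, Z) = tr (X ↦ R_{X,Y} Z)` at `p` of a connection on a `3`-manifold,
computed with vector fields `e 0, e 1, e 2` which are orthonormal at `p` for the metric `g p`. -/
def ricci (g : Π p : M, TangentSpace I p →L[ℝ] TangentSpace I p →L[ℝ] ℝ)
    (D : (Π q : M, TangentSpace I q) → (Π q : M, TangentSpace I q →L[ℝ] TangentSpace I q))
    (e : Fin 3 → Π q : M, TangentSpace I q) (Y Z : Π q : M, TangentSpace I q) (p : M) : ℝ :=
  ∑ i, g p (curvature D (e i) Y Z p) (e i p)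

/-- The Einstein--Weyl equation on `U` (in dimension three): the symmetric part of the Ricci tensor
of the Weyl connection `D` is a multiple of the metric, i.e. its symmetric traceless part
vanishes. -/
def WeylStructure.IsEinsteinWeyl {U : Set M} (W : WeylStructure I U)
    (D : (Π q : M, TangentSpace I q) → (Π q : M, TangentSpace I q →L[ℝ] TangentSpace I q)) :
    Prop :=
  ∀ p ∈ U, ∃ Λ : ℝ, ∀ e : Fin 3 → Π q : M, TangentSpace I q,
    (∀ i, SmoothVF I (e i) p) → (∀ i j, W.g p (e i p) (e j p) = if i = j then 1 else 0) →
    ∀ Y Z : (Π q : M, TangentSpace I q), SmoothVF I Y p → SmoothVF I Z p →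
      (ricci W.g D e Y Z p + ricci W.g D e Z Y p) / 2 = Λ * W.g p (Y p) (Z p)

/-- `χ i = μ⁻¹ ⊗ F i` (`i = 0, 1, 2`) is an orthonormal frame of the weightless tangent bundle
`L⁻¹ TM` over `U` with `D χ_i = κ ∗χ_i`, for the section `κ μ⁻¹` of `L⁻¹`. As `D μ = ω μ`, in the
gauge `μ` this reads `D_v (F i) = ω(v) F i + κ (F i × v)`, where the cross product is the one for
which the frame is oriented, so that
`F i × v = ⟨F (i+1), v⟩ F (i+2) - ⟨F (i+2), v⟩ F (i+1)`, with the indices modulo `3`. -/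
structure WeylStructure.IsHyperCRFrame {U : Set M} (W : WeylStructure I U)
    (D : (Π q : M, TangentSpace I q) → (Π q : M, TangentSpace I q →L[ℝ] TangentSpace I q))
    (F : Fin 3 → Π q : M, TangentSpace I q) (κ : M → ℝ) : Prop where
  smooth : ∀ p ∈ U, ∀ i, SmoothVF I (F i) p
  smooth_κ : ∀ p ∈ U, SmoothFn I κ p
  orthonormal : ∀ p ∈ U, ∀ i j, W.g p (F i p) (F j p) = if i = j then 1 else 0
  eqn : ∀ p ∈ U, ∀ i, ∀ v : TangentSpace I p,
    D (F i) p v = W.weylForm p v • F i p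
      + κ p • (W.g p (F (i + 1) p) v • F (i + 2) p - W.g p (F (i + 2) p) v • F (i + 1) p)

/-- A Weyl structure with Weyl connection `D` is a hyperCR Einstein--Weyl structure. -/
def WeylStructure.IsHyperCREinsteinWeyl {U : Set M} (W : WeylStructure I U)
    (D : (Π q : M, TangentSpace I q) → (Π q : M, TangentSpace I q →L[ℝ] TangentSpace I q)) :
    Prop :=
  W.IsEinsteinWeyl D ∧
    ∃ (F : Fin 3 → Π q : M, TangentSpace I q) (κ : M → ℝ), W.IsHyperCRFrame D F κ

/-- The vector field `X` represents, in the gauge of `W`, a hyperCR congruence: a point of the unit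
sphere generated by the members `χ_i` of a hyperCR frame. -/
def WeylStructure.IsHyperCRCongruence {U : Set M} (W : WeylStructure I U)
    (D : (Π q : M, TangentSpace I q) → (Π q : M, TangentSpace I q →L[ℝ] TangentSpace I q))
    (X : Π q : M, TangentSpace I q) : Prop :=
  ∃ (F : Fin 3 → Π q : M, TangentSpace I q) (κ : M → ℝ) (c : Fin 3 → ℝ),
    W.IsHyperCRFrame D F κ ∧ ∑ i, c i ^ 2 = 1 ∧ ∀ p ∈ U, X p = ∑ i, c i • F i p

end Weyl

/-! ### `Diff(S¹)` Hitchin fields -/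

section Hitchin

variable {E₂ : Type*} [NormedAddCommGroup E₂] [NormedSpace ℝ E₂]
  {H₂ : Type*} [TopologicalSpace H₂] (I₂ : ModelWithCorners ℝ E₂ H₂)
  {N : Type*} [TopologicalSpace N] [ChartedSpace H₂ N] [IsManifold I₂ ∞ N]
  {E₃ : Type*} [NormedAddCommGroup E₃] [NormedSpace ℝ E₃]
  {H₃ : Type*} [TopologicalSpace H₃] (I₃ : ModelWithCorners ℝ E₃ H₃)
  {P : Type*} [TopologicalSpace P] [ChartedSpace H₃ P] [IsManifold I₃ ∞ P]

/-- `J` is a smooth almost complex structure. On a surface this is the same thing as a conformal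
structure with an orientation, and as the structure of a Riemann surface. -/
structure IsComplexStructure (J : Π x : N, TangentSpace I₂ x →L[ℝ] TangentSpace I₂ x) : Prop where
  sq : ∀ x v, J x (J x v) = -v
  smooth : ∀ x, ∀ X : (Π y : N, TangentSpace I₂ y), SmoothVF I₂ X x →
    SmoothVF I₂ (fun y => J y (X y)) x

/-- `π : P → N` is a smooth circle bundle, i.e. the bundle associated to a principal
`Diff(S¹)`-bundle over `N`. -/
structure IsCircleBundle (π : P → N) : Prop where
  smooth : ContMDiff I₃ I₂ ∞ π
  locally_trivial : ∀ x : N, ∃ (V : Set N) (e : OpenPartialHomeomorph P (N × Circle)),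
    IsOpen V ∧ x ∈ V ∧ e.source = π ⁻¹' V ∧ e.target = V ×ˢ Set.univ ∧
    (∀ p ∈ e.source, (e p).1 = π p) ∧
    ContMDiffOn I₃ (I₂.prod (𝓡 1)) ∞ e e.source ∧ ContMDiffOn (I₂.prod (𝓡 1)) I₃ ∞ e.symm e.target

/-- A pair `(A, φ)` over the open subset `Ω` of the circle bundle `π : P → N`: a connection `A`,
given by its horizontal lifts `hor`, and a Higgs field `φ = re + i im`, a `1`-form of type `(1,0)`
on `N` with values in the (complexified) vertical vector fields, which are the sections of the
bundle of Lie algebras with fibre `Vect(S¹)`. A field defined over all of `N` is the case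
`Ω = P`. -/
structure HiggsPair (J : Π x : N, TangentSpace I₂ x →L[ℝ] TangentSpace I₂ x) (π : P → N)
    (Ω : Set P) where
  hor : Π p : P, TangentSpace I₂ (π p) →L[ℝ] TangentSpace I₃ p
  re : Π p : P, TangentSpace I₂ (π p) →L[ℝ] TangentSpace I₃ p
  im : Π p : P, TangentSpace I₂ (π p) →L[ℝ] TangentSpace I₃ p
  proj_hor : ∀ p ∈ Ω, ∀ x, mfderiv I₃ I₂ π p (hor p x) = x
  proj_re : ∀ p ∈ Ω, ∀ x, mfderiv I₃ I₂ π p (re p x) = 0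
  proj_im : ∀ p ∈ Ω, ∀ x, mfderiv I₃ I₂ π p (im p x) = 0
  re_J : ∀ p ∈ Ω, ∀ x, re p (J (π p) x) = -im p x
  im_J : ∀ p ∈ Ω, ∀ x, im p (J (π p) x) = re p x
  smooth_hor : ∀ p ∈ Ω, ∀ X : (Π y : N, TangentSpace I₂ y), SmoothVF I₂ X (π p) →
    SmoothVF I₃ (fun q => hor q (X (π q))) p
  smooth_re : ∀ p ∈ Ω, ∀ X : (Π y : N, TangentSpace I₂ y), SmoothVF I₂ X (π p) →
    SmoothVF I₃ (fun q => re q (X (π q))) p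
  smooth_im : ∀ p ∈ Ω, ∀ X : (Π y : N, TangentSpace I₂ y), SmoothVF I₂ X (π p) →
    SmoothVF I₃ (fun q => im q (X (π q))) p

variable {I₂ I₃} {J : Π x : N, TangentSpace I₂ x →L[ℝ] TangentSpace I₂ x} {π : P → N} {Ω : Set P}

namespace HiggsPair

/-- The horizontal lift of a vector field on the base. -/
def liftHor (Φ : HiggsPair I₂ I₃ J π Ω) (X : Π y : N, TangentSpace I₂ y) :
    Π q : P, TangentSpace I₃ q := fun q => Φ.hor q (X (π q))

/-- The vertical vector field `Re φ(X)`. -/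
def vecRe (Φ : HiggsPair I₂ I₃ J π Ω) (X : Π y : N, TangentSpace I₂ y) :
    Π q : P, TangentSpace I₃ q := fun q => Φ.re q (X (π q))

/-- The vertical vector field `Im φ(X)`. -/
def vecIm (Φ : HiggsPair I₂ I₃ J π Ω) (X : Π y : N, TangentSpace I₂ y) :
    Π q : P, TangentSpace I₃ q := fun q => Φ.im q (X (π q))

/-- Hitchin's equations `F^A = [φ, φ̄]` and `∂̄^A φ = 0` for the Lie algebra `Vect(S¹)`.

Here `[φ, φ̄](X, Y) = ¼ ([φ(X), φ̄(Y)] - [φ(Y), φ̄(X)]) = ½ ([Re φ(X), Re φ(Y)] + [Im φ(X), Im φ(Y)])`,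
and minus the curvature is the vertical part of the bracket of the horizontal lifts; the bracket of
the Lie algebra of `Diff(S¹)` is minus the bracket of vector fields. As `φ` has type `(1,0)`,
`∂̄^A φ` is the whole of `d^A φ`. In a local trivialization, with `A` and `φ` written as `A ∂_t` and
`φ ∂_t` and the connection form as `dt + A`, these are the equations
`d_N A + Ȧ ∧ A = ¼ (φ̇ ∧ φ̄ - φ ∧ φ̄̇)` and `d_N φ + Ȧ ∧ φ - A ∧ φ̇ = 0`. -/
structure IsHitchin (Φ : HiggsPair I₂ I₃ J π Ω) : Prop where
  curvature_eq : ∀ p ∈ Ω, ∀ X Y : (Π y : N, TangentSpace I₂ y),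
    SmoothVF I₂ X (π p) → SmoothVF I₂ Y (π p) →
    VectorField.mlieBracket I₃ (Φ.liftHor X) (Φ.liftHor Y) p
        - Φ.hor p (VectorField.mlieBracket I₂ X Y (π p))
      = (1 / 2 : ℝ) • (VectorField.mlieBracket I₃ (Φ.vecRe X) (Φ.vecRe Y) p
        + VectorField.mlieBracket I₃ (Φ.vecIm X) (Φ.vecIm Y) p)
  higgs_re : ∀ p ∈ Ω, ∀ X Y : (Π y : N, TangentSpace I₂ y),
    SmoothVF I₂ X (π p) → SmoothVF I₂ Y (π p) →
    VectorField.mlieBracket I₃ (Φ.liftHor X) (Φ.vecRe Y) p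
        - VectorField.mlieBracket I₃ (Φ.liftHor Y) (Φ.vecRe X) p
      = Φ.re p (VectorField.mlieBracket I₂ X Y (π p))
  higgs_im : ∀ p ∈ Ω, ∀ X Y : (Π y : N, TangentSpace I₂ y),
    SmoothVF I₂ X (π p) → SmoothVF I₂ Y (π p) →
    VectorField.mlieBracket I₃ (Φ.liftHor X) (Φ.vecIm Y) p
        - VectorField.mlieBracket I₃ (Φ.liftHor Y) (Φ.vecIm X) p
      = Φ.im p (VectorField.mlieBracket I₂ X Y (π p))

/-- The set of points of `Ω` where `φ`, as a map from the tangent plane of `N` to the (real,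
one-dimensional) tangent line of the fibre, is surjective. By type, `Re φ` and `Im φ` have the
same zeros. -/
def regularSet (Φ : HiggsPair I₂ I₃ J π Ω) : Set P := {p | p ∈ Ω ∧ Φ.re p ≠ 0}

/-- `W` is the Weyl structure on `U` defined by `(A, φ)`, written in the gauge given by the
nowhere-vanishing vertical vector field `T`. Writing `φ = φ_T ⊗ T`, and writing the vertical
projection as `θ ⊗ T`, this is `g = φ_T φ̄_T + θ²` and `ω = γ - τ θ`, where `γ` is horizontal and is
the `T`-derivative of the connection, and `τ = Re (φ̇_T / φ_T)`. For `T = ∂_t` and `φ = 2 Φ dz`,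
`A = α dz + ᾱ dz̄` it reads
`g = 4 Φ Φ̄ dz dz̄ + (dt + A)²`, `ω = α̇ dz + ᾱ̇ dz̄ - ½ (Φ̇/Φ + Φ̄̇/Φ̄) (dt + A)`.
Replacing `T` by `f T` is a change of gauge. -/
structure Induces (Φ : HiggsPair I₂ I₃ J π Ω) (T : Π q : P, TangentSpace I₃ q) {U : Set P}
    (W : WeylStructure I₃ U) : Prop where
  metric : ∀ p ∈ U, ∀ (v : TangentSpace I₃ p) (a b c : ℝ),
    Φ.re p (mfderiv I₃ I₂ π p v) = a • T p → Φ.im p (mfderiv I₃ I₂ π p v) = b • T p →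
    v - Φ.hor p (mfderiv I₃ I₂ π p v) = c • T p → W.g p v v = a ^ 2 + b ^ 2 + c ^ 2
  weyl_hor : ∀ p ∈ U, ∀ X : (Π y : N, TangentSpace I₂ y), SmoothVF I₂ X (π p) →
    VectorField.mlieBracket I₃ (Φ.liftHor X) T p = W.weylForm p (Φ.liftHor X p) • T p
  weyl_vert : ∀ p ∈ U, ∃ k : ℝ, ∀ X : (Π y : N, TangentSpace I₂ y), SmoothVF I₂ X (π p) →
    VectorField.mlieBracket I₃ T (Φ.vecRe X) p
      = (-W.weylForm p (T p)) • Φ.vecRe X p - k • Φ.vecIm X p ∧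
    VectorField.mlieBracket I₃ T (Φ.vecIm X) p
      = k • Φ.vecRe X p + (-W.weylForm p (T p)) • Φ.vecIm X p

end HiggsPair

/-- `T` is a smooth nowhere-vanishing vertical vector field over `Ω` (a gauge; it also orients the
fibres). -/
structure IsVerticalGauge (I₂ : ModelWithCorners ℝ E₂ H₂) (I₃ : ModelWithCorners ℝ E₃ H₃)
    [IsManifold I₃ ∞ P] (π : P → N) (Ω : Set P)
    (T : Π q : P, TangentSpace I₃ q) : Prop where
  smooth : ∀ p ∈ Ω, SmoothVF I₃ T p
  vertical : ∀ p ∈ Ω, mfderiv I₃ I₂ π p (T p) = 0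
  ne_zero : ∀ p ∈ Ω, T p ≠ 0

end Hitchin

end HyperCR

end

/-! In a gauge, the equation D F_i = ω F_i + κ F_i × (·) for an orthonormal frame F says the same as
the structure equations [F_{i+1}, F_{i+2}] = ω(F_{i+1}) F_{i+2} - ω(F_{i+2}) F_{i+1} - 2κ F_i
(`WeylStructure.StructureEq`). One direction is the vanishing of the torsion. For the other, the
connection defined by the frame is torsion-free by the structure equations and conformal because the
cross product is skew, so it is the Weyl connection by Koszul's argument. The Einstein–Weyl equation
is then automatic: the curvature is R_{X,Y} Z = dω(X,Y) Z + β(X) Z×Y - β(Y) Z×X + κ² Z×(X×Y) with β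
= dκ - κω, whose dω and β terms contribute only to the skew part of the Ricci tensor, while the last
one contributes 2κ² g (`WeylStructure.StructureEq.curvature_comp`, `curvForm_trace`).

It remains to match the structure equations with Hitchin's equations. Where φ ≠ 0, a vertical field
T determines a frame with F 0 = T, with F 1 and F 2 horizontal, φ(F 1) = F 0 and φ(F 2) = i F 0
(`HiggsPair.Adapted`). Brackets of lifts with vertical fields are vertical, and φ has type (1,0);
hence, modulo F 0, bracketing with F 0 acts on F 1 and F 2 by a scaling and a rotation. The
definition of ω names the scaling and the vertical parts of these brackets. The curvature equation
identifies the vertical part of [F 1, F 2] with the rate of rotation, and the Higgs equation gives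
its horizontal part. Both implications are comparisons of components
(`HiggsPair.Adapted.structureEq`, `HiggsPair.Adapted.isHitchin`).

Conversely, rotate a hyperCR frame by constants until the given congruence is F 0, and straighten F
0 by a flow box, with π the projection to the leaf space. The structure equations say that dπ(F 1)
and dπ(F 2) are only scaled and rotated along a leaf, so the complex structure turning the first
into the second descends to the leaf space (`LeafSpace.dir_leafJ`); the frame then defines A and φ.
The flow box needs smooth dependence of a flow on its initial point. This comes from the implicit
function theorem for the integral equation in a Banach space of curves, on which composition with a
smooth map is a smooth operation (`contDiff_postcomp`). -/

open VectorField

set_option linter.unusedSectionVars false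

noncomputable section

namespace HyperCR

/-! ### Calculus of smooth functions, vector fields and brackets. -/

section SmoothFields

variable {E : Type*} [NormedAddCommGroup E] [NormedSpace ℝ E]
  {H : Type*} [TopologicalSpace H] {I : ModelWithCorners ℝ E H}
  {M : Type*} [TopologicalSpace M] [ChartedSpace H M]
  {f g : M → ℝ} {p : M}

lemma SmoothFn.add (hf : SmoothFn I f p) (hg : SmoothFn I g p) :
    SmoothFn I (fun q => f q + g q) p := ContMDiffAt.add hf hg

lemma SmoothFn.sub (hf : SmoothFn I f p) (hg : SmoothFn I g p) :
    SmoothFn I (fun q => f q - g q) p := ContMDiffAt.sub hf hg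

lemma SmoothFn.neg (hf : SmoothFn I f p) : SmoothFn I (fun q => -f q) p := ContMDiffAt.neg hf

lemma SmoothFn.mul (hf : SmoothFn I f p) (hg : SmoothFn I g p) :
    SmoothFn I (fun q => f q * g q) p := ContMDiffAt.mul hf hg

lemma SmoothFn.const (c : ℝ) : SmoothFn I (fun _ : M => c) p := contMDiffAt_const

lemma SmoothFn.sum {ι : Type*} {s : Finset ι} {f : ι → M → ℝ}
    (hf : ∀ i ∈ s, SmoothFn I (f i) p) : SmoothFn I (fun q => ∑ i ∈ s, f i q) p :=
  ContMDiffAt.sum hf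

lemma SmoothFn.congr (hf : SmoothFn I f p) (h : ∀ᶠ q in 𝓝 p, g q = f q) : SmoothFn I g p :=
  ContMDiffAt.congr_of_eventuallyEq hf h

lemma SmoothFn.mdiff (hf : SmoothFn I f p) : MDifferentiableAt I 𝓘(ℝ) f p :=
  ContMDiffAt.mdifferentiableAt hf (by simp)

lemma SmoothFn.inv (hf : SmoothFn I f p) (h : f p ≠ 0) : SmoothFn I (fun q => (f q)⁻¹) p :=
  ContMDiffAt.inv₀ hf h

variable [IsManifold I ∞ M] {X Y Z : Π q : M, TangentSpace I q}

lemma isManifold_two : IsManifold I 2 M := IsManifold.of_le (n := ∞) (by norm_cast)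

lemma isManifold_minSmoothness_two : IsManifold I (minSmoothness ℝ 2) M := by
  simpa using isManifold_two

lemma isManifold_minSmoothness_three : IsManifold I (minSmoothness ℝ 3) M := by
  simpa using IsManifold.of_le (n := ∞) (m := 3) (by norm_cast)

attribute [local instance] isManifold_two isManifold_minSmoothness_two
  isManifold_minSmoothness_three

/-- Smoothness at a point means C^n near it for every finite n, on a neighbourhood depending on n.
Only finite order passes to nearby points, and order one suffices for identities that are
differentiated once more. -/
lemma SmoothFn.eventually_mdiff (hf : SmoothFn I f p) :
    ∀ᶠ q in 𝓝 p, MDifferentiableAt I 𝓘(ℝ) f q := by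
  have h1 : ContMDiffAt I 𝓘(ℝ) 1 f p := ContMDiffAt.of_le hf (by simp)
  filter_upwards [(contMDiffAt_iff_contMDiffAt_nhds (by simp)).1 h1] with q hq
    using hq.mdifferentiableAt (by simp)

lemma SmoothVF.add (hX : SmoothVF I X p) (hY : SmoothVF I Y p) :
    SmoothVF I (fun q => X q + Y q) p := ContMDiffAt.add_section hX hY

lemma SmoothVF.sub (hX : SmoothVF I X p) (hY : SmoothVF I Y p) :
    SmoothVF I (fun q => X q - Y q) p := ContMDiffAt.sub_section hX hY

lemma SmoothVF.smul (hf : SmoothFn I f p) (hX : SmoothVF I X p) :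
    SmoothVF I (fun q => f q • X q) p := ContMDiffAt.smul_section hf hX

lemma SmoothVF.const_smul (c : ℝ) (hX : SmoothVF I X p) :
    SmoothVF I (fun q => c • X q) p := ContMDiffAt.const_smul_section hX

lemma SmoothVF.zero : SmoothVF I (fun _ : M => 0) p :=
  (Bundle.contMDiff_zeroSection ℝ (TangentSpace I : M → Type _)).contMDiffAt

lemma SmoothVF.sum {ι : Type*} {s : Finset ι} {X : ι → Π q : M, TangentSpace I q}
    (hX : ∀ i ∈ s, SmoothVF I (X i) p) : SmoothVF I (fun q => ∑ i ∈ s, X i q) p :=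
  ContMDiffAt.sum_section hX

lemma SmoothVF.congr (hX : SmoothVF I X p) (h : ∀ᶠ q in 𝓝 p, Y q = X q) : SmoothVF I Y p :=
  ContMDiffAt.congr_of_eventuallyEq hX (h.mono fun q hq => by simp [hq])

lemma SmoothVF.mdiff (hX : SmoothVF I X p) :
    MDifferentiableAt I I.tangent (fun q => (⟨q, X q⟩ : TangentBundle I M)) p :=
  ContMDiffAt.mdifferentiableAt hX (by simp)

lemma SmoothVF.eventually_mdiff (hX : SmoothVF I X p) :
    ∀ᶠ q in 𝓝 p, MDifferentiableAt I I.tangent (fun q => (⟨q, X q⟩ : TangentBundle I M)) q := by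
  have h1 : ContMDiffAt I I.tangent 1 (fun q => (⟨q, X q⟩ : TangentBundle I M)) p :=
    ContMDiffAt.of_le hX (by simp)
  filter_upwards [(contMDiffAt_iff_contMDiffAt_nhds (by simp)).1 h1] with q hq
    using hq.mdifferentiableAt (by simp)

/-- The derivative of the function `f` along the vector field `X`. -/
def dir (I : ModelWithCorners ℝ E H) (X : Π q : M, TangentSpace I q) (f : M → ℝ) (q : M) : ℝ :=
  mvfderiv I f q (X q)

omit [IsManifold I ∞ M] in
lemma dir_congr (h : ∀ᶠ q in 𝓝 p, f q = g q) : dir I X f p = dir I X g p := by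
  unfold dir mvfderiv
  rw [Filter.EventuallyEq.mfderiv_eq h, h.self_of_nhds]

lemma SmoothFn.dir (hf : SmoothFn I f p) (hX : SmoothVF I X p) : SmoothFn I (dir I X f) p := by
  have h1 := ContMDiffAt.mfderiv_const (m := ∞) hf (by simp)
  have h2 := ContMDiffAt.clm_apply_of_inCoordinates (b₁ := id) (b₂ := f) h1 hX hf
  exact contMDiff_snd_tangentBundle_modelSpace ℝ 𝓘(ℝ) |>.contMDiffAt.comp p h2

lemma dir_mul (hf : SmoothFn I f p) (hg : SmoothFn I g p) :
    dir I X (fun q => f q * g q) p = f p * dir I X g p + g p * dir I X f p := by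
  have := mvfderiv_mul hf.mdiff hg.mdiff
  unfold dir
  change mvfderiv I (f * g) p (X p) = _
  rw [this]; simp

lemma dir_add (hf : SmoothFn I f p) (hg : SmoothFn I g p) :
    dir I X (fun q => f q + g q) p = dir I X f p + dir I X g p := by
  have := mvfderiv_add hf.mdiff hg.mdiff
  unfold dir
  change mvfderiv I (f + g) p (X p) = _
  rw [this]; simp

lemma dir_sub (hf : SmoothFn I f p) (hg : SmoothFn I g p) :
    dir I X (fun q => f q - g q) p = dir I X f p - dir I X g p := by
  have := mvfderiv_sub hf.mdiff hg.mdiff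
  unfold dir
  change mvfderiv I (f - g) p (X p) = _
  rw [this]; simp

lemma dir_const (c : ℝ) : dir I X (fun _ => c) p = 0 := by
  simp [dir, mvfderiv_const]

lemma dir_sum {ι : Type*} {s : Finset ι} {f : ι → M → ℝ} (hf : ∀ i ∈ s, SmoothFn I (f i) p) :
    dir I X (fun q => ∑ i ∈ s, f i q) p = ∑ i ∈ s, dir I X (f i) p := by
  classical
  induction s using Finset.induction_on with
  | empty => simp [dir, mvfderiv_const]
  | insert i s hi ih =>
    simp only [Finset.sum_insert hi]
    rw [dir_add (hf i (by simp)) (SmoothFn.sum fun j hj => hf j (by simp [hj])),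
      ih fun j hj => hf j (by simp [hj])]

variable [CompleteSpace E]

lemma SmoothVF.bracket (hX : SmoothVF I X p) (hY : SmoothVF I Y p) :
    SmoothVF I (mlieBracket I X Y) p := by
  have : IsManifold I (∞ + 1) M := by simpa using (inferInstance : IsManifold I ∞ M)
  exact ContMDiffAt.mlieBracket_vectorField (n := ⊤) (m := ⊤) hX hY (by simp)

lemma bracket_add_right (hY : SmoothVF I Y p) (hZ : SmoothVF I Z p) :
    mlieBracket I X (fun q => Y q + Z q) p = mlieBracket I X Y p + mlieBracket I X Z p := 
  mlieBracket_add_right hY.mdiff hZ.mdiff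

lemma bracket_smul_right (hf : SmoothFn I f p) (hY : SmoothVF I Y p) :
    mlieBracket I X (fun q => f q • Y q) p = dir I X f p • Y p + f p • mlieBracket I X Y p := 
  mlieBracket_smul_right hf.mdiff hY.mdiff

lemma bracket_sum_right {ι : Type*} {s : Finset ι} {Y : ι → Π q : M, TangentSpace I q}
    (hY : ∀ i ∈ s, SmoothVF I (Y i) p) :
    mlieBracket I X (fun q => ∑ i ∈ s, Y i q) p = ∑ i ∈ s, mlieBracket I X (Y i) p := by
  classical
  induction s using Finset.induction_on with
  | empty => 
    simp only [Finset.sum_empty]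
    exact congrFun mlieBracket_zero_right p
  | insert i s hi ih =>
    simp only [Finset.sum_insert hi]
    rw [bracket_add_right (hY i (by simp)) (SmoothVF.sum fun j hj => hY j (by simp [hj])),
      ih fun j hj => hY j (by simp [hj])]

lemma bracket_congr {X' Y' : Π q : M, TangentSpace I q} (hX : ∀ᶠ q in 𝓝 p, X q = X' q)
    (hY : ∀ᶠ q in 𝓝 p, Y q = Y' q) : mlieBracket I X Y p = mlieBracket I X' Y' p :=
  Filter.EventuallyEq.mlieBracket_vectorField_eq hX hY

lemma eventually_bracket_smul_right (hf : SmoothFn I f p) (hY : SmoothVF I Y p) :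
    ∀ᶠ q in 𝓝 p, mlieBracket I X (fun q => f q • Y q) q
      = dir I X f q • Y q + f q • mlieBracket I X Y q := by
  filter_upwards [hf.eventually_mdiff, hY.eventually_mdiff] with q h1 h2
    using mlieBracket_smul_right h1 h2

/-- A vector field bracket acts on functions as the commutator of derivations. -/
lemma dir_bracket (hX : SmoothVF I X p) (hY : SmoothVF I Y p) (hf : SmoothFn I f p) :
    dir I (mlieBracket I X Y) f p = dir I X (dir I Y f) p - dir I Y (dir I X f) p := by
  -- The action on functions is extracted from the Jacobi identity for X, Y and f W, where W does
  -- not vanish at p: after subtracting f times the identity for W, what remains is a multiple of W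
  -- p. If the tangent space is zero, both sides vanish.
  by_cases hw : ∃ w : TangentSpace I p, w ≠ 0
  · obtain ⟨w, hw⟩ := hw
    set W : Π q : M, TangentSpace I q := FiberBundle.extend E w
    have hW : SmoothVF I W p := FiberBundle.contMDiffAt_extend I E w
    have hWp : W p ≠ 0 := by simpa [W] using hw
    have key := leibniz_identity_mlieBracket_apply (I := I) (x := p) (U := X) (V := Y)
      (W := fun q => f q • W q) (ContMDiffAt.of_le hX (by simp; norm_cast)) (ContMDiffAt.of_le hY (by simp; norm_cast))
      (ContMDiffAt.of_le (hW.smul hf) (by simp; norm_cast))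
    rw [bracket_congr (Filter.Eventually.of_forall fun _ => rfl)
      (eventually_bracket_smul_right (X := Y) hf hW),
      bracket_congr (X := Y) (Filter.Eventually.of_forall fun _ => rfl)
      (eventually_bracket_smul_right (X := X) hf hW),
      bracket_smul_right hf hW,
      bracket_add_right (hW.smul (hf.dir hY)) ((hY.bracket hW).smul hf),
      bracket_add_right (hW.smul (hf.dir hX)) ((hX.bracket hW).smul hf),
      bracket_smul_right (hf.dir hY) hW, bracket_smul_right (hf.dir hX) hW,
      bracket_smul_right hf (hY.bracket hW), bracket_smul_right hf (hX.bracket hW),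
      leibniz_identity_mlieBracket_apply (I := I) (x := p) (U := X) (V := Y) (W := W)
       (ContMDiffAt.of_le hX (by simp; norm_cast)) (ContMDiffAt.of_le hY (by simp; norm_cast))
       (ContMDiffAt.of_le hW (by simp; norm_cast))] at key
    have : (dir I (mlieBracket I X Y) f p - (dir I X (dir I Y f) p - dir I Y (dir I X f) p)) • W p
        = 0 := by
      linear_combination (norm := module) (-1 : ℝ) • key
    exact sub_eq_zero.1 ((smul_eq_zero.1 this).resolve_right hWp)
  · push Not at hw
    simp [dir, hw (mlieBracket I X Y p), hw (X p), hw (Y p)]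

end SmoothFields

/-! ### Smooth 1-forms and local frames. -/

section Forms

variable {E : Type*} [NormedAddCommGroup E] [NormedSpace ℝ E] [FiniteDimensional ℝ E]
  {H : Type*} [TopologicalSpace H] {I : ModelWithCorners ℝ E H}
  {M : Type*} [TopologicalSpace M] [ChartedSpace H M] [IsManifold I ∞ M] {p : M}

/-- The `1`-form `α` is smooth at `p`. -/
def SmoothForm (I : ModelWithCorners ℝ E H) [IsManifold I ∞ M]
    (α : Π q : M, TangentSpace I q →L[ℝ] ℝ) (p : M) : Prop :=
  ∀ X : Π q : M, TangentSpace I q, SmoothVF I X p → SmoothFn I (fun q => α q (X q)) p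

lemma exists_smoothVF (v : TangentSpace I p) :
    ∃ X : Π q : M, TangentSpace I q, SmoothVF I X p ∧ X p = v :=
  ⟨FiberBundle.extend E v, FiberBundle.contMDiffAt_extend I E v, by simp⟩

/-- A vector field is a combination of smooth ones, with coefficients as regular as the field. -/
lemma exists_localFrame (p : M) :
    ∃ (n : ℕ) (L : Fin n → Π q : M, TangentSpace I q)
      (c : Fin n → Π q : M, TangentSpace I q →ₗ[ℝ] ℝ),
      (∀ i, SmoothVF I (L i) p) ∧ (∀ᶠ q in 𝓝 p, ∀ v : TangentSpace I q, v = ∑ i, c i q v • L i q) ∧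
      (∀ i (X : Π q : M, TangentSpace I q), SmoothVF I X p → SmoothFn I (fun q => c i q (X q)) p) ∧
      ∀ i (X : Π q : M, TangentSpace I q),
        MDifferentiableAt I I.tangent (fun q => (⟨q, X q⟩ : TangentBundle I M)) p →
          MDifferentiableAt I 𝓘(ℝ) (fun q => c i q (X q)) p := by
  let e := trivializationAt E (TangentSpace I : M → Type _) p
  have hp : p ∈ e.baseSet := FiberBundle.mem_baseSet_trivializationAt' p
  let b := Module.finBasis ℝ E
  refine ⟨Module.finrank ℝ E, e.localFrame b, e.localFrameCoeff I b,
    fun i => contMDiffAt_localFrame_of_mem _ e b i hp, ?_, ?_, ?_⟩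
  · filter_upwards [e.open_baseSet.mem_nhds hp] with q hq v
    have := e.eq_sum_localFrameCoeff_smul (I := I) (b := b) (s := FiberBundle.extend E v) hq
    simpa using this
  · intro i X hX
    exact contMDiffAt_localFrameCoeff b hp hX i
  · intro i X hX
    exact mdifferentiableAt_localFrameCoeff b hp hX i

/-- `SmoothForm` tests a form on smooth fields only, but the axioms of a covariant derivative
concern fields that are merely differentiable; expansion in a smooth local frame bridges the two. -/
lemma SmoothForm.mdiff {α : Π q : M, TangentSpace I q →L[ℝ] ℝ} (hα : SmoothForm I α p)
    {X : Π q : M, TangentSpace I q}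
    (hX : MDifferentiableAt I I.tangent (fun q => (⟨q, X q⟩ : TangentBundle I M)) p) :
    MDifferentiableAt I 𝓘(ℝ) (fun q => α q (X q)) p := by
  obtain ⟨n, L, c, hL, hexp, -, hc⟩ := exists_localFrame (I := I) p
  have : MDifferentiableAt I 𝓘(ℝ) (fun q => ∑ i, c i q (X q) * α q (L i q)) p :=
    by
      have := MDifferentiableAt.sum (t := Finset.univ)
        fun i _ => (hc i X hX).mul (hα _ (hL i)).mdiff
      convert! this using 1
      ext q
      simp
  refine this.congr_of_eventuallyEq ?_
  filter_upwards [hexp] with q hq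
  conv_lhs => rw [hq (X q)]
  simp

end Forms

/-! ### Brackets of vector fields related by a map. -/

section Related

variable {E : Type*} [NormedAddCommGroup E] [NormedSpace ℝ E] [FiniteDimensional ℝ E]
  {H : Type*} [TopologicalSpace H] {I : ModelWithCorners ℝ E H} 
  {M : Type*} [TopologicalSpace M] [ChartedSpace H M] [IsManifold I ∞ M]
  {E' : Type*} [NormedAddCommGroup E'] [NormedSpace ℝ E'] [FiniteDimensional ℝ E']
  {H' : Type*} [TopologicalSpace H'] {I' : ModelWithCorners ℝ E' H'} [I'.Boundaryless]
  {N : Type*} [TopologicalSpace N] [ChartedSpace H' N] [IsManifold I' ∞ N]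
  {π : M → N} {p : M}

/-- Smooth functions separate tangent vectors. -/
lemma eq_of_forall_mvfderiv {y : N} {v w : TangentSpace I' y}
    (h : ∀ f : N → ℝ, SmoothFn I' f y → mvfderiv I' f y v = mvfderiv I' f y w) : v = w := by
  have hinj : Function.Injective (mfderiv I' 𝓘(ℝ, E') (extChartAt I' y) y) :=
    (isInvertible_mfderiv_extChartAt (I := I') (mem_extChartAt_source y)).injective
  apply hinj
  have hφ : ContMDiffAt I' 𝓘(ℝ, E') ∞ (extChartAt I' y) y := contMDiffAt_extChartAt
  refine (SeparatingDual.eq_iff_forall_dual_eq (R := ℝ) (V := E')).2 fun l => ?_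
  have hl : SmoothFn I' (fun q => l (extChartAt I' y q)) y :=
    l.contMDiff.contMDiffAt.comp y hφ
  have key : ∀ v, mvfderiv I' (fun q => l (extChartAt I' y q)) y v
      = l (mfderiv I' 𝓘(ℝ, E') (extChartAt I' y) y v) := by
    intro v
    have := mvfderiv_comp_apply (I := 𝓘(ℝ, E')) (I' := I') y
      (l.contMDiff.contMDiffAt.mdifferentiableAt (x := extChartAt I' y y) (n := 1) (by simp))
      (hφ.mdifferentiableAt (by simp)) v
    refine this.trans ?_
    simp [mvfderiv, mfderiv_eq_fderiv]
    rfl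
  have := h _ hl
  rwa [key, key] at this

lemma dir_comp (hπ : ContMDiffAt I I' ∞ π p) {X : Π q : M, TangentSpace I q}
    {Y : Π y : N, TangentSpace I' y} (hXY : mfderiv I I' π p (X p) = Y (π p))
    {f : N → ℝ} (hf : MDifferentiableAt I' 𝓘(ℝ) f (π p)) :
    dir I X (fun q => f (π q)) p = dir I' Y f (π p) := by
  have := mvfderiv_comp_apply p hf (hπ.mdifferentiableAt (by simp)) (X p)
  unfold dir
  rw [← hXY, ← this]
  rfl

/-- Test functions pulled back from N see the related fields as the same derivations, X_i (f ∘ π) =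
(Y_i f) ∘ π near p, so the commutators agree as well. -/
lemma mfderiv_bracket_of_related (hπ : ContMDiffAt I I' ∞ π p)
    {X₁ X₂ : Π q : M, TangentSpace I q} {Y₁ Y₂ : Π y : N, TangentSpace I' y}
    (hX₁ : SmoothVF I X₁ p) (hX₂ : SmoothVF I X₂ p)
    (hY₁ : SmoothVF I' Y₁ (π p)) (hY₂ : SmoothVF I' Y₂ (π p))
    (h₁ : ∀ᶠ q in 𝓝 p, mfderiv I I' π q (X₁ q) = Y₁ (π q))
    (h₂ : ∀ᶠ q in 𝓝 p, mfderiv I I' π q (X₂ q) = Y₂ (π q)) :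
    mfderiv I I' π p (mlieBracket I X₁ X₂ p) = mlieBracket I' Y₁ Y₂ (π p) := by
  refine eq_of_forall_mvfderiv fun f hf => ?_
  have hf' : SmoothFn I (fun q => f (π q)) p := ContMDiffAt.comp p hf hπ
  have hev : ∀ᶠ q in 𝓝 p, ContMDiffAt I I' 1 π q :=
    (contMDiffAt_iff_contMDiffAt_nhds (by simp)).1 (ContMDiffAt.of_le hπ (by simp))
  have hfev : ∀ᶠ q in 𝓝 p, MDifferentiableAt I' 𝓘(ℝ) f (π q) :=
    hπ.continuousAt.eventually hf.eventually_mdiff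
  have hd : ∀ (X : Π q : M, TangentSpace I q) (Y : Π y : N, TangentSpace I' y),
      (∀ᶠ q in 𝓝 p, mfderiv I I' π q (X q) = Y (π q)) →
      ∀ᶠ q in 𝓝 p, dir I X (fun q => f (π q)) q = dir I' Y f (π q) := by
    intro X Y h
    filter_upwards [h, hev, hfev] with q hq h1 h2
    have := mvfderiv_comp_apply q h2 (h1.mdifferentiableAt (by simp)) (X q)
    unfold dir
    rw [← hq, ← this]
    rfl
  have e1 : mvfderiv I' f (π p) (mfderiv I I' π p (mlieBracket I X₁ X₂ p))
      = dir I (mlieBracket I X₁ X₂) (fun q => f (π q)) p :=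
    (mvfderiv_comp_apply p hf.mdiff (hπ.mdifferentiableAt (by simp)) _).symm
  rw [e1, dir_bracket hX₁ hX₂ hf', dir_congr (hd _ _ h₁), dir_congr (hd _ _ h₂),
    dir_comp hπ h₁.self_of_nhds (hf.dir hY₂).mdiff, dir_comp hπ h₂.self_of_nhds (hf.dir hY₁).mdiff]
  exact (dir_bracket hY₁ hY₂ hf).symm

end Related

/-! ### Frames and dual coframes. -/

section Frames

variable {E : Type*} [NormedAddCommGroup E] [NormedSpace ℝ E] [FiniteDimensional ℝ E]
  {H : Type*} [TopologicalSpace H] {I : ModelWithCorners ℝ E H}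
  {M : Type*} [TopologicalSpace M] [ChartedSpace H M] [IsManifold I ∞ M] {p : M}

/-- The coefficients of a smooth vector field with respect to smooth vector fields which form a
basis at `p` are smooth. -/
lemma smoothFn_coeff (hE : Module.finrank ℝ E = 3) {F : Fin 3 → Π q : M, TangentSpace I q}
    (hF : ∀ i, SmoothVF I (F i) p) (hli : LinearIndependent ℝ fun i => F i p)
    {X : Π q : M, TangentSpace I q} (hX : SmoothVF I X p) {x : Fin 3 → M → ℝ}
    (hx : ∀ᶠ q in 𝓝 p, X q = ∑ i, x i q • F i q) (i : Fin 3) : SmoothFn I (x i) p := by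
  let t := trivializationAt E (TangentSpace I : M → Type _) p
  have hp : p ∈ t.baseSet := FiberBundle.mem_baseSet_trivializationAt' p
  have hsm : ∀ {Y : Π q : M, TangentSpace I q}, SmoothVF I Y p →
      ContMDiffAt I 𝓘(ℝ, E) ∞ (fun q => (t ⟨q, Y q⟩).2) p :=
    fun hY => (t.contMDiffAt_section_iff hp).1 hY
  -- In a trivialization the frame is a matrix A q depending smoothly on q and invertible at p; the
  -- coefficients of X are obtained by applying its inverse, and inversion is a smooth operation.
  let A : M → (Fin 3 → ℝ) →L[ℝ] E := fun q =>
    ∑ i, (ContinuousLinearMap.proj (R := ℝ) i).smulRight (t ⟨q, F i q⟩).2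
  have hA : ContMDiffAt I 𝓘(ℝ, (Fin 3 → ℝ) →L[ℝ] E) ∞ A p := by
    refine ContMDiffAt.sum fun i _ => ?_
    exact ((ContinuousLinearMap.smulRightL ℝ (Fin 3 → ℝ) E
      (ContinuousLinearMap.proj (R := ℝ) i)).contMDiff.contMDiffAt).comp p (hsm (hF i))
  have hAp : ∀ q ∈ t.baseSet, ∀ c, A q c = (t ⟨q, ∑ i, c i • F i q⟩).2 := by
    intro q hq c
    have h1 : ∀ v : TangentSpace I q, (t ⟨q, v⟩).2 = t.linearEquivAt ℝ q hq v := fun v => by simp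
    simp only [h1, map_sum, map_smul, A, sum_apply,
      ContinuousLinearMap.smulRight_apply, ContinuousLinearMap.proj_apply]
  have hinj : Function.Injective (A p) := by
    rw [injective_iff_map_eq_zero]
    intro c hc
    rw [hAp p hp] at hc
    have h2 : ∑ i, c i • F i p = 0 := (t.linearEquivAt ℝ p hp).map_eq_zero_iff.1 hc
    exact funext (Fintype.linearIndependent_iff.1 hli c h2)
  have hfr : Module.finrank ℝ (Fin 3 → ℝ) = Module.finrank ℝ E := by simp [hE]
  let L : (Fin 3 → ℝ) ≃L[ℝ] E := (LinearEquiv.ofInjectiveOfFinrankEq (A p : (Fin 3 → ℝ) →ₗ[ℝ] E) hinj hfr).toContinuousLinearEquiv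
  have hL : (L : (Fin 3 → ℝ) →L[ℝ] E) = A p := by ext; rfl
  have hinv : ContMDiffAt I 𝓘(ℝ, E →L[ℝ] (Fin 3 → ℝ)) ∞ (fun q => (A q).inverse) p := by
    have := (contDiffAt_map_inverse (n := ∞) L).contMDiffAt
    rw [hL] at this
    exact this.comp p hA
  have hfin : ContMDiffAt I 𝓘(ℝ, Fin 3 → ℝ) ∞ (fun q => (A q).inverse (t ⟨q, X q⟩).2) p :=
    hinv.clm_apply (hsm hX)
  have hi : SmoothFn I (fun q => (A q).inverse (t ⟨q, X q⟩).2 i) p :=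
    ((ContinuousLinearMap.proj (R := ℝ) (φ := fun _ : Fin 3 => ℝ) i).contMDiff.contMDiffAt).comp p
      hfin
  have hinvert : ∀ᶠ q in 𝓝 p, A q ∈ Set.range ((↑) : ((Fin 3 → ℝ) ≃L[ℝ] E) → _) :=
    hA.continuousAt.eventually (by rw [← hL]; exact ContinuousLinearEquiv.nhds L)
  refine hi.congr ?_
  filter_upwards [hx, hinvert, t.open_baseSet.mem_nhds hp] with q hq ⟨L', hL'⟩ hqt
  rw [hq, ← hAp q hqt (fun i => x i q), ← hL']
  simp

variable (I) in
/-- `e` is the coframe dual to the smooth frame `F` on the open set `U`. -/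
structure Coframe (U : Set M) (F : Fin 3 → Π q : M, TangentSpace I q)
    (e : Fin 3 → Π q : M, TangentSpace I q →L[ℝ] ℝ) : Prop where
  isOpen : IsOpen U
  smooth : ∀ p ∈ U, ∀ i, SmoothVF I (F i) p
  dual : ∀ p ∈ U, ∀ i j, e i p (F j p) = if i = j then 1 else 0
  expand : ∀ p ∈ U, ∀ v : TangentSpace I p, v = ∑ i, e i p v • F i p
  smooth_form : ∀ p ∈ U, ∀ i, SmoothForm I (e i) p

variable {U : Set M} {F : Fin 3 → Π q : M, TangentSpace I q}
  {e : Fin 3 → Π q : M, TangentSpace I q →L[ℝ] ℝ} {X Y : Π q : M, TangentSpace I q}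

lemma Coframe.ext (h : Coframe I U F e) (hp : p ∈ U) {v w : TangentSpace I p}
    (hvw : ∀ i, e i p v = e i p w) : v = w := by
  rw [h.expand p hp v, h.expand p hp w]; simp only [hvw]

lemma Coframe.dir_eq (h : Coframe I U F e) (hp : p ∈ U) (X : Π q : M, TangentSpace I q)
    (f : M → ℝ) : dir I X f p = ∑ i, e i p (X p) * dir I (F i) f p := by
  unfold dir
  conv_lhs => rw [h.expand p hp (X p)]
  simp

/-- The components of the bracket of two vector fields in a frame. -/
lemma Coframe.bracket (h : Coframe I U F e) (hp : p ∈ U) (hX : SmoothVF I X p)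
    (hY : SmoothVF I Y p) (k : Fin 3) :
    e k p (mlieBracket I X Y p) = dir I X (fun q => e k q (Y q)) p
      - dir I Y (fun q => e k q (X q)) p
      + ∑ i, ∑ j, e i p (X p) * e j p (Y p) * e k p (mlieBracket I (F i) (F j) p) := by
  have hnhds : ∀ᶠ q in 𝓝 p, q ∈ U := h.isOpen.mem_nhds hp
  have aux : ∀ Z Y : Π q : M, TangentSpace I q, SmoothVF I Y p →
      mlieBracket I Z Y p = ∑ j, (dir I Z (fun q => e j q (Y q)) p • F j p
        + e j p (Y p) • mlieBracket I Z (F j) p) := by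
    intro Z Y hY
    rw [bracket_congr (X' := Z) (Y' := fun q => ∑ j, e j q (Y q) • F j q)
      (Filter.Eventually.of_forall fun _ => rfl) (hnhds.mono fun q hq => h.expand q hq (Y q)),
      bracket_sum_right fun j _ => (h.smooth p hp j).smul (h.smooth_form p hp j Y hY)]
    refine Finset.sum_congr rfl fun j _ => ?_
    rw [bracket_smul_right (h.smooth_form p hp j Y hY) (h.smooth p hp j)]
  have aux2 : ∀ j, mlieBracket I X (F j) p = - ∑ i, (dir I (F j) (fun q => e i q (X q)) p • F i p
        - e i p (X p) • mlieBracket I (F i) (F j) p) := by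
    intro j
    rw [mlieBracket_swap_apply, aux _ _ hX]
    congr 1
    refine Finset.sum_congr rfl fun i _ => ?_
    rw [mlieBracket_swap_apply (V := F j)]
    module
  rw [aux _ _ hY, h.dir_eq hp Y]
  simp only [aux2, map_add, map_smul, map_neg, map_sub, h.dual p hp, smul_eq_mul,
    Fin.sum_univ_three]
  fin_cases k <;> simp <;> ring

end Frames

/-- The cross product. -/
def cross (a b : Fin 3 → ℝ) (k : Fin 3) : ℝ := a (k + 1) * b (k + 2) - a (k + 2) * b (k + 1)

/-- Alternating the two symmetries six times restores the order of the indices after three changes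
of sign. The difference of two Weyl connections has these symmetries. -/
lemma koszul_zero {S : Fin 3 → Fin 3 → Fin 3 → ℝ} (h₁ : ∀ i j k, S i j k = -S i k j)
    (h₂ : ∀ i j k, S i j k = S j i k) (i j k : Fin 3) : S i j k = 0 := by
  linarith [h₁ i j k, h₂ i k j, h₁ k i j, h₂ k j i, h₁ j k i, h₂ j i k]

/-! ### Structure equations, the Weyl connection and its curvature. -/

section WeylFrames

variable {E : Type*} [NormedAddCommGroup E] [NormedSpace ℝ E] [FiniteDimensional ℝ E]
  {H : Type*} [TopologicalSpace H] {I : ModelWithCorners ℝ E H}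
  {M : Type*} [TopologicalSpace M] [ChartedSpace H M] [IsManifold I ∞ M] {p : M}
  {U : Set M} {F : Fin 3 → Π q : M, TangentSpace I q}
  {e : Fin 3 → Π q : M, TangentSpace I q →L[ℝ] ℝ} {X Y Z : Π q : M, TangentSpace I q}
  {W : WeylStructure I U} {κ : M → ℝ}
  {D : (Π q : M, TangentSpace I q) → (Π q : M, TangentSpace I q →L[ℝ] TangentSpace I q)}

/-- An orthonormal frame and its dual coframe. -/
lemma coframe_of_orthonormal (hE : Module.finrank ℝ E = 3) (hU : IsOpen U)
    (hF : ∀ p ∈ U, ∀ i, SmoothVF I (F i) p)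
    (ho : ∀ p ∈ U, ∀ i j, W.g p (F i p) (F j p) = if i = j then 1 else 0) :
    Coframe I U F (fun i q => W.g q (F i q)) where
  isOpen := hU
  smooth := hF
  dual := ho
  expand p hp v := by
    have hli : LinearIndependent ℝ fun i => F i p := by
      rw [Fintype.linearIndependent_iff]
      intro c hc j
      have := congrArg (W.g p (F j p)) hc
      simpa [ho p hp] using this
    have : FiniteDimensional ℝ (TangentSpace I p) := inferInstanceAs (FiniteDimensional ℝ E)
    have hfr : Module.finrank ℝ (TangentSpace I p) = 3 := hE
    have hspan := hli.span_eq_top_of_card_eq_finrank' (by simp [hfr])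
    obtain ⟨c, hc⟩ := (Submodule.mem_span_range_iff_exists_fun ℝ).1
      (hspan ▸ Submodule.mem_top : v ∈ Submodule.span ℝ (Set.range fun i => F i p))
    rw [← hc]
    refine Finset.sum_congr rfl fun i _ => ?_
    simp [ho p hp]
  smooth_form p hp i X hX := W.smooth_g p hp _ _ (hF p hp i) hX

/-- The frame `F` is orthonormal for `W`, with dual coframe `e`. -/
structure WeylStructure.IsOrthonormal (W : WeylStructure I U)
    (F : Fin 3 → Π q : M, TangentSpace I q)
    (e : Fin 3 → Π q : M, TangentSpace I q →L[ℝ] ℝ) : Prop extends Coframe I U F e where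
  metric : ∀ p ∈ U, ∀ v w, W.g p v w = ∑ i, e i p v * e i p w

lemma WeylStructure.IsOrthonormal.g_frame (h : W.IsOrthonormal F e) (hp : p ∈ U) (i : Fin 3)
    (v : TangentSpace I p) : W.g p (F i p) v = e i p v := by
  simp [h.metric p hp, h.dual p hp]

lemma isOrthonormal_of_orthonormal (hE : Module.finrank ℝ E = 3) (hU : IsOpen U)
    (hF : ∀ p ∈ U, ∀ i, SmoothVF I (F i) p)
    (ho : ∀ p ∈ U, ∀ i j, W.g p (F i p) (F j p) = if i = j then 1 else 0) :
    W.IsOrthonormal F (fun i q => W.g q (F i q)) where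
  toCoframe := coframe_of_orthonormal hE hU hF ho
  metric p hp v w := by
    have h := coframe_of_orthonormal hE hU hF ho
    conv_lhs => rw [h.expand p hp v]
    simp

/-- The structure equations of a frame which amount to `D F_i = ω F_i + κ F_i ×`. -/
structure WeylStructure.StructureEq (W : WeylStructure I U) (F : Fin 3 → Π q : M, TangentSpace I q)
    (e : Fin 3 → Π q : M, TangentSpace I q →L[ℝ] ℝ) (κ : M → ℝ) : Prop
    extends W.IsOrthonormal F e where
  smooth_κ : ∀ p ∈ U, SmoothFn I κ p
  bracket_frame : ∀ p ∈ U, ∀ i, mlieBracket I (F (i + 1)) (F (i + 2)) p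
    = W.weylForm p (F (i + 1) p) • F (i + 2) p - W.weylForm p (F (i + 2) p) • F (i + 1) p
      - (2 * κ p) • F i p

lemma WeylStructure.StructureEq.weylForm_eq (h : W.StructureEq F e κ) (hp : p ∈ U)
    (v : TangentSpace I p) : W.weylForm p v = ∑ i, W.weylForm p (F i p) * e i p v := by
  conv_lhs => rw [h.expand p hp v]
  simp [mul_comm]

/-- The structure equations extended by the Leibniz rule to arbitrary fields, which is the form used
for torsion and curvature. -/
lemma WeylStructure.StructureEq.bracket_apply (h : W.StructureEq F e κ) (hp : p ∈ U)
    (hX : SmoothVF I X p) (hY : SmoothVF I Y p) (k : Fin 3) :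
    e k p (mlieBracket I X Y p) = dir I X (fun q => e k q (Y q)) p
      - dir I Y (fun q => e k q (X q)) p
      + W.weylForm p (X p) * e k p (Y p) - W.weylForm p (Y p) * e k p (X p)
      - 2 * κ p * cross (fun i => e i p (X p)) (fun i => e i p (Y p)) k := by
  have h0 := h.bracket_frame p hp 0
  have h1 := h.bracket_frame p hp 1
  have h2 := h.bracket_frame p hp 2
  simp only [zero_add, show (1 + 1 : Fin 3) = 2 from rfl, show (1 + 2 : Fin 3) = 0 from rfl,
    show (2 + 1 : Fin 3) = 0 from rfl, show (2 + 2 : Fin 3) = 1 from rfl] at h0 h1 h2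
  rw [h.toCoframe.bracket hp hX hY k, h.weylForm_eq hp (X p), h.weylForm_eq hp (Y p)]
  simp only [Fin.sum_univ_three, mlieBracket_self, h0, h1, h2,
    mlieBracket_swap_apply (V := F 1) (W := F 0), mlieBracket_swap_apply (V := F 0) (W := F 2),
    mlieBracket_swap_apply (V := F 2) (W := F 1), Pi.zero_apply, map_zero, map_neg, map_sub,
    map_smul, h.dual p hp, smul_eq_mul, cross]
  fin_cases k <;> simp <;> ring

/-- The Weyl connection of a frame satisfying the structure equations. -/
def frameConnection (W : WeylStructure I U) (F : Fin 3 → Π q : M, TangentSpace I q)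
    (e : Fin 3 → Π q : M, TangentSpace I q →L[ℝ] ℝ) (κ : M → ℝ)
    (Y : Π q : M, TangentSpace I q) (q : M) : TangentSpace I q →L[ℝ] TangentSpace I q :=
  ∑ k, ((mvfderiv I (fun q => e k q (Y q)) q).smulRight (F k q)
    + e k q (Y q) • ((W.weylForm q).smulRight (F k q)
      + κ q • ((e (k + 1) q).smulRight (F (k + 2) q) - (e (k + 2) q).smulRight (F (k + 1) q))))

lemma Coframe.frameConnection_comp (h : Coframe I U F e) (hp : p ∈ U)
    (v : TangentSpace I p) (m : Fin 3) :
    e m p (frameConnection W F e κ Y p v) = mvfderiv I (fun q => e m q (Y q)) p v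
      + W.weylForm p v * e m p (Y p)
      + κ p * cross (fun i => e i p (Y p)) (fun i => e i p v) m := by
  unfold frameConnection cross
  simp only [Fin.sum_univ_three, add_apply, smul_apply, sub_apply,
    ContinuousLinearMap.smulRight_apply, map_add, map_sub, map_smul, h.dual p hp, smul_eq_mul]
  fin_cases m <;> simp <;> ring

lemma Coframe.isCovariantDerivativeOn (h : Coframe I U F e) :
    IsCovariantDerivativeOn E (frameConnection W F e κ) U where
  add {σ σ' x} hσ hσ' hx := by
    ext v
    refine h.ext hx fun m => ?_
    have := mvfderiv_add ((h.smooth_form x hx m).mdiff hσ) ((h.smooth_form x hx m).mdiff hσ')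
    have h2 : mvfderiv I (fun q => e m q ((σ + σ') q)) x
      = mvfderiv I (fun q => e m q (σ q)) x + mvfderiv I (fun q => e m q (σ' q)) x := by
      rw [← this]; congr 1; ext q; simp
    rw [add_apply, map_add, h.frameConnection_comp hx, h.frameConnection_comp hx,
      h.frameConnection_comp hx, h2]
    simp [cross]; ring
  leibniz {σ g x} hσ hg hx := by
    ext v
    refine h.ext hx fun m => ?_
    have := mvfderiv_mul hg ((h.smooth_form x hx m).mdiff hσ)
    have h2 : mvfderiv I (fun q => e m q ((g • σ) q)) x
      = g x • mvfderiv I (fun q => e m q (σ q)) x + e m x (σ x) • mvfderiv I g x := by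
      rw [← this]; congr 1; ext q; simp
    rw [add_apply, map_add, h.frameConnection_comp hx, smul_apply, map_smul,
      h.frameConnection_comp hx, h2]
    simp [cross]; ring

lemma Coframe.smoothVF (h : Coframe I U F e) (hp : p ∈ U)
    (hX : ∀ i, SmoothFn I (fun q => e i q (X q)) p) : SmoothVF I X p := by
  refine SmoothVF.congr (X := fun q => ∑ i, e i q (X q) • F i q)
    (SmoothVF.sum fun i _ => (h.smooth p hp i).smul (hX i)) ?_
  filter_upwards [h.isOpen.mem_nhds hp] with q hq using h.expand q hq _

/-- Torsion: the terms κ Y×X and -κ X×Y combine to the -2κ X×Y of the bracket. Conformality: the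
cross product terms cancel, as ⟨Y×v, Z⟩ + ⟨Y, Z×v⟩ = 0, and the two terms with ω give the right-hand
side. -/
lemma WeylStructure.StructureEq.isWeylConnection (h : W.StructureEq F e κ) :
    W.IsWeylConnection (frameConnection W F e κ) where
  isCovariantDerivative := h.isCovariantDerivativeOn
  smooth p hp X Y hX hY := by
    refine h.smoothVF hp fun m => ?_
    have hs := fun i => h.smooth_form p hp i X hX
    have ht := fun i => h.smooth_form p hp i Y hY
    refine SmoothFn.congr ((((ht m).dir hX).add ((W.smooth_weylForm p hp X hX).mul (ht m))).add
      ((h.smooth_κ p hp).mul (((ht (m + 1)).mul (hs (m + 2))).sub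
        ((ht (m + 2)).mul (hs (m + 1)))))) ?_
    filter_upwards [h.isOpen.mem_nhds hp] with q hq
    rw [h.frameConnection_comp hq]
    rfl
  torsion_free p hp X Y hX hY := by
    refine h.ext hp fun k => ?_
    rw [map_sub, h.bracket_apply hp hX hY, h.frameConnection_comp hp, h.frameConnection_comp hp]
    simp only [dir, cross]
    ring
  conformal p hp Y Z hY hZ v := by
    have hs := fun i => h.smooth_form p hp i Y hY
    have ht := fun i => h.smooth_form p hp i Z hZ
    obtain ⟨V, hV, rfl⟩ := exists_smoothVF v
    change dir I V _ p - _ - _ = _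
    rw [dir_congr (g := fun q => e 0 q (Y q) * e 0 q (Z q) + e 1 q (Y q) * e 1 q (Z q)
      + e 2 q (Y q) * e 2 q (Z q)) (by
        filter_upwards [h.isOpen.mem_nhds hp] with q hq
        rw [h.metric q hq, Fin.sum_univ_three]),
      dir_add (((hs 0).mul (ht 0)).add ((hs 1).mul (ht 1))) ((hs 2).mul (ht 2)),
      dir_add ((hs 0).mul (ht 0)) ((hs 1).mul (ht 1)), dir_mul (hs 0) (ht 0),
      dir_mul (hs 1) (ht 1), dir_mul (hs 2) (ht 2)]
    simp only [h.metric p hp, Fin.sum_univ_three, h.frameConnection_comp hp, cross, dir]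
    simp
    ring

/-- The Weyl connection is unique: Koszul's argument. -/
lemma WeylStructure.IsOrthonormal.connection_unique (h : W.IsOrthonormal F e)
    {D' : (Π q : M, TangentSpace I q) → (Π q : M, TangentSpace I q →L[ℝ] TangentSpace I q)}
    (hD : W.IsWeylConnection D) (hD' : W.IsWeylConnection D') (hp : p ∈ U) (j : Fin 3) :
    D (F j) p = D' (F j) p := by
  have hs := h.smooth p hp
  have key := koszul_zero
    (S := fun i j k => e k p (D (F j) p (F i p)) - e k p (D' (F j) p (F i p))) (by
      intro i j k
      have h1 := hD.conformal p hp _ _ (hs j) (hs k) (F i p)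
      have h2 := hD'.conformal p hp _ _ (hs j) (hs k) (F i p)
      rw [h.g_frame hp, W.symm p hp _ (F k p), h.g_frame hp] at h1 h2
      linarith) (by
      intro i j k
      have h1 := hD.torsion_free p hp _ _ (hs i) (hs j)
      rw [← hD'.torsion_free p hp _ _ (hs i) (hs j)] at h1
      have h2 := congrArg (e k p) h1
      simp only [map_sub] at h2
      linarith)
  ext v
  rw [h.expand p hp v, map_sum, map_sum]
  refine Finset.sum_congr rfl fun i _ => ?_
  rw [map_smul, map_smul]
  congr 1
  exact h.ext hp fun k => sub_eq_zero.1 (key i j k)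

/-- The equation of a hyperCR frame, in terms of the coframe. -/
lemma WeylStructure.StructureEq.hyperCR_eqn (h : W.StructureEq F e κ) (hD : W.IsWeylConnection D)
    (hp : p ∈ U) (i : Fin 3) (v : TangentSpace I p) :
    D (F i) p v = W.weylForm p v • F i p
      + κ p • (W.g p (F (i + 1) p) v • F (i + 2) p - W.g p (F (i + 2) p) v • F (i + 1) p) := by
  rw [h.connection_unique hD h.isWeylConnection hp i]
  refine h.ext hp fun m => ?_
  have h0 : mvfderiv I (fun q => e m q (F i q)) p v = 0 := by
    obtain ⟨V, hV, rfl⟩ := exists_smoothVF v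
    change dir I V _ p = 0
    rw [dir_congr (g := fun q => if m = i then 1 else 0), dir_const]
    filter_upwards [h.isOpen.mem_nhds hp] with q hq using h.dual q hq m i
  rw [h.frameConnection_comp hp, h0]
  simp only [h.g_frame hp, map_add, map_sub, map_smul, h.dual p hp, cross, smul_eq_mul]
  fin_cases m <;> fin_cases i <;> simp

lemma WeylStructure.StructureEq.isHyperCRFrame (h : W.StructureEq F e κ)
    (hD : W.IsWeylConnection D) : W.IsHyperCRFrame D F κ where
  smooth := h.smooth
  smooth_κ := h.smooth_κ
  orthonormal p hp i j := by rw [h.g_frame hp, h.dual p hp]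
  eqn p hp i v := h.hyperCR_eqn hD hp i v

lemma WeylStructure.IsHyperCRFrame.structureEq (hE : Module.finrank ℝ E = 3) (hU : IsOpen U)
    (h : W.IsHyperCRFrame D F κ) (hD : W.IsWeylConnection D) :
    W.StructureEq F (fun i q => W.g q (F i q)) κ where
  toIsOrthonormal := isOrthonormal_of_orthonormal hE hU h.smooth h.orthonormal
  smooth_κ := h.smooth_κ
  bracket_frame p hp i := by
    rw [← hD.torsion_free p hp _ _ (h.smooth p hp _) (h.smooth p hp _), h.eqn p hp, h.eqn p hp]
    simp only [h.orthonormal p hp]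
    fin_cases i <;> simp <;> module

/-- The components of a covariant derivative in a frame. -/
lemma Coframe.covariantDerivative_eq (h : Coframe I U F e) (hD : IsCovariantDerivativeOn E D U)
    (hp : p ∈ U)
    (hY : MDifferentiableAt I I.tangent (fun q => (⟨q, Y q⟩ : TangentBundle I M)) p) :
    D Y p = ∑ i, (e i p (Y p) • D (F i) p
      + (mvfderiv I (fun q => e i q (Y q)) p).smulRight (F i p)) := by
  have hY' : ∀ i, MDifferentiableAt I 𝓘(ℝ) (fun q => e i q (Y q)) p :=
    fun i => (h.smooth_form p hp i).mdiff hY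
  have hF := fun i => (h.smooth p hp i).mdiff
  let G : Fin 3 → Π q : M, TangentSpace I q := fun i => (fun q => e i q (Y q)) • F i
  have hsm : ∀ i, MDifferentiableAt I I.tangent
      (fun q => (⟨q, G i q⟩ : TangentBundle I M)) p :=
    fun i => MDifferentiableAt.smul_section (hY' i) (hF i)
  have hadd : MDifferentiableAt I I.tangent
      (fun q => (⟨q, (G 0 + G 1) q⟩ : TangentBundle I M)) p :=
    mdifferentiableAt_add_section (hsm 0) (hsm 1)
  have hadd' : MDifferentiableAt I I.tangent
      (fun q => (⟨q, (G 0 + G 1 + G 2) q⟩ : TangentBundle I M)) p :=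
    mdifferentiableAt_add_section hadd (hsm 2)
  have hev : ∀ᶠ q in 𝓝 p, Y q = (G 0 + G 1 + G 2) q := by
    filter_upwards [h.isOpen.mem_nhds hp] with q hq
    conv_lhs => rw [h.expand q hq (Y q)]
    simp [G, Fin.sum_univ_three]
  rw [hD.congr_of_eventuallyEq hY hadd' (h.isOpen.mem_nhds hp) hev, hD.add hadd (hsm 2) hp,
    hD.add (hsm 0) (hsm 1) hp, Fin.sum_univ_three]
  simp only [G, hD.leibniz (hF _) (hY' _) hp]

/-- The covariant derivative of an arbitrary vector field in a hyperCR frame. -/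
lemma WeylStructure.StructureEq.connection_comp (h : W.StructureEq F e κ)
    (hD : W.IsWeylConnection D) (hp : p ∈ U)
    (hY : MDifferentiableAt I I.tangent (fun q => (⟨q, Y q⟩ : TangentBundle I M)) p)
    (v : TangentSpace I p) (m : Fin 3) :
    e m p (D Y p v) = mvfderiv I (fun q => e m q (Y q)) p v
      + W.weylForm p v * e m p (Y p)
      + κ p * cross (fun i => e i p (Y p)) (fun i => e i p v) m := by
  rw [← h.frameConnection_comp hp, h.covariantDerivative_eq hD.isCovariantDerivative hp hY,
    h.covariantDerivative_eq h.isCovariantDerivativeOn hp hY]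
  simp only [h.connection_unique hD h.isWeylConnection hp]

/-- The components of the curvature of a hyperCR Weyl connection. -/
def curvForm (φ : Fin 3 → Fin 3 → ℝ) (β : Fin 3 → ℝ) (c : ℝ) (x y z : Fin 3 → ℝ) (m : Fin 3) : ℝ :=
  (∑ i, ∑ j, φ i j * (x i * y j)) * z m + (∑ i, β i * x i) * cross z y m
    - (∑ i, β i * y i) * cross z x m + c ^ 2 * cross z (cross x y) m

/-- Derivatives of the components of X, Y and Z cancel by `dir_bracket` and the structure equations,
leaving an algebraic expression. Of φ and β only the skewness of φ is recorded, since nothing else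
about them enters the symmetric Ricci tensor. -/
lemma WeylStructure.StructureEq.curvature_comp (h : W.StructureEq F e κ)
    (hD : W.IsWeylConnection D) (hp : p ∈ U) :
    ∃ (φ : Fin 3 → Fin 3 → ℝ) (β : Fin 3 → ℝ), (∀ i j, φ i j = -φ j i) ∧
      ∀ X Y Z : Π q : M, TangentSpace I q, SmoothVF I X p → SmoothVF I Y p → SmoothVF I Z p →
      ∀ m, e m p (curvature D X Y Z p) = curvForm φ β (κ p) (fun i => e i p (X p))
        (fun i => e i p (Y p)) (fun i => e i p (Z p)) m := by
  let w : Fin 3 → M → ℝ := fun i q => W.weylForm q (F i q)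
  have hU : ∀ᶠ q in 𝓝 p, q ∈ U := h.isOpen.mem_nhds hp
  have hw : ∀ i, SmoothFn I (w i) p := fun i => W.smooth_weylForm p hp _ (h.smooth p hp i)
  have hκ := h.smooth_κ p hp
  have hsm : ∀ {X : Π q : M, TangentSpace I q}, SmoothVF I X p →
      ∀ i, SmoothFn I (fun q => e i q (X q)) p := fun hX i => h.smooth_form p hp i _ hX
  -- The coefficients are those of φ = dω and β = dκ - κω in the frame.
  refine ⟨fun i j => dir I (F i) (w j) p - dir I (F j) (w i) p
    - W.weylForm p (mlieBracket I (F i) (F j) p), fun i => dir I (F i) κ p - κ p * w i p, ?_, ?_⟩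
  · intro i j
    simp only
    rw [mlieBracket_swap_apply (V := F i), map_neg]
    ring
  intro X Y Z hX hY hZ m
  -- The first covariant derivative is needed on a neighbourhood, as `second` differentiates it
  -- again.
  have first : ∀ {Y : Π q : M, TangentSpace I q}, SmoothVF I Y p → ∀ m,
      ∀ᶠ q in 𝓝 p, e m q (D Z q (Y q)) = dir I Y (fun q => e m q (Z q)) q
        + (∑ i, w i q * e i q (Y q)) * e m q (Z q)
        + κ q * (e (m + 1) q (Z q) * e (m + 2) q (Y q)
          - e (m + 2) q (Z q) * e (m + 1) q (Y q)) := by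
    intro Y hY m
    filter_upwards [hU, hZ.eventually_mdiff] with q hq hZq
    rw [h.connection_comp hD hq hZq, h.weylForm_eq hq (Y q)]
    rfl
  have second : ∀ {X Y : Π q : M, TangentSpace I q}, SmoothVF I X p → SmoothVF I Y p →
      e m p (D (fun q => D Z q (Y q)) p (X p))
        = dir I X (dir I Y (fun q => e m q (Z q))) p
        + ((∑ i, (w i p * dir I X (fun q => e i q (Y q)) p + e i p (Y p) * dir I X (w i) p))
            * e m p (Z p)
          + (∑ i, w i p * e i p (Y p)) * dir I X (fun q => e m q (Z q)) p)
        + (dir I X κ p * cross (fun i => e i p (Z p)) (fun i => e i p (Y p)) m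
          + κ p * (e (m + 1) p (Z p) * dir I X (fun q => e (m + 2) q (Y q)) p
            + e (m + 2) p (Y p) * dir I X (fun q => e (m + 1) q (Z q)) p
            - e (m + 2) p (Z p) * dir I X (fun q => e (m + 1) q (Y q)) p
            - e (m + 1) p (Y p) * dir I X (fun q => e (m + 2) q (Z q)) p))
        + (∑ i, w i p * e i p (X p)) * e m p (D Z p (Y p))
        + κ p * cross (fun i => e i p (D Z p (Y p))) (fun i => e i p (X p)) m := by
    intro X Y hX hY
    have hx := hsm hX
    have hy := hsm hY
    have hz := hsm hZ
    have hs1 : ∀ i, SmoothFn I (fun q => w i q * e i q (Y q)) p := fun i => (hw i).mul (hy i)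
    have hs2 : SmoothFn I (fun q => ∑ i, w i q * e i q (Y q)) p := SmoothFn.sum fun i _ => hs1 i
    rw [h.connection_comp hD hp (hD.smooth p hp Y Z hY hZ).mdiff]
    change dir I X _ p + _ + _ = _
    rw [dir_congr (first hY m), dir_add (((hz m).dir hY).add (hs2.mul (hz m))) (hκ.mul
        (((hz _).mul (hy _)).sub ((hz _).mul (hy _)))),
      dir_add ((hz m).dir hY) (hs2.mul (hz m)), dir_mul hs2 (hz m), dir_sum fun i _ => hs1 i,
      dir_mul hκ (((hz _).mul (hy _)).sub ((hz _).mul (hy _))),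
      dir_sub ((hz _).mul (hy _)) ((hz _).mul (hy _)), dir_mul (hz _) (hy _),
      dir_mul (hz _) (hy _), h.weylForm_eq hp]
    simp only [dir_mul (hw _) (hy _), cross]
    ring
  have h1 := second hX hY
  have h2 := second hY hX
  have h3 : W.weylForm p (mlieBracket I X Y p)
      = ∑ k, w k p * (dir I X (fun q => e k q (Y q)) p - dir I Y (fun q => e k q (X q)) p)
        + ∑ i, ∑ j, e i p (X p) * e j p (Y p) * W.weylForm p (mlieBracket I (F i) (F j) p) := by
    simp_rw [h.weylForm_eq hp (mlieBracket I _ _ p), h.toCoframe.bracket hp hX hY]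
    simp only [Fin.sum_univ_three, w]
    ring
  have h4 : ∀ X : Π q : M, TangentSpace I q, W.weylForm p (X p) = ∑ i, w i p * e i p (X p) :=
    fun X => h.weylForm_eq hp (X p)
  unfold curvature
  rw [map_sub, map_sub, h1, h2, h.connection_comp hD hp hZ.mdiff (mlieBracket I X Y p), h3]
  change _ - _ - (dir I (mlieBracket I X Y) _ p + _ + _) = _
  rw [dir_bracket hX hY (hsm hZ m)]
  simp only [curvForm, cross, (first hX _).self_of_nhds, (first hY _).self_of_nhds,
    h.bracket_apply hp hX hY, h4 X, h4 Y]
  rw [h.dir_eq hp X κ, h.dir_eq hp Y κ]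
  simp only [fun i => h.dir_eq hp X (w i), fun i => h.dir_eq hp Y (w i), Fin.sum_univ_three]
  generalize dir I X (dir I Y fun q => e m q (Z q)) p = t1
  generalize dir I Y (dir I X fun q => e m q (Z q)) p = t2
  fin_cases m <;> simp <;> ring

/-- The Ricci tensor is a trace over this slot, so linearity makes it independent of the orthonormal
basis. -/
lemma curvForm_linear (φ : Fin 3 → Fin 3 → ℝ) (β : Fin 3 → ℝ) (c : ℝ) (x y z : Fin 3 → ℝ)
    (m : Fin 3) :
    curvForm φ β c x y z m = ∑ a, x a * curvForm φ β c (Pi.single a 1) y z m := by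
  simp only [curvForm, cross, Fin.sum_univ_three]
  fin_cases m <;> simp <;> ring

/-- The traces of the φ and β terms are φ(z, y) and β · (z×y), which are skew in y and z. The double
cross product z×(x×y) = x (z·y) - y (z·x) has trace 3 (z·y) - (z·y), and this occurs twice. -/
lemma curvForm_trace {φ : Fin 3 → Fin 3 → ℝ} (hφ : ∀ i j, φ i j = -φ j i) (β : Fin 3 → ℝ) (c : ℝ)
    (y z : Fin 3 → ℝ) :
    ∑ a, curvForm φ β c (Pi.single a 1) y z a + ∑ a, curvForm φ β c (Pi.single a 1) z y a
      = 4 * c ^ 2 * ∑ a, y a * z a := by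
  simp only [curvForm, cross, Fin.sum_univ_three]
  simp [hφ 1 0, hφ 2 0, hφ 2 1]
  have h0 : φ 0 0 = 0 := by linarith [hφ 0 0]
  have h1 : φ 1 1 = 0 := by linarith [hφ 1 1]
  have h2 : φ 2 2 = 0 := by linarith [hφ 2 2]
  rw [h0, h1, h2]
  ring

lemma WeylStructure.StructureEq.isEinsteinWeyl (h : W.StructureEq F e κ)
    (hD : W.IsWeylConnection D) : W.IsEinsteinWeyl D := by
  intro p hp
  obtain ⟨φ, β, hφ, hR⟩ := h.curvature_comp hD hp
  -- Half of the constant 4κ² in `curvForm_trace`.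
  refine ⟨2 * κ p ^ 2, fun b hb ho Y Z hY hZ => ?_⟩
  let B : Matrix (Fin 3) (Fin 3) ℝ := Matrix.of fun i a => e a p (b i p)
  have hB : B * B.transpose = 1 := by
    ext i j
    rw [Matrix.mul_apply, Matrix.one_apply, ← ho i j, h.metric p hp]
    rfl
  -- The matrix relating b to F has orthonormal rows, hence orthonormal columns; this turns the
  -- trace over b into the trace over F.
  have hmat : ∀ a m, ∑ i, e a p (b i p) * e m p (b i p) = if a = m then 1 else 0 := by
    intro a m
    rw [← Matrix.one_apply, ← mul_eq_one_comm.1 hB, Matrix.mul_apply]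
    rfl
  have htr : ∀ Y Z : Π q : M, TangentSpace I q, SmoothVF I Y p → SmoothVF I Z p →
      ricci W.g D b Y Z p = ∑ a, curvForm φ β (κ p) (Pi.single a 1) (fun i => e i p (Y p))
        (fun i => e i p (Z p)) a := by
    intro Y Z hY hZ
    unfold ricci
    simp only [h.metric p hp, hR _ Y Z (hb _) hY hZ]
    set R := fun a => curvForm φ β (κ p) (Pi.single a 1) (fun i => e i p (Y p))
      (fun i => e i p (Z p))
    have hl : ∀ i m, curvForm φ β (κ p) (fun j => e j p (b i p)) (fun i => e i p (Y p))
        (fun i => e i p (Z p)) m = ∑ a, e a p (b i p) * R a m :=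
      fun i m => curvForm_linear φ β (κ p) _ _ _ m
    calc _ = ∑ a, ∑ m, R a m * ∑ i, e a p (b i p) * e m p (b i p) := by
          simp only [hl, Fin.sum_univ_three]
          ring
      _ = _ := by simp [hmat, R]
  rw [htr Y Z hY hZ, htr Z Y hZ hY, curvForm_trace hφ, h.metric p hp]
  ring

end WeylFrames

/-! ### Brackets of fields with given components. -/

section BracketComponents

variable {E : Type*} [NormedAddCommGroup E] [NormedSpace ℝ E] [FiniteDimensional ℝ E]
  {H : Type*} [TopologicalSpace H] {I : ModelWithCorners ℝ E H}
  {M : Type*} [TopologicalSpace M] [ChartedSpace H M] [IsManifold I ∞ M] {p : M}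
  {U : Set M} {F : Fin 3 → Π q : M, TangentSpace I q}
  {e : Fin 3 → Π q : M, TangentSpace I q →L[ℝ] ℝ} {X Y : Π q : M, TangentSpace I q}

/-- On `U`, the vector field `X` has the components `a`, `b`, `c`, which are smooth at `p`. -/
structure HasComp (I : ModelWithCorners ℝ E H) [IsManifold I ∞ M] (U : Set M)
    (e : Fin 3 → Π q : M, TangentSpace I q →L[ℝ] ℝ)
    (p : M) (X : Π q : M, TangentSpace I q) (a b c : M → ℝ) : Prop where
  smooth : SmoothVF I X p
  eq0 : ∀ q ∈ U, e 0 q (X q) = a q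
  eq1 : ∀ q ∈ U, e 1 q (X q) = b q
  eq2 : ∀ q ∈ U, e 2 q (X q) = c q

lemma Coframe.dir_of_hasComp (h : Coframe I U F e) (hp : p ∈ U) {a b c : M → ℝ}
    (hX : HasComp I U e p X a b c) (f : M → ℝ) :
    dir I X f p = a p * dir I (F 0) f p + b p * dir I (F 1) f p + c p * dir I (F 2) f p := by
  rw [h.dir_eq hp, Fin.sum_univ_three, hX.eq0 p hp, hX.eq1 p hp, hX.eq2 p hp]

lemma Coframe.bracket_of_hasComp (h : Coframe I U F e) (hp : p ∈ U) {a b c a' b' c' : M → ℝ}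
    (hX : HasComp I U e p X a b c) (hY : HasComp I U e p Y a' b' c') (k : Fin 3) :
    e k p (mlieBracket I X Y p) = dir I X (![a', b', c'] k) p - dir I Y (![a, b, c] k) p
      + (a p * b' p - b p * a' p) * e k p (mlieBracket I (F 0) (F 1) p)
      + (b p * c' p - c p * b' p) * e k p (mlieBracket I (F 1) (F 2) p)
      + (c p * a' p - a p * c' p) * e k p (mlieBracket I (F 2) (F 0) p) := by
  have hU : ∀ᶠ q in 𝓝 p, q ∈ U := h.isOpen.mem_nhds hp
  have h1 : ∀ᶠ q in 𝓝 p, e k q (Y q) = ![a', b', c'] k q := by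
    filter_upwards [hU] with q hq
    fin_cases k
    exacts [hY.eq0 q hq, hY.eq1 q hq, hY.eq2 q hq]
  have h2 : ∀ᶠ q in 𝓝 p, e k q (X q) = ![a, b, c] k q := by
    filter_upwards [hU] with q hq
    fin_cases k
    exacts [hX.eq0 q hq, hX.eq1 q hq, hX.eq2 q hq]
  rw [h.bracket hp hX.smooth hY.smooth, dir_congr h1, dir_congr h2]
  simp only [Fin.sum_univ_three, hX.eq0 p hp, hX.eq1 p hp, hX.eq2 p hp, hY.eq0 p hp, hY.eq1 p hp,
    hY.eq2 p hp, mlieBracket_self, Pi.zero_apply, map_zero, map_neg,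
    mlieBracket_swap_apply (V := F 1) (W := F 0), mlieBracket_swap_apply (V := F 0) (W := F 2),
    mlieBracket_swap_apply (V := F 2) (W := F 1)]
  ring

end BracketComponents

/-! ### Adapted frames: Hitchin's equations against the structure equations. -/

section Adapted

variable {E₂ : Type*} [NormedAddCommGroup E₂] [NormedSpace ℝ E₂] [FiniteDimensional ℝ E₂]
  {H₂ : Type*} [TopologicalSpace H₂] {I₂ : ModelWithCorners ℝ E₂ H₂} [I₂.Boundaryless]
  {N : Type*} [TopologicalSpace N] [ChartedSpace H₂ N] [IsManifold I₂ ∞ N]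
  {E₃ : Type*} [NormedAddCommGroup E₃] [NormedSpace ℝ E₃] [FiniteDimensional ℝ E₃]
  {H₃ : Type*} [TopologicalSpace H₃] {I₃ : ModelWithCorners ℝ E₃ H₃}
  {P : Type*} [TopologicalSpace P] [ChartedSpace H₃ P] [IsManifold I₃ ∞ P]
  {J : Π x : N, TangentSpace I₂ x →L[ℝ] TangentSpace I₂ x} {π : P → N} {Ω U : Set P}
  {Φ : HiggsPair I₂ I₃ J π Ω} {F : Fin 3 → Π q : P, TangentSpace I₃ q}
  {e : Fin 3 → Π q : P, TangentSpace I₃ q →L[ℝ] ℝ} {p : P}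
  {X Y : Π y : N, TangentSpace I₂ y} {W : WeylStructure I₃ U} {κ : P → ℝ}

/-- A frame `F` on `U` with `F 0` vertical, `F 1` and `F 2` horizontal, `φ (F 1) = F 0` and
`φ (F 2) = i F 0`. -/
structure HiggsPair.Adapted (Φ : HiggsPair I₂ I₃ J π Ω) (U : Set P)
    (F : Fin 3 → Π q : P, TangentSpace I₃ q) (e : Fin 3 → Π q : P, TangentSpace I₃ q →L[ℝ] ℝ) :
    Prop extends Coframe I₃ U F e where
  subset : U ⊆ Ω
  smooth_proj : ∀ p ∈ U, ContMDiffAt I₃ I₂ ∞ π p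
  hor_proj : ∀ p ∈ U, ∀ v, Φ.hor p (mfderiv I₃ I₂ π p v) = e 1 p v • F 1 p + e 2 p v • F 2 p
  re_proj : ∀ p ∈ U, ∀ v, Φ.re p (mfderiv I₃ I₂ π p v) = e 1 p v • F 0 p
  im_proj : ∀ p ∈ U, ∀ v, Φ.im p (mfderiv I₃ I₂ π p v) = e 2 p v • F 0 p

namespace HiggsPair.Adapted

variable (h : Φ.Adapted U F e)
include h

lemma hor_eq (hp : p ∈ U) (x : TangentSpace I₂ (π p)) :
    Φ.hor p x = e 1 p (Φ.hor p x) • F 1 p + e 2 p (Φ.hor p x) • F 2 p := by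
  conv_lhs => rw [← Φ.proj_hor p (h.subset hp) x]
  exact h.hor_proj p hp _

lemma re_eq (hp : p ∈ U) (x : TangentSpace I₂ (π p)) :
    Φ.re p x = e 1 p (Φ.hor p x) • F 0 p := by
  conv_lhs => rw [← Φ.proj_hor p (h.subset hp) x]
  exact h.re_proj p hp _

lemma im_eq (hp : p ∈ U) (x : TangentSpace I₂ (π p)) :
    Φ.im p x = e 2 p (Φ.hor p x) • F 0 p := by
  conv_lhs => rw [← Φ.proj_hor p (h.subset hp) x]
  exact h.im_proj p hp _

lemma vecRe_eq (hp : p ∈ U) (X : Π y : N, TangentSpace I₂ y) :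
    Φ.vecRe X p = e 1 p (Φ.liftHor X p) • F 0 p := h.re_eq hp _

lemma vecIm_eq (hp : p ∈ U) (X : Π y : N, TangentSpace I₂ y) :
    Φ.vecIm X p = e 2 p (Φ.liftHor X p) • F 0 p := h.im_eq hp _

lemma vertical (hp : p ∈ U) : mfderiv I₃ I₂ π p (F 0 p) = 0 := by
  have h1 := h.hor_proj p hp (F 0 p)
  rw [h.dual p hp, h.dual p hp] at h1
  have h2 := Φ.proj_hor p (h.subset hp) (mfderiv I₃ I₂ π p (F 0 p))
  rw [h1] at h2
  simpa using h2.symm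

lemma comp_eq_zero (hp : p ∈ U) {v : TangentSpace I₃ p} (hv : mfderiv I₃ I₂ π p v = 0) :
    e 1 p v = 0 ∧ e 2 p v = 0 := by
  have h1 := h.hor_proj p hp v
  rw [hv, map_zero] at h1
  have h2 := congrArg (e 1 p) h1
  have h3 := congrArg (e 2 p) h1
  simp only [map_zero, map_add, map_smul, h.dual p hp] at h2 h3
  exact ⟨by simpa using h2.symm, by simpa using h3.symm⟩

lemma hasComp_frame (hp : p ∈ U) (i : Fin 3) : HasComp I₃ U e p (F i)
    (fun _ => if 0 = i then 1 else 0) (fun _ => if 1 = i then 1 else 0)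
    (fun _ => if 2 = i then 1 else 0) where
  smooth := h.smooth p hp i
  eq0 q hq := h.dual q hq 0 i
  eq1 q hq := h.dual q hq 1 i
  eq2 q hq := h.dual q hq 2 i

lemma hasComp_liftHor (hp : p ∈ U) (hX : SmoothVF I₂ X (π p)) :
    HasComp I₃ U e p (Φ.liftHor X) (fun _ => 0) (fun q => e 1 q (Φ.liftHor X q))
      (fun q => e 2 q (Φ.liftHor X q)) where
  smooth := Φ.smooth_hor p (h.subset hp) X hX
  eq0 q hq := by
    have := congrArg (e 0 q) (h.hor_eq hq (X (π q)))
    simpa [h.dual q hq, liftHor] using this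
  eq1 q hq := rfl
  eq2 q hq := rfl

lemma hasComp_vecRe (hp : p ∈ U) (hX : SmoothVF I₂ X (π p)) :
    HasComp I₃ U e p (Φ.vecRe X) (fun q => e 1 q (Φ.liftHor X q)) (fun _ => 0) (fun _ => 0) where
  smooth := Φ.smooth_re p (h.subset hp) X hX
  eq0 q hq := by simp [h.vecRe_eq hq, h.dual q hq]
  eq1 q hq := by simp [h.vecRe_eq hq, h.dual q hq]
  eq2 q hq := by simp [h.vecRe_eq hq, h.dual q hq]

lemma hasComp_vecIm (hp : p ∈ U) (hX : SmoothVF I₂ X (π p)) :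
    HasComp I₃ U e p (Φ.vecIm X) (fun q => e 2 q (Φ.liftHor X q)) (fun _ => 0) (fun _ => 0) where
  smooth := Φ.smooth_im p (h.subset hp) X hX
  eq0 q hq := by simp [h.vecIm_eq hq, h.dual q hq]
  eq1 q hq := by simp [h.vecIm_eq hq, h.dual q hq]
  eq2 q hq := by simp [h.vecIm_eq hq, h.dual q hq]

lemma smooth_comp (hp : p ∈ U) (hX : SmoothVF I₂ X (π p)) (i : Fin 3) :
    SmoothFn I₃ (fun q => e i q (Φ.liftHor X q)) p :=
  h.smooth_form p hp i _ (Φ.smooth_hor p (h.subset hp) X hX)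

lemma mfderiv_bracket_liftHor (hp : p ∈ U) (hX : SmoothVF I₂ X (π p)) (hY : SmoothVF I₂ Y (π p)) :
    mfderiv I₃ I₂ π p (mlieBracket I₃ (Φ.liftHor X) (Φ.liftHor Y) p)
      = mlieBracket I₂ X Y (π p) := by
  have hU : ∀ᶠ q in 𝓝 p, q ∈ U := h.isOpen.mem_nhds hp
  exact mfderiv_bracket_of_related (h.smooth_proj p hp) (Φ.smooth_hor p (h.subset hp) X hX)
    (Φ.smooth_hor p (h.subset hp) Y hY) hX hY
    (hU.mono fun q hq => Φ.proj_hor q (h.subset hq) _)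
    (hU.mono fun q hq => Φ.proj_hor q (h.subset hq) _)

/-- The brackets of horizontal lifts with `F 0` are vertical. -/
lemma dir_comp_liftHor (hp : p ∈ U) (hX : SmoothVF I₂ X (π p)) :
    dir I₃ (F 0) (fun q => e 1 q (Φ.liftHor X q)) p
      = e 2 p (Φ.liftHor X p) * e 1 p (mlieBracket I₃ (F 2) (F 0) p)
        - e 1 p (Φ.liftHor X p) * e 1 p (mlieBracket I₃ (F 0) (F 1) p) ∧
    dir I₃ (F 0) (fun q => e 2 q (Φ.liftHor X q)) p
      = e 2 p (Φ.liftHor X p) * e 2 p (mlieBracket I₃ (F 2) (F 0) p)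
        - e 1 p (Φ.liftHor X p) * e 2 p (mlieBracket I₃ (F 0) (F 1) p) := by
  have hU : ∀ᶠ q in 𝓝 p, q ∈ U := h.isOpen.mem_nhds hp
  -- The lift is related to X and F 0 to the zero field, so their bracket projects to zero. Its two
  -- vanishing horizontal components are linear equations for the derivatives of the components of
  -- the lift along the fibre.
  have hv := mfderiv_bracket_of_related (h.smooth_proj p hp)
    (Φ.smooth_hor p (h.subset hp) X hX) (h.smooth p hp 0) hX (SmoothVF.zero (I := I₂))
    (hU.mono fun q hq => Φ.proj_hor q (h.subset hq) _) (hU.mono fun q hq => h.vertical hq)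
  have h0 : mlieBracket I₂ X (fun y => (0 : TangentSpace I₂ y)) (π p) = 0 :=
    congrFun mlieBracket_zero_right (π p)
  obtain ⟨h1, h2⟩ := h.comp_eq_zero hp (hv.trans h0)
  change e 1 p (mlieBracket I₃ (Φ.liftHor X) (F 0) p) = 0 at h1
  change e 2 p (mlieBracket I₃ (Φ.liftHor X) (F 0) p) = 0 at h2
  rw [h.bracket_of_hasComp hp (h.hasComp_liftHor hp hX) (h.hasComp_frame hp 0)] at h1 h2
  simp [dir_const] at h1 h2
  constructor <;> linarith

/-- The Weyl structure of a Higgs pair, in terms of an adapted frame. -/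
lemma induces (hW : W.IsOrthonormal F e)
    (h1 : ∀ p ∈ U, e 0 p (mlieBracket I₃ (F 0) (F 1) p) = -W.weylForm p (F 1 p))
    (h2 : ∀ p ∈ U, e 0 p (mlieBracket I₃ (F 2) (F 0) p) = W.weylForm p (F 2 p))
    (h3 : ∀ p ∈ U, e 1 p (mlieBracket I₃ (F 0) (F 1) p) = W.weylForm p (F 0 p))
    (h4 : ∀ p ∈ U, e 2 p (mlieBracket I₃ (F 2) (F 0) p) = -W.weylForm p (F 0 p))
    (h5 : ∀ p ∈ U, e 2 p (mlieBracket I₃ (F 0) (F 1) p) = e 1 p (mlieBracket I₃ (F 2) (F 0) p)) :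
    Φ.Induces (F 0) W where
  metric p hp v a b c ha hb hc := by
    have ha' := congrArg (e 0 p) ha
    have hb' := congrArg (e 0 p) hb
    have hc' := congrArg (e 0 p) hc
    rw [h.re_proj p hp] at ha'
    rw [h.im_proj p hp] at hb'
    rw [h.hor_proj p hp] at hc'
    simp [h.dual p hp] at ha' hb' hc'
    rw [hW.metric p hp, Fin.sum_univ_three, ha', hb', hc']
    ring
  weyl_hor p hp X hX := by
    have hd := h.dir_comp_liftHor hp hX
    refine h.ext hp fun k => ?_
    rw [h.bracket_of_hasComp hp (h.hasComp_liftHor hp hX) (h.hasComp_frame hp 0)]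
    have hω : W.weylForm p (Φ.liftHor X p) = e 1 p (Φ.liftHor X p) * W.weylForm p (F 1 p)
        + e 2 p (Φ.liftHor X p) * W.weylForm p (F 2 p) := by
      conv_lhs => rw [liftHor, h.hor_eq hp]
      simp [liftHor]
    rw [hω]
    fin_cases k
    · simp [dir_const, h1 p hp, h2 p hp, h.dual p hp]
    · simp [dir_const, hd.1, h.dual p hp]; ring
    · simp [dir_const, hd.2, h.dual p hp]; ring
  weyl_vert p hp := by
    -- By `h3`, `h4` and `h5` the components of a lift evolve along F 0 by a scaling at rate -ω(F 0)
    -- and a rotation; k is the rate of this rotation.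
    refine ⟨-e 1 p (mlieBracket I₃ (F 2) (F 0) p), fun X hX => ?_⟩
    have hd := h.dir_comp_liftHor hp hX
    rw [h3 p hp, h4 p hp, h5 p hp] at hd
    constructor
    · refine h.ext hp fun k => ?_
      rw [h.bracket_of_hasComp hp (h.hasComp_frame hp 0) (h.hasComp_vecRe hp hX)]
      simp only [map_sub, map_smul, h.vecRe_eq hp, h.vecIm_eq hp, h.dual p hp]
      fin_cases k
      · simp [dir_const, hd.1]; ring
      · simp [dir_const]
      · simp [dir_const]
    · refine h.ext hp fun k => ?_
      rw [h.bracket_of_hasComp hp (h.hasComp_frame hp 0) (h.hasComp_vecIm hp hX)]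
      simp only [map_add, map_smul, h.vecRe_eq hp, h.vecIm_eq hp, h.dual p hp]
      fin_cases k
      · simp [dir_const, hd.2]; ring
      · simp [dir_const]
      · simp [dir_const]

/-- The structure equations of an adapted frame follow from Hitchin's equations. -/
lemma structureEq (hΦ : Φ.IsHitchin) (hW : W.IsOrthonormal F e) (hI : Φ.Induces (F 0) W) :
    W.StructureEq F e (fun q => -(1 / 2) * e 0 q (mlieBracket I₃ (F 1) (F 2) q)) where
  toIsOrthonormal := hW
  smooth_κ p hp := (SmoothFn.const _).mul
    (h.smooth_form p hp 0 _ ((h.smooth p hp 1).bracket (h.smooth p hp 2)))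
  bracket_frame p hp i := by
    -- Base fields whose lifts are F 1 and F 2 at p. Their components at p are (1, 0) and (0, 1), so
    -- each hypothesis becomes a linear relation between structure constants and derivatives of
    -- these components.
    obtain ⟨X, hX, hXp⟩ := exists_smoothVF (I := I₂) (mfderiv I₃ I₂ π p (F 1 p))
    obtain ⟨Y, hY, hYp⟩ := exists_smoothVF (I := I₂) (mfderiv I₃ I₂ π p (F 2 p))
    have hX0 : Φ.liftHor X p = F 1 p := by
      rw [liftHor, hXp, h.hor_proj p hp]; simp [h.dual p hp]
    have hY0 : Φ.liftHor Y p = F 2 p := by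
      rw [liftHor, hYp, h.hor_proj p hp]; simp [h.dual p hp]
    have dual := h.dual p hp
    have hlX := h.hasComp_liftHor hp hX
    have hlY := h.hasComp_liftHor hp hY
    have hF0 := h.hasComp_frame hp 0
    obtain ⟨k, hk⟩ := hI.weyl_vert p hp
    have a1 := congrArg (e 0 p) (hI.weyl_hor p hp X hX)
    have a2 := congrArg (e 1 p) (hI.weyl_hor p hp X hX)
    have a3 := congrArg (e 2 p) (hI.weyl_hor p hp X hX)
    have b1 := congrArg (e 0 p) (hI.weyl_hor p hp Y hY)
    have b2 := congrArg (e 1 p) (hI.weyl_hor p hp Y hY)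
    have b3 := congrArg (e 2 p) (hI.weyl_hor p hp Y hY)
    rw [h.bracket_of_hasComp hp hlX hF0] at a1 a2 a3
    rw [h.bracket_of_hasComp hp hlY hF0] at b1 b2 b3
    have c1 := congrArg (e 0 p) (hk X hX).1
    have c2 := congrArg (e 0 p) (hk X hX).2
    have c3 := congrArg (e 0 p) (hk Y hY).1
    have c4 := congrArg (e 0 p) (hk Y hY).2
    rw [h.bracket_of_hasComp hp hF0 (h.hasComp_vecRe hp hX)] at c1
    rw [h.bracket_of_hasComp hp hF0 (h.hasComp_vecIm hp hX)] at c2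
    rw [h.bracket_of_hasComp hp hF0 (h.hasComp_vecRe hp hY)] at c3
    rw [h.bracket_of_hasComp hp hF0 (h.hasComp_vecIm hp hY)] at c4
    -- The vertical component of the curvature equation relates e 0 [F 1, F 2] to the rate of
    -- rotation. Its horizontal components say that the lift of [X, Y] is the horizontal part of the
    -- bracket of lifts; inserted in the two Higgs equations, they give e 1 [F 1, F 2] and e 2 [F 1,
    -- F 2].
    have d0 := hΦ.curvature_eq p (h.subset hp) X Y hX hY
    have d1 := congrArg (e 0 p) d0
    have d2 := congrArg (e 1 p) d0
    have d3 := congrArg (e 2 p) d0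
    have hhor := h.hor_eq hp (mlieBracket I₂ X Y (π p))
    have f0 := congrArg (e 0 p) hhor
    have g1 := congrArg (e 0 p) (hΦ.higgs_re p (h.subset hp) X Y hX hY)
    have g2 := congrArg (e 0 p) (hΦ.higgs_im p (h.subset hp) X Y hX hY)
    rw [h.re_eq hp] at g1
    rw [h.im_eq hp] at g2
    simp only [map_add, map_sub, map_smul, h.bracket_of_hasComp hp hlX hlY,
      h.bracket_of_hasComp hp (h.hasComp_vecRe hp hX) (h.hasComp_vecRe hp hY),
      h.bracket_of_hasComp hp (h.hasComp_vecIm hp hX) (h.hasComp_vecIm hp hY),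
      h.bracket_of_hasComp hp hlX (h.hasComp_vecRe hp hY),
      h.bracket_of_hasComp hp hlY (h.hasComp_vecRe hp hX),
      h.bracket_of_hasComp hp hlX (h.hasComp_vecIm hp hY),
      h.bracket_of_hasComp hp hlY (h.hasComp_vecIm hp hX),
      h.dir_of_hasComp hp (h.hasComp_vecRe hp hX), h.dir_of_hasComp hp (h.hasComp_vecRe hp hY),
      h.dir_of_hasComp hp (h.hasComp_vecIm hp hX), h.dir_of_hasComp hp (h.hasComp_vecIm hp hY)]
      at d1 d2 d3 g1 g2
    simp only [map_sub, map_add, map_smul, h.vecRe_eq hp, h.vecIm_eq hp, hX0, hY0, dual]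
      at a1 a2 a3 b1 b2 b3 c1 c2 c3 c4 d1 d2 d3 f0 g1 g2
    simp [dir_const] at a1 a2 a3 b1 b2 b3 c1 c2 c3 c4 d1 d2 d3 f0 g1 g2
    refine h.ext hp fun m => ?_
    fin_cases i <;> fin_cases m <;> simp [dual] <;> linarith

/-- Hitchin's equations follow from the structure equations of an adapted frame. -/
lemma isHitchin (hU : Ω ⊆ U) (hW : W.StructureEq F e κ) : Φ.IsHitchin := by
  have main : ∀ p ∈ U, ∀ X Y : (Π y : N, TangentSpace I₂ y),
      SmoothVF I₂ X (π p) → SmoothVF I₂ Y (π p) → ∀ k,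
      e k p (mlieBracket I₃ (Φ.liftHor X) (Φ.liftHor Y) p
        - Φ.hor p (mlieBracket I₂ X Y (π p))) =
        e k p ((1 / 2 : ℝ) • (mlieBracket I₃ (Φ.vecRe X) (Φ.vecRe Y) p
          + mlieBracket I₃ (Φ.vecIm X) (Φ.vecIm Y) p)) ∧
      e k p (mlieBracket I₃ (Φ.liftHor X) (Φ.vecRe Y) p
        - mlieBracket I₃ (Φ.liftHor Y) (Φ.vecRe X) p)
          = e k p (Φ.re p (mlieBracket I₂ X Y (π p))) ∧
      e k p (mlieBracket I₃ (Φ.liftHor X) (Φ.vecIm Y) p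
        - mlieBracket I₃ (Φ.liftHor Y) (Φ.vecIm X) p)
          = e k p (Φ.im p (mlieBracket I₂ X Y (π p))) := by
    intro p hp X Y hX hY k
    have dual := h.dual p hp
    have h0 := hW.bracket_frame p hp 0
    have h1 := hW.bracket_frame p hp 1
    have h2 := hW.bracket_frame p hp 2
    simp only [zero_add, show (1 + 1 : Fin 3) = 2 from rfl, show (1 + 2 : Fin 3) = 0 from rfl,
      show (2 + 1 : Fin 3) = 0 from rfl, show (2 + 2 : Fin 3) = 1 from rfl] at h0 h1 h2
    have hlX := h.hasComp_liftHor hp hX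
    have hlY := h.hasComp_liftHor hp hY
    have hdX := h.dir_comp_liftHor hp hX
    have hdY := h.dir_comp_liftHor hp hY
    -- Once [X, Y] is written as the projection of the bracket of the lifts, all terms live upstairs
    -- and the three equations become identities between components in the frame.
    rw [← h.mfderiv_bracket_liftHor hp hX hY, h.hor_proj p hp, h.re_proj p hp, h.im_proj p hp]
    simp only [map_add, map_sub, map_smul, h.bracket_of_hasComp hp hlX hlY,
      h.bracket_of_hasComp hp (h.hasComp_vecRe hp hX) (h.hasComp_vecRe hp hY),
      h.bracket_of_hasComp hp (h.hasComp_vecIm hp hX) (h.hasComp_vecIm hp hY),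
      h.bracket_of_hasComp hp hlX (h.hasComp_vecRe hp hY),
      h.bracket_of_hasComp hp hlY (h.hasComp_vecRe hp hX),
      h.bracket_of_hasComp hp hlX (h.hasComp_vecIm hp hY),
      h.bracket_of_hasComp hp hlY (h.hasComp_vecIm hp hX),
      h.dir_of_hasComp hp (h.hasComp_vecRe hp hX), h.dir_of_hasComp hp (h.hasComp_vecRe hp hY),
      h.dir_of_hasComp hp (h.hasComp_vecIm hp hX), h.dir_of_hasComp hp (h.hasComp_vecIm hp hY)]
    fin_cases k <;>
    simp [dir_const, dual, h0, h1, h2, hdX.1, hdX.2, hdY.1, hdY.2] <;>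
    (try constructor) <;> (ring_nf; try trivial)
  constructor
  · intro p hp X Y hX hY
    exact h.ext (hU hp) fun k => (main p (hU hp) X Y hX hY k).1
  · intro p hp X Y hX hY
    exact h.ext (hU hp) fun k => (main p (hU hp) X Y hX hY k).2.1
  · intro p hp X Y hX hY
    exact h.ext (hU hp) fun k => (main p (hU hp) X Y hX hY k).2.2

end HiggsPair.Adapted

end Adapted

/-! ### Coframes and Weyl structures built from a frame. -/

section FrameConstruction

variable {E : Type*} [NormedAddCommGroup E] [NormedSpace ℝ E] [FiniteDimensional ℝ E]
  {H : Type*} [TopologicalSpace H] {I : ModelWithCorners ℝ E H}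
  {M : Type*} [TopologicalSpace M] [ChartedSpace H M] [IsManifold I ∞ M] {p : M}
  {U : Set M} {F : Fin 3 → Π q : M, TangentSpace I q}
  {e : Fin 3 → Π q : M, TangentSpace I q →L[ℝ] ℝ} {X Y : Π q : M, TangentSpace I q}

lemma SmoothVF.eventually_ne_zero (hX : SmoothVF I X p) (h : X p ≠ 0) : ∀ᶠ q in 𝓝 p, X q ≠ 0 := by
  obtain ⟨n, L, c, hL, hexp, hc, -⟩ := exists_localFrame (I := I) p
  have : ∃ i, c i p (X p) ≠ 0 := by
    by_contra! h0
    apply h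
    rw [hexp.self_of_nhds (X p)]
    simp [h0]
  obtain ⟨i, hi⟩ := this
  filter_upwards [(hc i X hX).continuousAt.eventually_ne hi] with q hq h0
  exact hq (by simp [h0])

/-- A smooth frame has a smooth dual coframe. -/
lemma exists_coframe (hE : Module.finrank ℝ E = 3) (hU : IsOpen U)
    (hF : ∀ p ∈ U, ∀ i, SmoothVF I (F i) p) (hli : ∀ p ∈ U, LinearIndependent ℝ fun i => F i p) :
    ∃ e, Coframe I U F e := by
  classical
  have hfd : ∀ p : M, FiniteDimensional ℝ (TangentSpace I p) :=
    fun p => inferInstanceAs (FiniteDimensional ℝ E)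
  have hfr : ∀ p : M, Module.finrank ℝ (TangentSpace I p) = 3 := fun p => hE
  have ht2 : ∀ p : M, T2Space (TangentSpace I p) := fun p => inferInstanceAs (T2Space E)
  let b : ∀ p ∈ U, Module.Basis (Fin 3) ℝ (TangentSpace I p) := fun p hp =>
    basisOfLinearIndependentOfCardEqFinrank (hli p hp) (by simp [hfr])
  have hb : ∀ p (hp : p ∈ U) i, b p hp i = F i p := fun p hp i => by simp [b]
  let e : Fin 3 → Π q : M, TangentSpace I q →L[ℝ] ℝ := fun i q =>
    if h : q ∈ U then LinearMap.toContinuousLinearMap ((b q h).coord i) else 0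
  have he : ∀ p (hp : p ∈ U) i v, e i p v = (b p hp).repr v i := by
    intro p hp i v
    simp [e, hp]
  have hexp : ∀ p ∈ U, ∀ v : TangentSpace I p, v = ∑ i, e i p v • F i p := by
    intro p hp v
    conv_lhs => rw [← (b p hp).sum_repr v]
    simp [he p hp, hb p hp]
  refine ⟨e, hU, hF, ?_, hexp, ?_⟩
  · intro p hp i j
    rw [he p hp, ← hb p hp j, Module.Basis.repr_self, Finsupp.single_apply]
    simp [eq_comm]
  · intro p hp i X hX
    exact smoothFn_coeff hE (hF p hp) (hli p hp) hX (x := fun i q => e i q (X q))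
      (by filter_upwards [hU.mem_nhds hp] with q hq using hexp q hq (X q)) i

lemma SmoothForm.sum_smul {α : Fin 3 → M → ℝ} {β : Fin 3 → Π q : M, TangentSpace I q →L[ℝ] ℝ}
    (hα : ∀ i, SmoothFn I (α i) p) (hβ : ∀ i, SmoothForm I (β i) p) :
    SmoothForm I (fun q => ∑ i, α i q • β i q) p := by
  intro X hX
  have : SmoothFn I (fun q => ∑ i, α i q * β i q (X q)) p :=
    SmoothFn.sum fun i _ => (hα i).mul (hβ i X hX)
  simpa using this

/-- The Weyl structure for which the frame `F` is orthonormal, with Weyl form `α`. -/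
lemma Coframe.exists_weylStructure (h : Coframe I U F e) {α : Π q : M, TangentSpace I q →L[ℝ] ℝ}
    (hα : ∀ p ∈ U, SmoothForm I α p) :
    ∃ W : WeylStructure I U, W.IsOrthonormal F e ∧ W.weylForm = α := by
  let g : Π p : M, TangentSpace I p →L[ℝ] TangentSpace I p →L[ℝ] ℝ := fun p =>
    ∑ i, (e i p).smulRight (e i p)
  have hg : ∀ p v w, g p v w = ∑ i, e i p v * e i p w := by
    intro p v w
    simp [g]
  refine ⟨⟨g, α, ?_, ?_, ?_, hα⟩, ⟨h, fun p _ => hg p⟩, rfl⟩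
  · intro p _ v w
    simp only [hg, mul_comm]
  · intro p hp v hv
    rw [hg]
    have hne : ∃ i, e i p v ≠ 0 := by
      by_contra! h0
      exact hv (h.ext hp (by simpa using h0))
    obtain ⟨i, hi⟩ := hne
    exact Finset.sum_pos' (fun i _ => mul_self_nonneg _) ⟨i, Finset.mem_univ _, mul_self_pos.2 hi⟩
  · intro p hp X Y hX hY
    simp only [hg]
    exact SmoothFn.sum fun i _ => (h.smooth_form p hp i X hX).mul (h.smooth_form p hp i Y hY)

end FrameConstruction

/-! ### The induced Weyl structure and existence of adapted frames. -/

section Construction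

variable {E₂ : Type*} [NormedAddCommGroup E₂] [NormedSpace ℝ E₂] [FiniteDimensional ℝ E₂]
  {H₂ : Type*} [TopologicalSpace H₂] {I₂ : ModelWithCorners ℝ E₂ H₂} [I₂.Boundaryless]
  {N : Type*} [TopologicalSpace N] [ChartedSpace H₂ N] [IsManifold I₂ ∞ N]
  {E₃ : Type*} [NormedAddCommGroup E₃] [NormedSpace ℝ E₃] [FiniteDimensional ℝ E₃]
  {H₃ : Type*} [TopologicalSpace H₃] {I₃ : ModelWithCorners ℝ E₃ H₃}
  {P : Type*} [TopologicalSpace P] [ChartedSpace H₃ P] [IsManifold I₃ ∞ P]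
  {J : Π x : N, TangentSpace I₂ x →L[ℝ] TangentSpace I₂ x} {π : P → N} {Ω U : Set P}
  {Φ : HiggsPair I₂ I₃ J π Ω} {F : Fin 3 → Π q : P, TangentSpace I₃ q}
  {e : Fin 3 → Π q : P, TangentSpace I₃ q →L[ℝ] ℝ} {p : P} {T : Π q : P, TangentSpace I₃ q}
  {W : WeylStructure I₃ U} {κ : P → ℝ}

/-- An adapted frame is orthonormal for every Weyl structure induced by the Higgs pair. -/
lemma HiggsPair.Adapted.isOrthonormal (h : Φ.Adapted U F e) (hI : Φ.Induces (F 0) W) :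
    W.IsOrthonormal F e where
  toCoframe := h.toCoframe
  metric p hp v w := by
    have hq : ∀ v, W.g p v v = ∑ i, e i p v * e i p v := by
      intro v
      rw [hI.metric p hp v (e 1 p v) (e 2 p v) (e 0 p v) (h.re_proj p hp v) (h.im_proj p hp v) ?_,
        Fin.sum_univ_three]
      · ring
      · rw [h.hor_proj p hp]
        nth_rewrite 1 [h.expand p hp v]
        rw [Fin.sum_univ_three]
        abel
    -- `Induces` prescribes only the quadratic form of the metric; polarization recovers the
    -- bilinear form.
    have h1 := hq (v + w)
    simp only [map_add, add_apply, W.symm p hp w v, hq v, hq w, Fin.sum_univ_three] at h1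
    rw [Fin.sum_univ_three]
    linarith

/-- The Higgs pair induces a Weyl structure, if it has an adapted frame. -/
lemma HiggsPair.Adapted.exists_induces (h : Φ.Adapted U F e) (hJ : IsComplexStructure I₂ J) :
    ∃ W : WeylStructure I₃ U, Φ.Induces (F 0) W := by
  -- The values of ω on the frame, forced by the third, first and second conditions of
  -- `HiggsPair.Adapted.induces`.
  let a : Fin 3 → P → ℝ := ![fun q => e 1 q (mlieBracket I₃ (F 0) (F 1) q),
    fun q => -e 0 q (mlieBracket I₃ (F 0) (F 1) q), fun q => e 0 q (mlieBracket I₃ (F 2) (F 0) q)]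
  have ha : ∀ p ∈ U, ∀ i, SmoothFn I₃ (a i) p := by
    intro p hp i
    have h01 := (h.smooth p hp 0).bracket (h.smooth p hp 1)
    have h20 := (h.smooth p hp 2).bracket (h.smooth p hp 0)
    fin_cases i
    · exact h.smooth_form p hp 1 _ h01
    · exact (h.smooth_form p hp 0 _ h01).neg
    · exact h.smooth_form p hp 0 _ h20
  obtain ⟨W, hW, hα⟩ := h.exists_weylStructure (α := fun q => ∑ i, a i q • e i q)
    fun p hp => SmoothForm.sum_smul (ha p hp) (h.smooth_form p hp)
  have hw : ∀ p ∈ U, ∀ i, W.weylForm p (F i p) = a i p := by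
    intro p hp i
    simp [hα, h.dual p hp]
  -- This is where the type of φ enters. If the lift of X has components (x₁, x₂), that of J X has
  -- (-x₂, x₁), so the evolution of components along F 0 commutes with the quarter turn and its
  -- matrix is a scaling plus a rotation.
  have key : ∀ p ∈ U, e 2 p (mlieBracket I₃ (F 2) (F 0) p) = -a 0 p ∧
      e 2 p (mlieBracket I₃ (F 0) (F 1) p) = e 1 p (mlieBracket I₃ (F 2) (F 0) p) := by
    intro p hp
    obtain ⟨X, hX, hXp⟩ := exists_smoothVF (I := I₂) (mfderiv I₃ I₂ π p (F 1 p))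
    have hX0 : Φ.liftHor X p = F 1 p := by
      rw [HiggsPair.liftHor, hXp, h.hor_proj p hp]; simp [h.dual p hp]
    let X' : Π y : N, TangentSpace I₂ y := fun y => J y (X y)
    have hX' : SmoothVF I₂ X' (π p) := hJ.smooth _ X hX
    have h1 : ∀ q ∈ U, e 1 q (Φ.liftHor X' q) = -e 2 q (Φ.liftHor X q) := by
      intro q hq
      have := congrArg (e 0 q) (Φ.re_J q (h.subset hq) (X (π q)))
      rw [h.re_eq hq, h.im_eq hq] at this
      simpa [h.dual q hq, HiggsPair.liftHor, X'] using this
    have h2 : ∀ q ∈ U, e 2 q (Φ.liftHor X' q) = e 1 q (Φ.liftHor X q) := by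
      intro q hq
      have := congrArg (e 0 q) (Φ.im_J q (h.subset hq) (X (π q)))
      rw [h.re_eq hq, h.im_eq hq] at this
      simpa [h.dual q hq, HiggsPair.liftHor, X'] using this
    have hU : ∀ᶠ q in 𝓝 p, q ∈ U := h.isOpen.mem_nhds hp
    have hd := h.dir_comp_liftHor hp hX
    have hd' := h.dir_comp_liftHor hp hX'
    have hsm := h.smooth_comp hp hX 2
    rw [dir_congr (hU.mono h1), dir_congr (hU.mono h2), h1 p hp, h2 p hp] at hd'
    have hneg : dir I₃ (F 0) (fun q => -e 2 q (Φ.liftHor X q)) p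
        = -dir I₃ (F 0) (fun q => e 2 q (Φ.liftHor X q)) p := by
      have := dir_sub (X := F 0) (SmoothFn.const (I := I₃) (p := p) 0) hsm
      simpa [dir_const] using this
    rw [hneg] at hd'
    simp [hX0, h.dual p hp] at hd hd'
    simp only [a, Matrix.cons_val_zero]
    constructor <;> linarith
  refine ⟨W, h.induces hW ?_ ?_ ?_ ?_ ?_⟩ <;> intro p hp <;> (try rw [hw p hp])
  · simp [a]
  · simp [a]
  · simp [a]
  · exact (key p hp).1
  · exact (key p hp).2

/-- The `(1,0)`-form of a Higgs pair is an isomorphism at the regular points. -/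
lemma HiggsPair.exists_higgs_basis (Φ : HiggsPair I₂ I₃ J π Ω) (h2 : Module.finrank ℝ E₂ = 2)
    (h3 : Module.finrank ℝ E₃ = 3) {t : TangentSpace I₃ p}
    (hp : p ∈ Φ.regularSet) (ht : mfderiv I₃ I₂ π p t = 0) (ht0 : t ≠ 0) :
    (∀ v : TangentSpace I₃ p, mfderiv I₃ I₂ π p v = 0 → ∃ c : ℝ, v = c • t) ∧
    ∃ x : TangentSpace I₂ (π p), Φ.re p x = t ∧ Φ.im p x = 0 ∧
      ∀ y, ∃ a b : ℝ, y = a • x + b • J (π p) x ∧ Φ.re p y = a • t ∧ Φ.im p y = b • t := by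
  have hfd2 : FiniteDimensional ℝ (TangentSpace I₂ (π p)) :=
    inferInstanceAs (FiniteDimensional ℝ E₂)
  have hfd3 : FiniteDimensional ℝ (TangentSpace I₃ p) := inferInstanceAs (FiniteDimensional ℝ E₃)
  have hfr2 : Module.finrank ℝ (TangentSpace I₂ (π p)) = 2 := h2
  have hfr3 : Module.finrank ℝ (TangentSpace I₃ p) = 3 := h3
  obtain ⟨hpΩ, hre⟩ := hp
  let L : TangentSpace I₃ p →ₗ[ℝ] TangentSpace I₂ (π p) := (mfderiv I₃ I₂ π p).toLinearMap
  have hsurj : L.range = ⊤ :=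
    LinearMap.range_eq_top.2 fun x => ⟨Φ.hor p x, Φ.proj_hor p hpΩ x⟩
  -- The horizontal lift splits dπ, so the vertical space has dimension 3 - 2 = 1 and is spanned by
  -- t.
  have hker : Module.finrank ℝ L.ker = 1 := by
    have := L.finrank_range_add_finrank_ker
    rw [hsurj, finrank_top, hfr2, hfr3] at this
    omega
  have hspan : ∀ v : TangentSpace I₃ p, mfderiv I₃ I₂ π p v = 0 → ∃ c : ℝ, v = c • t := by
    intro v hv
    obtain ⟨c, hc⟩ := (finrank_eq_one_iff_of_nonzero' (⟨t, ht⟩ : L.ker)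
      (fun h0 => ht0 (congrArg Subtype.val h0))).1 hker ⟨v, hv⟩
    exact ⟨c, (congrArg Subtype.val hc).symm⟩
  refine ⟨hspan, ?_⟩
  obtain ⟨y, hy⟩ : ∃ y, Φ.re p y ≠ 0 := by
    by_contra! h
    exact hre (ContinuousLinearMap.ext h)
  obtain ⟨u, hu⟩ := hspan _ (Φ.proj_re p hpΩ y)
  obtain ⟨v, hv⟩ := hspan _ (Φ.proj_im p hpΩ y)
  have hu0 : u ≠ 0 := by
    rintro rfl
    exact hy (by simpa using hu)
  have huv : u ^ 2 + v ^ 2 ≠ 0 := by positivity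
  -- As φ(y) = (u + i v) t and φ(J y) = i φ(y), the solution of φ(x) = t is x = (u + i v)⁻¹ y, with
  -- J acting as i.
  obtain ⟨x, hx⟩ : ∃ x, x = (u / (u ^ 2 + v ^ 2)) • y - (v / (u ^ 2 + v ^ 2)) • J (π p) y :=
    ⟨_, rfl⟩
  have hx1 : Φ.re p x = t := by
    rw [hx, map_sub, map_smul, map_smul, Φ.re_J p hpΩ, hu, hv]
    match_scalars
    field_simp
    ring
  have hx2 : Φ.im p x = 0 := by
    rw [hx, map_sub, map_smul, map_smul, Φ.im_J p hpΩ, hu, hv]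
    match_scalars
    field_simp
    ring
  have hre2 : ∀ a b : ℝ, Φ.re p (a • x + b • J (π p) x) = a • t := by
    intro a b
    rw [map_add, map_smul, map_smul, Φ.re_J p hpΩ, hx1, hx2]
    simp
  have him2 : ∀ a b : ℝ, Φ.im p (a • x + b • J (π p) x) = b • t := by
    intro a b
    rw [map_add, map_smul, map_smul, Φ.im_J p hpΩ, hx1, hx2]
    simp
  have hli : LinearIndependent ℝ ![x, J (π p) x] := by
    rw [LinearIndependent.pair_iff]
    intro a b hab
    have h1 := hre2 a b
    have h2 := him2 a b
    rw [hab, map_zero, eq_comm, smul_eq_zero] at h1 h2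
    exact ⟨h1.resolve_right ht0, h2.resolve_right ht0⟩
  have htop := hli.span_eq_top_of_card_eq_finrank (by simp [hfr2])
  refine ⟨x, hx1, hx2, fun y => ?_⟩
  have hy : y ∈ Submodule.span ℝ (Set.range ![x, J (π p) x]) := htop ▸ Submodule.mem_top
  rw [Matrix.range_cons, Matrix.range_cons, Matrix.range_empty, Set.union_empty,
    Set.singleton_union, Submodule.mem_span_pair] at hy
  obtain ⟨a, b, rfl⟩ := hy
  exact ⟨a, b, rfl, hre2 a b, him2 a b⟩

lemma HiggsPair.isOpen_regularSet (Φ : HiggsPair I₂ I₃ J π Ω) (hΩ : IsOpen Ω) :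
    IsOpen Φ.regularSet := by
  rw [isOpen_iff_mem_nhds]
  rintro p ⟨hpΩ, hp⟩
  obtain ⟨x, hx⟩ : ∃ x, Φ.re p x ≠ 0 := by
    by_contra! h
    exact hp (ContinuousLinearMap.ext h)
  obtain ⟨X, hX, rfl⟩ := exists_smoothVF (I := I₂) x
  filter_upwards [(Φ.smooth_re p hpΩ X hX).eventually_ne_zero hx, hΩ.mem_nhds hpΩ] with q hq hqΩ
  exact ⟨hqΩ, fun h0 => hq (by simp [h0])⟩

/-- A Higgs pair has an adapted frame on its regular set. -/
lemma HiggsPair.exists_adapted (Φ : HiggsPair I₂ I₃ J π Ω) (h2 : Module.finrank ℝ E₂ = 2)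
    (h3 : Module.finrank ℝ E₃ = 3)
    (hJ : IsComplexStructure I₂ J) (hπ : ContMDiff I₃ I₂ ∞ π) (hΩ : IsOpen Ω)
    (hT : IsVerticalGauge I₂ I₃ π Φ.regularSet T) :
    ∃ F e, Φ.Adapted Φ.regularSet F e ∧ F 0 = T := by
  have hopen := Φ.isOpen_regularSet hΩ
  have hbase : ∀ p : P, p ∈ Φ.regularSet → _ := fun p hp =>
    Φ.exists_higgs_basis h2 h3 hp (hT.vertical p hp) (hT.ne_zero p hp)
  have hex : ∀ p : P, ∃ x : TangentSpace I₂ (π p), p ∈ Φ.regularSet →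
      Φ.re p x = T p ∧ Φ.im p x = 0 ∧
      ∀ y, ∃ a b : ℝ, y = a • x + b • J (π p) x ∧ Φ.re p y = a • T p ∧ Φ.im p y = b • T p := by
    intro p
    by_cases hp : p ∈ Φ.regularSet
    · obtain ⟨x, hx⟩ := (hbase p hp).2
      exact ⟨x, fun _ => hx⟩
    · exact ⟨0, fun h => absurd h hp⟩
  choose x hx using hex
  have hdπ : ∀ p ∈ Φ.regularSet, ∀ v, mfderiv I₃ I₂ π p (Φ.hor p v) = v :=
    fun p hp => Φ.proj_hor p hp.1
  have hliaux : ∀ p ∈ Φ.regularSet, ∀ y : TangentSpace I₂ (π p), Φ.re p y = T p →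
      Φ.im p y = 0 → LinearIndependent ℝ ![T p, Φ.hor p y, Φ.hor p (J (π p) y)] := by
    intro p hp y hy1 hy2
    rw [Fintype.linearIndependent_iff]
    intro c hc
    simp only [Fin.sum_univ_three, Matrix.cons_val] at hc
    have h1 := congrArg (mfderiv I₃ I₂ π p) hc
    simp only [map_add, map_smul, hdπ p hp, hT.vertical p hp, map_zero, smul_zero, zero_add] at h1
    have hr := congrArg (Φ.re p) h1
    have hi := congrArg (Φ.im p) h1
    rw [map_add, map_smul, map_smul, Φ.re_J p hp.1, hy1, hy2, map_zero, neg_zero, smul_zero,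
      add_zero, smul_eq_zero] at hr
    rw [map_add, map_smul, map_smul, Φ.im_J p hp.1, hy1, hy2, map_zero, smul_zero,
      zero_add, smul_eq_zero] at hi
    have hr := hr.resolve_right (hT.ne_zero p hp)
    have hi := hi.resolve_right (hT.ne_zero p hp)
    rw [hr, hi, zero_smul, zero_smul, add_zero, add_zero, smul_eq_zero] at hc
    intro i
    fin_cases i
    exacts [hc.resolve_right (hT.ne_zero p hp), hr, hi]
  have hsmooth : ∀ p ∈ Φ.regularSet, SmoothVF I₃ (fun q => Φ.hor q (x q)) p ∧
      SmoothVF I₃ (fun q => Φ.hor q (J (π q) (x q))) p := by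
    intro p hp
    -- The vector x q with φ(x q) = T q was chosen pointwise. To see that its lift is smooth,
    -- compare it with a smooth field X equal to x p at π p: if φ(X) = (u + i v) T, then x = (u + i
    -- v)⁻¹ X near p.
    obtain ⟨X, hX, hXp⟩ := exists_smoothVF (I := I₂) (x p)
    have hJX : SmoothVF I₂ (fun y => J y (X y)) (π p) := hJ.smooth _ X hX
    have hcoef : ∀ q : P, ∃ u v : ℝ, q ∈ Φ.regularSet →
        Φ.re q (X (π q)) = u • T q ∧ Φ.im q (X (π q)) = v • T q := by
      intro q
      by_cases hq : q ∈ Φ.regularSet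
      · obtain ⟨u, hu⟩ := (hbase q hq).1 _ (Φ.proj_re q hq.1 (X (π q)))
        obtain ⟨v, hv⟩ := (hbase q hq).1 _ (Φ.proj_im q hq.1 (X (π q)))
        exact ⟨u, v, fun _ => ⟨hu, hv⟩⟩
      · exact ⟨0, 0, fun h => absurd h hq⟩
    choose u v huv using hcoef
    -- In this smooth frame, u and v are the first coefficients of Re φ(X) and Im φ(X), hence smooth
    -- at p.
    let L : Fin 3 → Π q : P, TangentSpace I₃ q :=
      ![T, Φ.liftHor X, Φ.liftHor fun y => J y (X y)]
    have hL : ∀ i, SmoothVF I₃ (L i) p := by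
      intro i
      fin_cases i
      exacts [hT.smooth p hp, Φ.smooth_hor p hp.1 X hX, Φ.smooth_hor p hp.1 _ hJX]
    have hLi : LinearIndependent ℝ fun i => L i p := by
      convert! hliaux p hp (x p) (hx p hp).1 (hx p hp).2.1 using 1
      ext i
      fin_cases i <;> simp [L, HiggsPair.liftHor, hXp]
    have hev := hopen.mem_nhds hp
    have hsu : SmoothFn I₃ u p :=
      smoothFn_coeff h3 hL hLi (Φ.smooth_re p hp.1 X hX) (x := ![u, fun _ => 0, fun _ => 0])
        (by filter_upwards [hev] with q hq
            rw [(huv q hq).1, Fin.sum_univ_three]; simp [L]) 0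
    have hsv : SmoothFn I₃ v p :=
      smoothFn_coeff h3 hL hLi (Φ.smooth_im p hp.1 X hX) (x := ![v, fun _ => 0, fun _ => 0])
        (by filter_upwards [hev] with q hq
            rw [(huv q hq).2, Fin.sum_univ_three]; simp [L]) 0
    have hup : u p ≠ 0 := by
      intro h0
      have := (huv p hp).1
      rw [hXp, (hx p hp).1, h0, zero_smul] at this
      exact hT.ne_zero p hp this
    have hn0 : u p * u p + v p * v p ≠ 0 := by
      have := mul_self_pos.2 hup
      have := mul_self_nonneg (v p)
      positivity
    have hsn := (hsu.mul hsu).add (hsv.mul hsv)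
    have hsi := hsn.inv hn0
    have hxq : ∀ᶠ q in 𝓝 p, x q = (u q * (u q * u q + v q * v q)⁻¹) • X (π q)
        - (v q * (u q * u q + v q * v q)⁻¹) • J (π q) (X (π q)) := by
      filter_upwards [hev, ContinuousAt.eventually_ne (ContMDiffAt.continuousAt hsn) hn0]
        with q hq hnq
      have hnq : u q * u q + v q * v q ≠ 0 := hnq
      obtain ⟨a, b, hab, ha, hb⟩ := (hx q hq).2.2
        ((u q * (u q * u q + v q * v q)⁻¹) • X (π q)
        - (v q * (u q * u q + v q * v q)⁻¹) • J (π q) (X (π q)))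
      rw [map_sub, map_smul, map_smul, Φ.re_J q hq.1, (huv q hq).1, (huv q hq).2] at ha
      rw [map_sub, map_smul, map_smul, Φ.im_J q hq.1, (huv q hq).1, (huv q hq).2] at hb
      have ha1 : (1 - a) • T q = 0 := by
        have h1 : 1 - (u q * (u q * u q + v q * v q)⁻¹ * u q + v q * (u q * u q + v q * v q)⁻¹ * v q) = 0 := by
          rw [sub_eq_zero, ← mul_inv_cancel₀ hnq]
          ring
        rw [← zero_smul ℝ (T q), ← h1, sub_smul, sub_smul, ← ha]
        module
      have hb1 : b • T q = 0 := by
        rw [← hb]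
        match_scalars
        field_simp
        ring
      rw [smul_eq_zero] at ha1 hb1
      have ha2 := ha1.resolve_right (hT.ne_zero q hq)
      have hb2 := hb1.resolve_right (hT.ne_zero q hq)
      rw [hab, hb2, ← sub_eq_zero.1 ha2]
      simp
    constructor
    · refine (((hL 1).smul (hsu.mul hsi)).sub ((hL 2).smul (hsv.mul hsi))).congr ?_
      filter_upwards [hxq] with q hq
      simp [hq, L, HiggsPair.liftHor]
    · refine (((hL 2).smul (hsu.mul hsi)).add ((hL 1).smul (hsv.mul hsi))).congr ?_
      filter_upwards [hxq] with q hq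
      simp [hq, L, HiggsPair.liftHor, hJ.sq]
  let F : Fin 3 → Π q : P, TangentSpace I₃ q :=
    ![T, fun q => Φ.hor q (x q), fun q => Φ.hor q (J (π q) (x q))]
  have hF : ∀ p ∈ Φ.regularSet, ∀ i, SmoothVF I₃ (F i) p := by
    intro p hp i
    fin_cases i
    exacts [hT.smooth p hp, (hsmooth p hp).1, (hsmooth p hp).2]
  have hli : ∀ p ∈ Φ.regularSet, LinearIndependent ℝ fun i => F i p := by
    intro p hp
    convert! hliaux p hp (x p) (hx p hp).1 (hx p hp).2.1 using 1
    ext i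
    fin_cases i <;> rfl
  obtain ⟨e, he⟩ := exists_coframe h3 hopen hF hli
  have hproj : ∀ p ∈ Φ.regularSet, ∀ v,
      mfderiv I₃ I₂ π p v = e 1 p v • x p + e 2 p v • J (π p) (x p) := by
    intro p hp v
    conv_lhs => rw [he.expand p hp v]
    rw [Fin.sum_univ_three, map_add, map_add, map_smul, map_smul, map_smul]
    change e 0 p v • mfderiv I₃ I₂ π p (T p) + e 1 p v • mfderiv I₃ I₂ π p (Φ.hor p (x p))
      + e 2 p v • mfderiv I₃ I₂ π p (Φ.hor p (J (π p) (x p))) = _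
    rw [hT.vertical p hp, hdπ p hp, hdπ p hp, smul_zero, zero_add]
  refine ⟨F, e, ⟨he, fun p hp => hp.1, fun p _ => hπ.contMDiffAt, ?_, ?_, ?_⟩, rfl⟩
  · intro p hp v
    rw [hproj p hp, map_add, map_smul, map_smul]
    rfl
  · intro p hp v
    rw [hproj p hp, map_add, map_smul, map_smul, Φ.re_J p hp.1, (hx p hp).1, (hx p hp).2.1]
    simp [F]
  · intro p hp v
    rw [hproj p hp, map_add, map_smul, map_smul, Φ.im_J p hp.1, (hx p hp).1, (hx p hp).2.1]
    simp [F]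

end Construction

/-! ### From Hitchin fields to hyperCR Einstein–Weyl structures. -/

section HitchinToWeyl

variable {E₂ : Type*} [NormedAddCommGroup E₂] [NormedSpace ℝ E₂] [FiniteDimensional ℝ E₂]
  {H₂ : Type*} [TopologicalSpace H₂] {I₂ : ModelWithCorners ℝ E₂ H₂} [I₂.Boundaryless]
  {N : Type*} [TopologicalSpace N] [ChartedSpace H₂ N] [IsManifold I₂ ∞ N]
  {E₃ : Type*} [NormedAddCommGroup E₃] [NormedSpace ℝ E₃] [FiniteDimensional ℝ E₃]
  {H₃ : Type*} [TopologicalSpace H₃] {I₃ : ModelWithCorners ℝ E₃ H₃}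
  {P : Type*} [TopologicalSpace P] [ChartedSpace H₃ P] [IsManifold I₃ ∞ P]
  {J : Π x : N, TangentSpace I₂ x →L[ℝ] TangentSpace I₂ x} {π : P → N} {Ω : Set P}
  {Φ : HiggsPair I₂ I₃ J π Ω} {T : Π q : P, TangentSpace I₃ q}

/-- The Weyl structure of a Hitchin field is hyperCR Einstein–Weyl, and the vertical field is one of
its hyperCR congruences. -/
theorem HiggsPair.IsHitchin.isHyperCREinsteinWeyl (hΦ : Φ.IsHitchin)
    (h2 : Module.finrank ℝ E₂ = 2) (h3 : Module.finrank ℝ E₃ = 3) (hJ : IsComplexStructure I₂ J)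
    (hπ : ContMDiff I₃ I₂ ∞ π) (hΩ : IsOpen Ω) (hT : IsVerticalGauge I₂ I₃ π Φ.regularSet T) :
    (∃ W : WeylStructure I₃ Φ.regularSet, Φ.Induces T W) ∧
      ∀ W : WeylStructure I₃ Φ.regularSet, Φ.Induces T W →
        (∃ D, W.IsWeylConnection D) ∧
        ∀ D, W.IsWeylConnection D → W.IsHyperCREinsteinWeyl D ∧ W.IsHyperCRCongruence D T := by
  obtain ⟨F, e, hF, rfl⟩ := Φ.exists_adapted h2 h3 hJ hπ hΩ hT
  refine ⟨hF.exists_induces hJ, fun W hI => ?_⟩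
  have hW := hF.structureEq hΦ (hF.isOrthonormal hI) hI
  refine ⟨⟨_, hW.isWeylConnection⟩, fun D hD => ⟨⟨hW.isEinsteinWeyl hD, F, _, hW.isHyperCRFrame hD⟩,
    F, _, ![1, 0, 0], hW.isHyperCRFrame hD, by simp [Fin.sum_univ_three], fun p _ => ?_⟩⟩
  simp [Fin.sum_univ_three]

end HitchinToWeyl

/-! ### Composition with a smooth map as a smooth operation on continuous functions. -/

section Omega

universe u

variable {K : Type*} [TopologicalSpace K] [CompactSpace K]
  {E : Type u} [NormedAddCommGroup E] [NormedSpace ℝ E]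
  {F : Type u} [NormedAddCommGroup F] [NormedSpace ℝ F]

variable (K E F) in
/-- Pointwise application of operator-valued functions. -/
def applyL : C(K, E →L[ℝ] F) →L[ℝ] C(K, E) →L[ℝ] C(K, F) :=
  LinearMap.mkContinuous₂
    (LinearMap.mk₂ ℝ (fun (A : C(K, E →L[ℝ] F)) (h : C(K, E)) =>
        (⟨fun t => A t (h t), by fun_prop⟩ : C(K, F)))
      (fun _ _ _ => by ext; simp) (fun _ _ _ => by ext; simp)
      (fun _ _ _ => by ext; simp) (fun _ _ _ => by ext; simp)) 1 fun A h => by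
    rw [ContinuousMap.norm_le _ (by positivity)]
    intro t
    rw [one_mul]
    exact (A t).le_of_opNorm_le_of_le (A.norm_coe_le_norm t) (h.norm_coe_le_norm t)

/-- The mean value inequality bounds the remainder at each point. The bound is uniform because f' is
uniformly continuous along the compact image of u. -/
lemma hasFDerivAt_postcomp (f : C(E, F)) (f' : C(E, E →L[ℝ] F)) (hf : ∀ x, HasFDerivAt f (f' x) x)
    (u : C(K, E)) : HasFDerivAt (fun u : C(K, E) => f.comp u) (applyL K E F (f'.comp u)) u := by
  rw [hasFDerivAt_iff_isLittleO_nhds_zero, Asymptotics.isLittleO_iff]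
  intro c hc
  have hcpt : IsCompact (Set.range u) := isCompact_range u.continuous
  have hu := hcpt.uniformContinuousAt_of_continuousAt f' (fun a _ => f'.continuous.continuousAt)
    (Metric.dist_mem_uniformity hc)
  obtain ⟨δ, hδ, hδ'⟩ := Metric.mem_uniformity_dist.1 hu
  filter_upwards [Metric.ball_mem_nhds (0 : C(K, E)) hδ] with h hh
  rw [mem_ball_zero_iff] at hh
  rw [ContinuousMap.norm_le _ (by positivity)]
  intro t
  have hconv := (convex_ball (u t) δ).norm_image_sub_le_of_norm_hasFDerivWithin_le' (𝕜 := ℝ)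
    (f := f) (f' := f') (φ := f' (u t)) (C := c) (x := u t) (y := u t + h t)
    (fun x _ => (hf x).hasFDerivWithinAt) (fun x hx => ?_) (by simpa using hδ)
    (by simpa using (h.norm_coe_le_norm t).trans_lt hh)
  · simp only [add_sub_cancel_left] at hconv
    exact hconv.trans (by gcongr; exact h.norm_coe_le_norm t)
  · have := hδ' (a := u t) (b := x) (by rwa [Metric.mem_ball, dist_comm] at hx) ⟨t, rfl⟩
    rw [← dist_eq_norm, dist_comm]
    exact this.le

/-- Composition with a smooth function is a smooth operation on continuous functions on a compact
space. -/
lemma contDiff_postcomp_nat (n : ℕ) : ∀ {F : Type u} [NormedAddCommGroup F] [NormedSpace ℝ F]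
    (f : C(E, F)), ContDiff ℝ ∞ f → ContDiff ℝ n fun u : C(K, E) => f.comp u := by
  induction n with
  | zero =>
    intro F _ _ f hf
    exact contDiff_zero.2 f.continuous_postcomp
  | succ n ih =>
    intro F _ _ f hf
    -- The derivative is again a postcomposition, with the derivative of f, followed by the
    -- continuous linear map `applyL`. Its target is a space of operators, so the induction must
    -- hold for all F.
    have hf' : ContDiff ℝ ∞ (fderiv ℝ f) := hf.fderiv_right (by simp)
    push_cast
    refine contDiff_succ_iff_hasFDerivAt.2 ⟨_, ?_, hasFDerivAt_postcomp f ⟨_, hf'.continuous⟩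
      fun x => (hf.differentiable (by simp) x).hasFDerivAt⟩
    exact (applyL K E F).contDiff.comp (ih ⟨_, hf'.continuous⟩ hf')

lemma contDiff_postcomp (f : C(E, F)) (hf : ContDiff ℝ ∞ f) :
    ContDiff ℝ ∞ fun u : C(K, E) => f.comp u :=
  contDiff_infty.2 fun n => contDiff_postcomp_nat n f hf

end Omega

/-! ### Local flows and their smooth dependence, from an integral equation. -/

section Flow

open Set

universe u

variable {E : Type u} [NormedAddCommGroup E] [NormedSpace ℝ E]

variable (E) in
/-- The primitive vanishing at `0`. -/
def primL : C(Icc (-1 : ℝ) 1, E) →L[ℝ] C(Icc (-1 : ℝ) 1, E) :=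
  LinearMap.mkContinuous
    { toFun := fun w => ⟨fun t => ∫ s in (0 : ℝ)..t, IccExtend (by norm_num) w s, by
        refine (intervalIntegral.continuous_primitive (fun a b => ?_) 0).comp continuous_subtype_val
        exact (w.continuous.Icc_extend' (h := by norm_num)).intervalIntegrable a b⟩
      map_add' := fun w w' => by
        ext t
        exact intervalIntegral.integral_add
          ((w.continuous.Icc_extend' (h := by norm_num)).intervalIntegrable _ _)
          ((w'.continuous.Icc_extend' (h := by norm_num)).intervalIntegrable _ _)
      map_smul' := fun c w => by
        ext t
        exact intervalIntegral.integral_smul c _ } 1 fun w => by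
    rw [ContinuousMap.norm_le _ (by positivity)]
    intro t
    refine (intervalIntegral.norm_integral_le_of_norm_le_const (C := ‖w‖) fun s _ =>
      w.norm_coe_le_norm _).trans ?_
    rw [one_mul, sub_zero]
    exact mul_le_of_le_one_right (norm_nonneg _) (abs_le.2 t.2)

lemma primL_apply (w : C(Icc (-1 : ℝ) 1, E)) (t : Icc (-1 : ℝ) 1) :
    primL E w t = ∫ s in (0 : ℝ)..t, IccExtend (by norm_num) w s := rfl

lemma norm_primL_le (w : C(Icc (-1 : ℝ) 1, E)) : ‖primL E w‖ ≤ ‖w‖ := by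
  simpa using LinearMap.mkContinuous_norm_le _ zero_le_one _ |> fun h =>
    (primL E).le_of_opNorm_le h w

variable [CompleteSpace E] (v : C(E, E))

/-- The integral equation of the curve `u` with `u' = ε v(u)`, `u 0 = y`. -/
def flowEq (x : (ℝ × E) × C(Icc (-1 : ℝ) 1, E)) : C(Icc (-1 : ℝ) 1, E) :=
  x.2 - (ContinuousMap.const _ x.1.2 + x.1.1 • primL E (v.comp x.2))

variable {v} {k : NNReal}

lemma norm_comp_sub_le (hk : LipschitzWith k v) (u u' : C(Icc (-1 : ℝ) 1, E)) :
    ‖v.comp u - v.comp u'‖ ≤ k * ‖u - u'‖ := by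
  rw [ContinuousMap.norm_le _ (by positivity)]
  intro t
  refine (hk.norm_sub_le (u t) (u' t)).trans ?_
  gcongr
  exact (u - u').norm_coe_le_norm t

/-- On [-1, 1] the primitive from 0 has norm at most one, so u ↦ y + ε ∫ v(u) contracts by |ε| k.
Time is rescaled into ε so that all curves share this interval. -/
lemma existsUnique_flowEq (hk : LipschitzWith k v) {x : ℝ × E} (hx : |x.1| * k < 1) :
    ∃! u, flowEq v (x, u) = 0 := by
  let f : C(Icc (-1 : ℝ) 1, E) → C(Icc (-1 : ℝ) 1, E) := fun u =>
    ContinuousMap.const _ x.2 + x.1 • primL E (v.comp u)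
  have hf : ContractingWith (Real.nnabs x.1 * k) f := by
    refine ⟨by rw [← NNReal.coe_lt_coe]; simpa using hx, LipschitzWith.of_dist_le_mul fun u u' => ?_⟩
    rw [dist_eq_norm, dist_eq_norm]
    simp only [f, add_sub_add_left_eq_sub, ← smul_sub, ← map_sub, norm_smul]
    rw [NNReal.coe_mul, Real.coe_nnabs, Real.norm_eq_abs, mul_assoc]
    gcongr
    exact (norm_primL_le _).trans (norm_comp_sub_le hk u u')
  refine ⟨hf.fixedPoint, sub_eq_zero.2 hf.fixedPoint_isFixedPt.eq.symm, fun u hu => ?_⟩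
  exact hf.fixedPoint_unique (sub_eq_zero.1 hu).symm

lemma contDiff_flowEq (hv : ContDiff ℝ ∞ v) : ContDiff ℝ ∞ (flowEq v) := by
  have hc : ContDiff ℝ ∞ fun y : E => ContinuousMap.const (Icc (-1 : ℝ) 1) y :=
    (LinearMap.mkContinuous (⟨⟨fun y : E => ContinuousMap.const (Icc (-1 : ℝ) 1) y,
      fun _ _ => rfl⟩, fun _ _ => rfl⟩ : E →ₗ[ℝ] C(Icc (-1 : ℝ) 1, E)) 1 fun y => by
        rw [ContinuousMap.norm_le _ (by positivity), one_mul]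
        exact fun t => le_rfl).contDiff
  exact contDiff_snd.sub ((hc.comp (contDiff_snd.comp contDiff_fst)).add
    ((contDiff_fst.comp contDiff_fst).smul ((primL E).contDiff.comp
      ((contDiff_postcomp v hv).comp contDiff_snd))))

/-- The partial derivative in the curve is 1 - A with ‖A‖ ≤ |ε| k < 1, inverted by a Neumann series;
the Lipschitz constant bounds the derivative of v. -/
lemma isInvertible_fderiv_flowEq (hv : ContDiff ℝ ∞ v) (hk : LipschitzWith k v)
    {x : (ℝ × E) × C(Icc (-1 : ℝ) 1, E)} (hx : |x.1.1| * k < 1) :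
    (fderiv ℝ (flowEq v) x ∘L .inr ℝ (ℝ × E) C(Icc (-1 : ℝ) 1, E)).IsInvertible := by
  have hv' : ContDiff ℝ ∞ (fderiv ℝ v) := hv.fderiv_right (by simp)
  let A : C(Icc (-1 : ℝ) 1, E) →L[ℝ] C(Icc (-1 : ℝ) 1, E) :=
    x.1.1 • (primL E ∘L applyL _ E E (ContinuousMap.comp ⟨_, hv'.continuous⟩ x.2))
  have hA : ‖A‖ < 1 := by
    refine lt_of_le_of_lt (ContinuousLinearMap.opNorm_le_bound _ (by positivity) fun h => ?_) hx
    rw [smul_apply, norm_smul, Real.norm_eq_abs, mul_assoc]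
    gcongr
    refine (norm_primL_le _).trans ?_
    rw [ContinuousMap.norm_le _ (by positivity)]
    intro t
    exact (fderiv ℝ v (x.2 t)).le_of_opNorm_le_of_le (norm_fderiv_le_of_lipschitz ℝ hk)
      (h.norm_coe_le_norm t)
  have h1 : HasFDerivAt (fun u => flowEq v (x.1, u))
      (fderiv ℝ (flowEq v) x ∘L .inr ℝ (ℝ × E) C(Icc (-1 : ℝ) 1, E)) x.2 :=
    HasFDerivAt.comp (g := flowEq v) (f := fun u => (x.1, u)) x.2
      ((contDiff_flowEq hv).differentiable (by simp) x).hasFDerivAt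
      (hasFDerivAt_prodMk_right x.1 x.2)
  have h2 : HasFDerivAt (fun u => flowEq v (x.1, u)) (1 - A) x.2 := by
    have h3 : HasFDerivAt (fun u => primL E (v.comp u)) _ x.2 :=
      (primL E).hasFDerivAt.comp x.2 (hasFDerivAt_postcomp v ⟨_, hv'.continuous⟩
        (fun y => (hv.differentiable (by simp) y).hasFDerivAt) x.2)
    exact (hasFDerivAt_id x.2).sub
      ((h3.const_smul x.1.1).const_add (ContinuousMap.const _ x.1.2))
  rw [h1.unique h2]
  exact ⟨ContinuousLinearEquiv.unitsEquiv ℝ _ (Units.oneSub A hA), by ext; rfl⟩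

open Classical in
variable (v) in
/-- The curve `u` with `u' = ε v(u)`, `u 0 = y`, for small `ε`. -/
def flowCurve (x : ℝ × E) : C(Icc (-1 : ℝ) 1, E) :=
  if h : ∃ u, flowEq v (x, u) = 0 then h.choose else 0

lemma flowEq_flowCurve (hk : LipschitzWith k v) {x : ℝ × E} (hx : |x.1| * k < 1) :
    flowEq v (x, flowCurve v x) = 0 := by
  have h := (existsUnique_flowEq hk hx).exists
  rw [flowCurve, dif_pos h]
  exact h.choose_spec

/-- The implicit function theorem yields a smooth family of solutions near x, and uniqueness of the
fixed point identifies it with `flowCurve`. -/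
lemma contDiffAt_flowCurve (hv : ContDiff ℝ ∞ v) (hk : LipschitzWith k v) {x : ℝ × E}
    (hx : |x.1| * k < 1) : ContDiffAt ℝ ∞ (flowCurve v) x := by
  have hcd : ContDiffAt ℝ ∞ (flowEq v) (x, flowCurve v x) := (contDiff_flowEq hv).contDiffAt
  have hinv := isInvertible_fderiv_flowEq hv hk (x := (x, flowCurve v x)) hx
  have h := hcd.contDiffAt_implicitFunction (by simp) hinv
  refine h.congr_of_eventuallyEq ?_
  have hopen : ∀ᶠ y : ℝ × E in 𝓝 x, |y.1| * k < 1 :=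
    (continuous_fst.abs.mul continuous_const).continuousAt.eventually_lt
      continuousAt_const hx
  filter_upwards [hcd.eventually_apply_implicitFunction (by simp) hinv, hopen] with y hy hy1
  rw [flowEq_flowCurve hk hx] at hy
  exact (existsUnique_flowEq hk hy1).unique (flowEq_flowCurve hk hy1) hy

lemma flowCurve_apply (hk : LipschitzWith k v) {x : ℝ × E} (hx : |x.1| * k < 1)
    (t : Icc (-1 : ℝ) 1) : flowCurve v x t
      = x.2 + x.1 • ∫ s in (0 : ℝ)..t, IccExtend (by norm_num) (v.comp (flowCurve v x)) s := by
  have := congrArg (fun u => u t) (sub_eq_zero.1 (flowEq_flowCurve hk hx))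
  exact this

variable (v) in
/-- The flow of `v` for small time. -/
def flow (x : ℝ × E) : E := flowCurve v x ⟨1, by norm_num⟩

/-- If u solves the equation with parameter ε, then s ↦ u(t s) solves it with parameter t ε, by
substitution in the integral; evaluate at s = 1. -/
lemma flowCurve_eq_flow (hk : LipschitzWith k v) {x : ℝ × E} (hx : |x.1| * k < 1)
    (t : Icc (-1 : ℝ) 1) : flowCurve v x t = flow v (t * x.1, x.2) := by
  have ht : |(t : ℝ)| ≤ 1 := abs_le.2 t.2
  have hx' : |(t * x.1, x.2).1| * k < 1 := by
    refine lt_of_le_of_lt ?_ hx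
    rw [abs_mul]
    gcongr
    exact mul_le_of_le_one_left (abs_nonneg _) ht
  have hmem : ∀ s : Icc (-1 : ℝ) 1, (t * s : ℝ) ∈ Icc (-1 : ℝ) 1 := fun s => by
    rw [mem_Icc, ← abs_le, abs_mul]
    exact mul_le_one₀ ht (abs_nonneg _) (abs_le.2 s.2)
  let w : C(Icc (-1 : ℝ) 1, E) := (flowCurve v x).comp ⟨fun s => ⟨t * s, hmem s⟩, by fun_prop⟩
  have hw : flowEq v ((t * x.1, x.2), w) = 0 := by
    refine sub_eq_zero.2 (ContinuousMap.ext fun s => ?_)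
    change flowCurve v x ⟨t * s, hmem s⟩ = x.2 + (t * x.1) • primL E (v.comp w) s
    rw [flowCurve_apply hk hx, primL_apply, mul_smul, smul_comm]
    congr 2
    have h1 := intervalIntegral.smul_integral_comp_mul_left (a := 0) (b := s)
      (IccExtend (by norm_num) (v.comp (flowCurve v x))) (t : ℝ)
    rw [mul_zero] at h1
    rw [← h1]
    congr 1
    refine intervalIntegral.integral_congr fun r hr => ?_
    have hr1 : r ∈ Icc (-1 : ℝ) 1 := by
      have h0 : (0 : ℝ) ∈ Icc (-1 : ℝ) 1 := by norm_num
      exact uIcc_subset_Icc h0 s.2 hr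
    rw [IccExtend_of_mem _ _ hr1, IccExtend_of_mem _ _ (hmem ⟨r, hr1⟩)]
    rfl
  have hu := (existsUnique_flowEq hk hx').unique hw (flowEq_flowCurve hk hx')
  have := congrArg (fun u => u ⟨1, by norm_num⟩) hu
  rw [flow, ← this]
  simp [w]

lemma contDiffAt_flow (hv : ContDiff ℝ ∞ v) (hk : LipschitzWith k v) {x : ℝ × E}
    (hx : |x.1| * k < 1) : ContDiffAt ℝ ∞ (flow v) x :=
  (ContinuousMap.evalCLM (M := E) ℝ (⟨1, by norm_num⟩ : Icc (-1 : ℝ) 1)).contDiff.contDiffAt.comp x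
    (contDiffAt_flowCurve hv hk hx)

lemma flow_zero (hk : LipschitzWith k v) (y : E) : flow v (0, y) = y := by
  rw [flow, flowCurve_apply hk (by simp)]
  simp

lemma hasDerivAt_flow (hk : LipschitzWith k v) {ε : ℝ} (y : E) (hε : |ε| * k < 1) :
    HasDerivAt (fun s => flow v (s, y)) (v (flow v (ε, y))) ε := by
  -- With δ slightly larger than |ε|, the one curve of parameter δ describes the flow at all times
  -- near ε, at position s / δ, and the fundamental theorem of calculus applies in the interior.
  obtain ⟨δ, hδ0, hδ, hδk⟩ : ∃ δ : ℝ, 0 < δ ∧ |ε| < δ ∧ |δ| * k < 1 := by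
    have h1 : ∀ᶠ δ : ℝ in 𝓝[>] |ε|, |δ| * k < 1 := by
      refine Filter.Eventually.filter_mono nhdsWithin_le_nhds ?_
      refine (continuous_abs.mul continuous_const).continuousAt.eventually_lt
        continuousAt_const ?_
      simpa using hε
    obtain ⟨δ, h1, h2⟩ := (h1.and self_mem_nhdsWithin).exists
    exact ⟨δ, (abs_nonneg _).trans_lt h2, h2, h1⟩
  let g : ℝ → E := IccExtend (by norm_num) (v.comp (flowCurve v (δ, y)))
  have hg : Continuous g :=
    ContinuousMap.continuous _ |>.Icc_extend' 
  have hmem : ∀ s : ℝ, |s| ≤ δ → s / δ ∈ Icc (-1 : ℝ) 1 := fun s hs => by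
    rw [mem_Icc, ← abs_le, abs_div, abs_of_pos hδ0]
    exact div_le_one_of_le₀ hs hδ0.le
  have heq : ∀ s : ℝ, |s| ≤ δ → flow v (s, y) = y + δ • ∫ r in (0 : ℝ)..(s / δ), g r := by
    intro s hs
    have h1 := flowCurve_eq_flow hk (x := (δ, y)) hδk ⟨s / δ, hmem s hs⟩
    rw [flowCurve_apply hk hδk] at h1
    rw [div_mul_cancel₀ _ hδ0.ne'] at h1
    exact h1.symm
  have hgε : g (ε / δ) = v (flow v (ε, y)) := by
    have h1 := flowCurve_eq_flow hk (x := (δ, y)) hδk ⟨ε / δ, hmem ε hδ.le⟩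
    rw [div_mul_cancel₀ _ hδ0.ne'] at h1
    rw [← h1]
    exact IccExtend_of_mem _ _ (hmem ε hδ.le)
  have hd : HasDerivAt (fun s => y + δ • ∫ r in (0 : ℝ)..(s / δ), g r) (g (ε / δ)) ε := by
    have h1 := (intervalIntegral.integral_hasDerivAt_right (hg.intervalIntegrable 0 (ε / δ))
      (hg.stronglyMeasurableAtFilter _ _) hg.continuousAt)
    have h2 := h1.scomp ε ((hasDerivAt_id ε).div_const δ)
    have h3 := (h2.const_smul δ).const_add y
    convert! h3 using 1
    rw [smul_smul, mul_one_div_cancel hδ0.ne', one_smul]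
  rw [← hgε]
  refine hd.congr_of_eventuallyEq ?_
  filter_upwards [continuous_abs.continuousAt.eventually_lt continuousAt_const hδ] with s hs
    using heq s hs.le

end Flow

/-! ### The flow box theorem in a vector space. -/

section FlowBox

variable {E : Type*} [NormedAddCommGroup E] [NormedSpace ℝ E] [FiniteDimensional ℝ E]
  {v : E → E} {b : E} {U : Set E}

/-- A smooth vector field coincides near a point with one which is smooth and Lipschitz everywhere. -/
lemma exists_lipschitz_extension (hU : U ∈ 𝓝 b) (hv : ContDiffOn ℝ ∞ v U) :
    ∃ (w : C(E, E)) (k : NNReal) (V : Set E), ContDiff ℝ ∞ w ∧ LipschitzWith k w ∧ IsOpen V ∧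
      b ∈ V ∧ V ⊆ U ∧ ∀ x ∈ V, w x = v x := by
  obtain ⟨r, hr, hrU⟩ := Metric.mem_nhds_iff.1 (interior_mem_nhds.2 hU)
  -- The cutoff is one on the ball of radius r/3, where the field is unchanged, and its support
  -- stays inside the ball of radius r, where v is smooth.
  let χ : ContDiffBump b := ⟨r / 3, r / 2, by positivity, by linarith⟩
  have hw : ContDiff ℝ ∞ fun x => χ x • v x := by
    rw [contDiff_iff_contDiffAt]
    intro x
    by_cases hx : x ∈ Metric.ball b r
    · exact χ.contDiff.contDiffAt.smul (hv.contDiffAt (mem_interior_iff_mem_nhds.1 (hrU hx)))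
    · have hx' : x ∉ tsupport χ := by
        rw [χ.tsupport_eq]
        intro h
        refine hx (Metric.closedBall_subset_ball ?_ h)
        change r / 2 < r
        linarith
      refine (contDiffAt_const (c := (0 : E))).congr_of_eventuallyEq ?_
      filter_upwards [notMem_tsupport_iff_eventuallyEq.1 hx'] with y hy
      simp [hy]
  have hc : HasCompactSupport fun x => χ x • v x := χ.hasCompactSupport.smul_right
  obtain ⟨k, hk⟩ := hw.lipschitzWith_of_hasCompactSupport hc (by simp)
  refine ⟨⟨_, hw.continuous⟩, k, Metric.ball b (r / 3), hw, hk, Metric.isOpen_ball,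
    Metric.mem_ball_self (by positivity), ?_, fun x hx => ?_⟩
  · exact (Metric.ball_subset_ball (by linarith)).trans (hrU.trans interior_subset)
  · have : χ x = 1 := χ.one_of_mem_closedBall (Metric.ball_subset_closedBall hx)
    simp [this]

/-- The space of parameters of a flow box: the leaves and the positions on them. -/
abbrev BoxSpace : Type := EuclideanSpace ℝ (Fin 2) × EuclideanSpace ℝ (Fin 1)

/-- The unit vector along the leaves. -/
def leafVec : EuclideanSpace ℝ (Fin 1) := EuclideanSpace.single 0 1

lemma smul_leafVec (s : EuclideanSpace ℝ (Fin 1)) : s 0 • leafVec = s := by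
  ext i
  fin_cases i
  simp [leafVec]

/-- A smooth parametrization whose last coordinate lines are integral curves of `v`. -/
lemma exists_flow_parametrization (hE : Module.finrank ℝ E = 3) (hU : U ∈ 𝓝 b)
    (hv : ContDiffOn ℝ ∞ v U) (hb : v b ≠ 0) :
    ∃ Ψ : BoxSpace → E, Ψ 0 = b ∧ (∀ᶠ x in 𝓝 0, ContDiffAt ℝ ∞ Ψ x) ∧
      (∃ A : BoxSpace ≃L[ℝ] E, HasFDerivAt Ψ (A : BoxSpace →L[ℝ] E) 0) ∧
      ∀ᶠ x in 𝓝 0, Ψ x ∈ interior U ∧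
        HasDerivAt (fun τ : ℝ => Ψ (x.1, x.2 + τ • leafVec)) (v (Ψ x)) 0 := by
  obtain ⟨w, k, V, hw, hk, hV, hbV, hVU, hwv⟩ := exists_lipschitz_extension hU hv
  have hl0 : leafVec ≠ 0 := by simp [leafVec]
  obtain ⟨A₁⟩ : Nonempty (BoxSpace ≃L[ℝ] E) :=
    ⟨ContinuousLinearEquiv.ofFinrankEq (by simp [hE])⟩
  -- This makes A send the leaf direction to v b, so the images of the vectors (y, 0) form a plane
  -- transversal to v at b; Ψ flows out of that plane, with the leaf coordinate as time.
  obtain ⟨A₂, hA₂⟩ := SeparatingDual.exists_continuousLinearEquiv_apply_eq (R := ℝ)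
    (x := A₁ (0, leafVec)) (y := v b) (by simpa using hl0) hb
  let A : BoxSpace ≃L[ℝ] E := A₁.trans A₂
  have hA : A (0, leafVec) = v b := hA₂
  let L : BoxSpace →L[ℝ] ℝ × E :=
    ((EuclideanSpace.proj 0).comp (.snd ℝ _ _)).prod
      ((A : BoxSpace →L[ℝ] E).comp ((ContinuousLinearMap.inl ℝ _ _).comp (.fst ℝ _ _)))
  let Λ : BoxSpace → ℝ × E := fun x => (0, b) + L x
  have hΛ : ContDiff ℝ ∞ Λ := contDiff_const.add L.contDiff
  let Ψ : BoxSpace → E := fun x => flow w (Λ x)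
  have hΛ0 : Λ 0 = (0, b) := by simp [Λ]
  have hΨ0 : Ψ 0 = b := by simp only [Ψ, hΛ0, flow_zero hk]
  have hsmall : ∀ᶠ x in 𝓝 (0 : BoxSpace), |(Λ x).1| * k < 1 := by
    refine ((continuous_fst.comp hΛ.continuous).abs.mul
      continuous_const).continuousAt.eventually_lt continuousAt_const ?_
    simp [hΛ0]
  have hsm : ∀ᶠ x in 𝓝 0, ContDiffAt ℝ ∞ Ψ x :=
    hsmall.mono fun x hx => (contDiffAt_flow hw hk hx).comp x hΛ.contDiffAt
  refine ⟨Ψ, hΨ0, hsm, ⟨A, ?_⟩, ?_⟩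
  · have hd : HasFDerivAt (flow w) (fderiv ℝ (flow w) (0, b)) (Λ 0) := by
      rw [hΛ0]
      exact ((contDiffAt_flow hw hk (by simp)).differentiableAt (by simp)).hasFDerivAt
    have hdΨ : HasFDerivAt Ψ (fderiv ℝ (flow w) (0, b) ∘L L) 0 :=
      hd.comp 0 (L.hasFDerivAt.const_add _)
    rw [hΛ0] at hd
    -- The derivative of the flow at (0, b) is v b in time and, by `h2`, the identity in space;
    -- together these make A the derivative of Ψ at 0.
    have h1 : fderiv ℝ (flow w) (0, b) (1, 0) = v b := by
      have h := hasDerivAt_flow hk (ε := 0) b (by simp)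
      rw [flow_zero hk, hwv b hbV] at h
      have h' := hd.comp_hasDerivAt (0 : ℝ) ((hasDerivAt_id (0 : ℝ)).prodMk (hasDerivAt_const 0 b))
      exact h'.unique h
    have h2 : ∀ y, fderiv ℝ (flow w) (0, b) (0, y) = y := by
      intro y
      have h : HasFDerivAt (fun y => flow w ((0 : ℝ), y)) _ b :=
        HasFDerivAt.comp (f := fun y => ((0 : ℝ), y)) b hd (hasFDerivAt_prodMk_right (0 : ℝ) b)
      simp only [flow_zero hk] at h
      have := h.unique (hasFDerivAt_id b)
      simpa using congrArg (fun l => l y) this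
    convert! hdΨ using 1
    refine ContinuousLinearMap.ext fun x => ?_
    have hx : x = (x.1, 0) + x.2 0 • ((0 : EuclideanSpace ℝ (Fin 2)), leafVec) := by
      ext1
      · simp
      · simp [smul_leafVec]
    have hL : L x = x.2 0 • ((1 : ℝ), (0 : E)) + (0, A (x.1, 0)) := by
      simp [L]
    rw [ContinuousLinearMap.comp_apply, hL, map_add, map_smul, h1, h2]
    change A x = _
    conv_lhs => rw [hx]
    rw [map_add, map_smul, hA, add_comm]
  · have hΨV : ∀ᶠ x in 𝓝 0, Ψ x ∈ V :=
      hsm.self_of_nhds.continuousAt.eventually (by rw [hΨ0]; exact hV.mem_nhds hbV)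
    filter_upwards [hsmall, hΨV] with x hx hxV
    refine ⟨interior_maximal hVU hV hxV, ?_⟩
    have h := hasDerivAt_flow hk (Λ x).2 hx
    rw [hwv _ hxV] at h
    have h0 : HasDerivAt (fun τ : ℝ => (Λ x).1 + τ) 1 0 := (hasDerivAt_id 0).const_add _
    have h' := HasDerivAt.scomp (g₁ := fun s => flow w (s, (Λ x).2)) (x := (0 : ℝ))
      (h := fun τ : ℝ => (Λ x).1 + τ) (by simpa using h) h0
    rw [one_smul] at h'
    convert! h' using 1
    ext τ
    simp [Ψ, Λ, L, leafVec]

/-- The flow box theorem. -/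
theorem exists_flowBox (hE : Module.finrank ℝ E = 3) (hU : U ∈ 𝓝 b)
    (hv : ContDiffOn ℝ ∞ v U) (hb : v b ≠ 0) :
    ∃ φ : OpenPartialHomeomorph E BoxSpace, b ∈ φ.source ∧ φ.source ⊆ U ∧ φ.target = Set.univ ∧
      ContDiffOn ℝ ∞ φ φ.source ∧ ContDiff ℝ ∞ φ.symm ∧
      ∀ x ∈ φ.source, (fderiv ℝ φ x (v x)).1 = 0 := by
  obtain ⟨Ψ, hΨ0, hsm, ⟨A, hA⟩, hflow⟩ := exists_flow_parametrization hE hU hv hb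
  let Q := hsm.self_of_nhds.toOpenPartialHomeomorph Ψ hA (by simp)
  have hQ : (Q : BoxSpace → E) = Ψ := hsm.self_of_nhds.toOpenPartialHomeomorph_coe hA (by simp)
  have hQ0 : (0 : BoxSpace) ∈ Q.source :=
    hsm.self_of_nhds.mem_toOpenPartialHomeomorph_source hA (by simp)
  have hinv : ∀ᶠ x in 𝓝 0, fderiv ℝ Ψ x ∈ Set.range ContinuousLinearEquiv.toContinuousLinearMap := by
    have hc : ContinuousAt (fderiv ℝ Ψ) 0 :=
      (hsm.self_of_nhds.fderiv_right (m := 0) (by simp)).continuousAt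
    refine hc.eventually ?_
    rw [hA.fderiv]
    exact A.nhds
  obtain ⟨r, hr, hball⟩ := Metric.eventually_nhds_iff_ball.1
    (((hsm.and hinv).and hflow).and (Q.open_source.mem_nhds hQ0))
  -- Stretching the two factors separately makes the target the whole parameter space while
  -- preserving the leaves. In the sup norm of a product, the ball is the product of the balls.
  let β₂ := OpenPartialHomeomorph.univBall (0 : EuclideanSpace ℝ (Fin 2)) r
  let β₁ := OpenPartialHomeomorph.univBall (0 : EuclideanSpace ℝ (Fin 1)) r
  let β : OpenPartialHomeomorph BoxSpace BoxSpace := β₂.prod β₁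
  have hβs : β.source = Set.univ := by simp [β, β₁, β₂]
  have hβt : β.target = Metric.ball 0 r := by
    simp only [β, OpenPartialHomeomorph.prod_target, β₁, β₂,
      OpenPartialHomeomorph.univBall_target _ hr, ball_prod_same]
    rfl
  have hβ : ContDiff ℝ ∞ β :=
    (OpenPartialHomeomorph.contDiff_univBall.comp contDiff_fst).prodMk
      (OpenPartialHomeomorph.contDiff_univBall.comp contDiff_snd)
  have hβ' : ContDiffOn ℝ ∞ β.symm (Metric.ball 0 r) := by
    have h2 : ContDiffOn ℝ ∞ β₂.symm (Metric.ball 0 r) :=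
      OpenPartialHomeomorph.contDiffOn_univBall_symm
    have h1 : ContDiffOn ℝ ∞ β₁.symm (Metric.ball 0 r) :=
      OpenPartialHomeomorph.contDiffOn_univBall_symm
    have hm : ∀ x ∈ Metric.ball (0 : BoxSpace) r, x.1 ∈ Metric.ball 0 r ∧ x.2 ∈ Metric.ball 0 r := by
      intro x hx
      have : x ∈ Metric.ball (0 : EuclideanSpace ℝ (Fin 2)) r ×ˢ
        Metric.ball (0 : EuclideanSpace ℝ (Fin 1)) r := by rw [ball_prod_same]; exact hx
      exact this
    exact (h2.comp contDiffOn_fst fun x hx => (hm x hx).1).prodMk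
      (h1.comp contDiffOn_snd fun x hx => (hm x hx).2)
  have hβball : ∀ y, β y ∈ Metric.ball 0 r := fun y => hβt ▸ β.map_source (by simp [hβs])
  let φ : OpenPartialHomeomorph E BoxSpace := (β.trans Q).symm
  have hφ' : ∀ y, φ.symm y = Ψ (β y) := fun y => by simp [φ, hQ]
  have hφt : φ.target = Set.univ := by
    ext y
    simp only [φ, OpenPartialHomeomorph.symm_target, OpenPartialHomeomorph.trans_source, hβs]
    simpa using show β y ∈ Q.source from (hball _ (hβball y)).2
  have hφ : ∀ x, φ x = β.symm (Q.symm x) := fun x => rfl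
  have hφs : ∀ x ∈ φ.source, ∃ y ∈ Metric.ball (0 : BoxSpace) r, Q.symm x = y ∧ Ψ y = x ∧
      x ∈ Q.target := by
    intro x hx
    simp only [φ, OpenPartialHomeomorph.symm_source, OpenPartialHomeomorph.trans_target, hβt] at hx
    exact ⟨_, hx.2, rfl, by rw [← hQ]; exact Q.right_inv hx.1, hx.1⟩
  have hφsm : ∀ x ∈ φ.source, ContDiffAt ℝ ∞ φ x := by
    intro x hx
    obtain ⟨y, hy, hxy, hyx, hxt⟩ := hφs x hx
    obtain ⟨⟨⟨h1, B, hB⟩, -⟩, -⟩ := hball y hy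
    have h2 : ContDiffAt ℝ ∞ Q.symm x := by
      refine Q.contDiffAt_symm (f₀' := B) hxt ?_ ?_
      · rw [hxy, hQ, hB]
        exact (h1.differentiableAt (by simp)).hasFDerivAt
      · rwa [hxy, hQ]
    have h3 : ContDiffAt ℝ ∞ β.symm (Q.symm x) :=
      hβ'.contDiffAt (hxy ▸ Metric.isOpen_ball.mem_nhds hy)
    exact h3.comp x h2
  refine ⟨φ, ?_, ?_, hφt, fun x hx => (hφsm x hx).contDiffWithinAt, ?_, ?_⟩
  · have hb0 : Q.symm b = 0 := by
      rw [← hΨ0, ← hQ]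
      exact Q.left_inv hQ0
    simp only [φ, OpenPartialHomeomorph.symm_source, OpenPartialHomeomorph.trans_target, hβt]
    refine ⟨?_, ?_⟩
    · rw [← hΨ0, ← hQ]
      exact Q.map_source hQ0
    · simpa [hb0] using hr
  · intro x hx
    obtain ⟨y, hy, -, hyx, -⟩ := hφs x hx
    rw [← hyx]
    exact interior_subset (hball y hy).1.2.1
  · have : (φ.symm : BoxSpace → E) = Ψ ∘ β := funext hφ'
    rw [this, contDiff_iff_contDiffAt]
    exact fun y => (hball _ (hβball y)).1.1.1.comp y hβ.contDiffAt
  · intro x hx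
    obtain ⟨y, hy, hxy, hyx, hxt⟩ := hφs x hx
    have hd := (hball y hy).1.2.2
    rw [hyx] at hd
    -- Along the integral curve through x, φ ∘ Ψ is the inverse of β, whose first component depends
    -- on y.1 alone and so is constant.
    have hc : HasDerivAt (fun τ : ℝ => φ (Ψ (y.1, y.2 + τ • leafVec))) (fderiv ℝ φ x (v x)) 0 := by
      refine HasFDerivAt.comp_hasDerivAt (0 : ℝ) ?_ hd
      simpa [hyx] using ((hφsm x hx).differentiableAt (by simp)).hasFDerivAt
    have hc1 : HasDerivAt (fun τ : ℝ => (φ (Ψ (y.1, y.2 + τ • leafVec))).1)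
        (fderiv ℝ φ x (v x)).1 0 :=
      (ContinuousLinearMap.fst ℝ (EuclideanSpace ℝ (Fin 2))
        (EuclideanSpace ℝ (Fin 1))).hasFDerivAt.comp_hasDerivAt (0 : ℝ) hc
    refine hc1.unique ((hasDerivAt_const (0 : ℝ) (β₂.symm y.1)).congr_of_eventuallyEq ?_)
    have hcont : Continuous fun τ : ℝ => ((y.1, y.2 + τ • leafVec) : BoxSpace) := by fun_prop
    have hmem : ∀ᶠ τ : ℝ in 𝓝 0, ((y.1, y.2 + τ • leafVec) : BoxSpace) ∈ Metric.ball 0 r :=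
      hcont.continuousAt.eventually (Metric.isOpen_ball.mem_nhds (by simpa using hy))
    filter_upwards [hmem] with τ hτ
    rw [hφ, ← hQ, Q.left_inv (hball _ hτ).2]
    rfl

end FlowBox

/-! ### Constant rotations of a hyperCR frame. -/

section Rotation

/-- A unit vector is the first one of a positively oriented orthonormal basis. -/
lemma exists_rotation {c : Fin 3 → ℝ} (hc : ∑ i, c i ^ 2 = 1) :
    ∃ R : Fin 3 → Fin 3 → ℝ, R 0 = c ∧ (∀ i j, ∑ k, R i k * R j k = if i = j then 1 else 0) ∧
      ∀ i, R i = cross (R (i + 1)) (R (i + 2)) := by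
  -- A unit vector orthogonal to c: the normalized (-c₁, c₀, 0), or the first axis when c lies on
  -- the third. The basis is then c, u, c×u.
  obtain ⟨u, hu, hcu⟩ : ∃ u : Fin 3 → ℝ, u 0 ^ 2 + u 1 ^ 2 + u 2 ^ 2 = 1 ∧
      c 0 * u 0 + c 1 * u 1 + c 2 * u 2 = 0 := by
    by_cases h : c 0 ^ 2 + c 1 ^ 2 = 0
    · have h0 : c 0 = 0 := by nlinarith [sq_nonneg (c 0), sq_nonneg (c 1)]
      exact ⟨![1, 0, 0], by simp, by simp [h0]⟩
    · have hpos : 0 < c 0 ^ 2 + c 1 ^ 2 := lt_of_le_of_ne (by positivity) (Ne.symm h)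
      have hs := Real.sq_sqrt hpos.le
      have hs0 : Real.sqrt (c 0 ^ 2 + c 1 ^ 2) ≠ 0 := (Real.sqrt_pos.2 hpos).ne'
      refine ⟨![-c 1 / Real.sqrt (c 0 ^ 2 + c 1 ^ 2), c 0 / Real.sqrt (c 0 ^ 2 + c 1 ^ 2), 0],
        ?_, ?_⟩
      · simp only [Matrix.cons_val, div_pow, hs]
        field_simp
        ring
      · simp only [Matrix.cons_val]
        ring
  rw [Fin.sum_univ_three] at hc
  let R : Fin 3 → Fin 3 → ℝ := ![c, u, cross c u]
  have hR0 : R 0 = c := rfl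
  have hR1 : R 1 = u := rfl
  have hR2 : R 2 = cross c u := rfl
  have e0 : cross c u 0 = c 1 * u 2 - c 2 * u 1 := rfl
  have e1 : cross c u 1 = c 2 * u 0 - c 0 * u 2 := rfl
  have e2 : cross c u 2 = c 0 * u 1 - c 1 * u 0 := rfl
  refine ⟨R, rfl, fun i j => ?_, fun i => funext fun k => ?_⟩
  · fin_cases i <;> fin_cases j <;>
      simp only [Fin.zero_eta, Fin.mk_one, Fin.reduceFinMk, Fin.sum_univ_three, hR0, hR1, hR2, e0,
        e1, e2, if_true, Fin.reduceEq, if_false, zero_ne_one, one_ne_zero]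
    · linear_combination hc
    · linear_combination hcu
    · ring
    · linear_combination hcu
    · linear_combination hu
    · ring
    · ring
    · ring
    · linear_combination (u 0 ^ 2 + u 1 ^ 2 + u 2 ^ 2) * hc + hu
        - (c 0 * u 0 + c 1 * u 1 + c 2 * u 2) * hcu
  · have f0 : ∀ a b, cross a b 0 = a 1 * b 2 - a 2 * b 1 := fun a b => rfl
    have f1 : ∀ a b, cross a b 1 = a 2 * b 0 - a 0 * b 2 := fun a b => rfl
    have f2 : ∀ a b, cross a b 2 = a 0 * b 1 - a 1 * b 0 := fun a b => rfl
    fin_cases i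
    · change c k = cross u (cross c u) k
      fin_cases k <;> simp only [Fin.zero_eta, Fin.mk_one, Fin.reduceFinMk, f0, f1, f2]
      · linear_combination u 0 * hcu - c 0 * hu
      · linear_combination u 1 * hcu - c 1 * hu
      · linear_combination u 2 * hcu - c 2 * hu
    · change u k = cross (cross c u) c k
      fin_cases k <;> simp only [Fin.zero_eta, Fin.mk_one, Fin.reduceFinMk, f0, f1, f2]
      · linear_combination c 0 * hcu - u 0 * hc
      · linear_combination c 1 * hcu - u 1 * hc
      · linear_combination c 2 * hcu - u 2 * hc
    · rfl

variable {E : Type*} [NormedAddCommGroup E] [NormedSpace ℝ E] [FiniteDimensional ℝ E]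
  {H : Type*} [TopologicalSpace H] {I : ModelWithCorners ℝ E H}
  {M : Type*} [TopologicalSpace M] [ChartedSpace H M] [IsManifold I ∞ M] {p : M}
  {U : Set M} {F : Fin 3 → Π q : M, TangentSpace I q} {κ : M → ℝ} {W : WeylStructure I U}
  {D : (Π q : M, TangentSpace I q) → (Π q : M, TangentSpace I q →L[ℝ] TangentSpace I q)}

/-- A constant rotation of a hyperCR frame is a hyperCR frame. -/
lemma WeylStructure.IsHyperCRFrame.rotate (h : W.IsHyperCRFrame D F κ)
    (hD : IsCovariantDerivativeOn E D U) {R : Fin 3 → Fin 3 → ℝ}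
    (hR : ∀ i j, ∑ k, R i k * R j k = if i = j then 1 else 0)
    (hR' : ∀ i, R i = cross (R (i + 1)) (R (i + 2))) :
    W.IsHyperCRFrame D (fun i q => ∑ k, R i k • F k q) κ where
  smooth p hp i := SmoothVF.sum fun k _ => (h.smooth p hp k).const_smul _
  smooth_κ := h.smooth_κ
  orthonormal p hp i j := by
    rw [← hR i j]
    simp [h.orthonormal p hp, Fin.sum_univ_three]
  eqn p hp i v := by
    have hs : ∀ k, SmoothVF I (F k) p := h.smooth p hp
    have hDs : D (fun q => ∑ k, R i k • F k q) p v = ∑ k, R i k • D (F k) p v := by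
      have hsum : (fun q => ∑ k, R i k • F k q) = (R i 0 • F 0 + R i 1 • F 1) + R i 2 • F 2 := by
        ext q
        simp [Fin.sum_univ_three]
      have h0 : SmoothVF I (R i 0 • F 0) p := (hs 0).const_smul _
      have h1 : SmoothVF I (R i 1 • F 1) p := (hs 1).const_smul _
      have h2 : SmoothVF I (R i 2 • F 2) p := (hs 2).const_smul _
      have h01 : SmoothVF I (R i 0 • F 0 + R i 1 • F 1) p := h0.add h1
      rw [hsum, hD.add h01.mdiff h2.mdiff hp, hD.add h0.mdiff h1.mdiff hp, hD.smul_const _ (hs 0).mdiff hp,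
        hD.smul_const _ (hs 1).mdiff hp, hD.smul_const _ (hs 2).mdiff hp, Fin.sum_univ_three]
      rfl
    -- That each row is the cross product of the other two expresses that the rotation preserves
    -- cross products; these coordinates match the coefficients of the three frame fields.
    have h0 := congrFun (hR' i) 0
    have h1 := congrFun (hR' i) 1
    have h2 := congrFun (hR' i) 2
    have f0 : ∀ a b, cross a b 0 = a 1 * b 2 - a 2 * b 1 := fun a b => rfl
    have f1 : ∀ a b, cross a b 1 = a 2 * b 0 - a 0 * b 2 := fun a b => rfl
    have f2 : ∀ a b, cross a b 2 = a 0 * b 1 - a 1 * b 0 := fun a b => rfl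
    rw [f0] at h0
    rw [f1] at h1
    rw [f2] at h2
    have e0 := h.eqn p hp 0 v
    have e1 := h.eqn p hp 1 v
    have e2 := h.eqn p hp 2 v
    simp only [zero_add, show (1 + 1 : Fin 3) = 2 from rfl, show (1 + 2 : Fin 3) = 0 from rfl,
      show (2 + 1 : Fin 3) = 0 from rfl, show (2 + 2 : Fin 3) = 1 from rfl] at e0 e1 e2
    rw [hDs, Fin.sum_univ_three, e0, e1, e2]
    simp only [Fin.sum_univ_three, map_add, map_smul, add_apply, smul_apply, smul_eq_mul]
    generalize W.g p (F 0 p) v = g0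
    generalize W.g p (F 1 p) v = g1
    generalize W.g p (F 2 p) v = g2
    match_scalars
    · linear_combination κ p * (g2 * h1 - g1 * h2)
    · linear_combination κ p * (g1 * h0 - g0 * h1)
    · linear_combination κ p * (g0 * h2 - g2 * h0)

/-- A hyperCR congruence belongs to a frame satisfying the structure equations. -/
lemma WeylStructure.IsHyperCRCongruence.exists_structureEq {W : WeylStructure I (Set.univ : Set M)}
    (hE : Module.finrank ℝ E = 3) (hD : W.IsWeylConnection D) {X : Π q : M, TangentSpace I q}
    (hX : W.IsHyperCRCongruence D X) : ∃ F e κ, W.StructureEq F e κ ∧ F 0 = X := by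
  obtain ⟨F, κ, c, hF, hc, hXF⟩ := hX
  obtain ⟨R, hR0, hR, hR'⟩ := exists_rotation hc
  refine ⟨_, _, κ, (hF.rotate hD.isCovariantDerivative hR hR').structureEq hE isOpen_univ hD, ?_⟩
  ext q
  rw [hXF q trivial, hR0]

end Rotation

/-! ### Pullback by a local diffeomorphism. -/

section Transport

variable {E : Type*} [NormedAddCommGroup E] [NormedSpace ℝ E] [FiniteDimensional ℝ E]
  {H : Type*} [TopologicalSpace H] {I : ModelWithCorners ℝ E H} [I.Boundaryless]
  {M : Type*} [TopologicalSpace M] [ChartedSpace H M] [IsManifold I ∞ M]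
  {E' : Type*} [NormedAddCommGroup E'] [NormedSpace ℝ E'] [FiniteDimensional ℝ E']
  {H' : Type*} [TopologicalSpace H'] {I' : ModelWithCorners ℝ E' H'}
  {M' : Type*} [TopologicalSpace M'] [ChartedSpace H' M'] [IsManifold I' ∞ M']
  {U : Set M} {F : Fin 3 → Π q : M, TangentSpace I q}
  {e : Fin 3 → Π q : M, TangentSpace I q →L[ℝ] ℝ} {κ : M → ℝ} {W : WeylStructure I U}

/-- Pullback of a Weyl structure satisfying the structure equations, by a local diffeomorphism. -/
lemma WeylStructure.StructureEq.pullback (h : W.StructureEq F e κ) (hE : Module.finrank ℝ E' = 3)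
    {V : Set M'} (hV : IsOpen V) {f : M' → M} (hf : ∀ y ∈ V, ContMDiffAt I' I ∞ f y)
    (hfV : ∀ y ∈ V, f y ∈ U) (hinv : ∀ y ∈ V, (mfderiv I' I f y).IsInvertible) :
    ∃ F' e', ∃ W' : WeylStructure I' V, W'.StructureEq F' e' (fun y => κ (f y)) ∧
      (∀ y ∈ V, ∀ i, mfderiv I' I f y (F' i y) = F i (f y)) ∧
      (∀ y ∈ V, ∀ v w, W'.g y v w = W.g (f y) (mfderiv I' I f y v) (mfderiv I' I f y w)) ∧
      ∀ y ∈ V, ∀ v, W'.weylForm y v = W.weylForm (f y) (mfderiv I' I f y v) := by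
  let F' : Fin 3 → Π y : M', TangentSpace I' y := fun i => mpullback I' I f (F i)
  have hrel : ∀ y ∈ V, ∀ i, mfderiv I' I f y (F' i y) = F i (f y) := fun y hy i =>
    (hinv y hy).self_apply_inverse _
  have hF' : ∀ y ∈ V, ∀ i, SmoothVF I' (F' i) y := fun y hy i =>
    ContMDiffAt.mpullback_vectorField_preimage (n := ∞) (h.smooth _ (hfV y hy) i) (hf y hy)
      (hinv y hy) (by simp)
  have hli : ∀ y ∈ V, LinearIndependent ℝ fun i => F' i y := by
    intro y hy
    rw [Fintype.linearIndependent_iff]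
    intro c hc i
    have h1 := congrArg (fun w => e i (f y) (mfderiv I' I f y w)) hc
    simpa [map_sum, map_smul, hrel y hy, h.dual _ (hfV y hy)] using h1
  obtain ⟨e', he'⟩ := exists_coframe hE hV hF' hli
  have hcomp : ∀ y ∈ V, ∀ v i, e' i y v = e i (f y) (mfderiv I' I f y v) := by
    intro y hy v i
    conv_rhs => rw [he'.expand y hy v]
    simp [map_sum, map_smul, hrel y hy, h.dual _ (hfV y hy)]
  have hω : ∀ y ∈ V, ∀ i, SmoothFn I' (fun y => W.weylForm (f y) (F i (f y))) y := fun y hy i =>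
    ContMDiffAt.comp y (W.smooth_weylForm _ (hfV y hy) _ (h.smooth _ (hfV y hy) i)) (hf y hy)
  obtain ⟨W', hW', hα⟩ := he'.exists_weylStructure
    (α := fun y => ∑ i, W.weylForm (f y) (F i (f y)) • e' i y)
    fun y hy => SmoothForm.sum_smul (hω y hy) (he'.smooth_form y hy)
  have hα' : ∀ y ∈ V, ∀ v, W'.weylForm y v = W.weylForm (f y) (mfderiv I' I f y v) := by
    intro y hy v
    rw [h.weylForm_eq (hfV y hy), hα]
    simp [hcomp y hy]
  refine ⟨F', e', W', ⟨hW', ?_, ?_⟩, hrel, ?_, hα'⟩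
  · exact fun y hy => ContMDiffAt.comp y (h.smooth_κ _ (hfV y hy)) (hf y hy)
  · intro y hy i
    -- The bracket relation is checked after applying the injective differential of f, under which
    -- the frames are related.
    apply (hinv y hy).injective
    have hev : ∀ j, ∀ᶠ q in 𝓝 y, mfderiv I' I f q (F' j q) = F j (f q) := fun j => by
      filter_upwards [hV.mem_nhds hy] with q hq using hrel q hq j
    rw [mfderiv_bracket_of_related (hf y hy) (hF' y hy _) (hF' y hy _)
      (h.smooth _ (hfV y hy) _) (h.smooth _ (hfV y hy) _) (hev _) (hev _),
      h.bracket_frame _ (hfV y hy)]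
    simp only [map_sub, map_smul, hrel y hy, hα' y hy]
  · intro y hy v w
    rw [hW'.metric y hy, h.metric _ (hfV y hy)]
    simp only [hcomp y hy]

end Transport

/-! ### Almost complex structures on the plane in coordinates. -/

section Plane

/-- The coordinates of a tangent vector of the plane. -/
def coordL (a : Fin 2) (y : EuclideanSpace ℝ (Fin 2)) : TangentSpace (𝓡 2) y →L[ℝ] ℝ :=
  (EuclideanSpace.proj a : EuclideanSpace ℝ (Fin 2) →L[ℝ] ℝ)

variable {y : EuclideanSpace ℝ (Fin 2)}

lemma coordL_ext {v w : TangentSpace (𝓡 2) y} (h0 : coordL 0 y v = coordL 0 y w)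
    (h1 : coordL 1 y v = coordL 1 y w) : v = w := by
  have : ∀ a, coordL a y v = coordL a y w := fun a => by fin_cases a; exacts [h0, h1]
  exact PiLp.ext this

/-- The tangent vector of the plane with given coordinates. -/
def planeVec (y : EuclideanSpace ℝ (Fin 2)) (s t : ℝ) : TangentSpace (𝓡 2) y :=
  (!₂[s, t] : EuclideanSpace ℝ (Fin 2))

lemma coordL_planeVec_zero (s t : ℝ) : coordL 0 y (planeVec y s t) = s := rfl

lemma coordL_planeVec_one (s t : ℝ) : coordL 1 y (planeVec y s t) = t := rfl

lemma smoothVF_plane_iff {X : Π z : EuclideanSpace ℝ (Fin 2), TangentSpace (𝓡 2) z} :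
    SmoothVF (𝓡 2) X y ↔ ∀ a, SmoothFn (𝓡 2) (fun z => coordL a z (X z)) y := by
  refine (contMDiffAt_vectorSpace_iff_contDiffAt (V := X)).trans ?_
  refine (contDiffAt_euclidean (f := fun z => (X z : EuclideanSpace ℝ (Fin 2)))).trans ?_
  exact forall_congr' fun a => contMDiffAt_iff_contDiffAt.symm

/-- The endomorphism of the plane with matrix `(α, -β; γ, -α)`. -/
def planeEnd (α β γ : ℝ) (y : EuclideanSpace ℝ (Fin 2)) :
    TangentSpace (𝓡 2) y →L[ℝ] TangentSpace (𝓡 2) y :=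
  (α • coordL 0 y - β • coordL 1 y).smulRight (planeVec y 1 0)
    + (γ • coordL 0 y - α • coordL 1 y).smulRight (planeVec y 0 1)

lemma coordL_planeEnd_zero (α β γ : ℝ) (v : TangentSpace (𝓡 2) y) :
    coordL 0 y (planeEnd α β γ y v) = α * coordL 0 y v - β * coordL 1 y v := by
  simp [planeEnd, coordL_planeVec_zero]

lemma coordL_planeEnd_one (α β γ : ℝ) (v : TangentSpace (𝓡 2) y) :
    coordL 1 y (planeEnd α β γ y v) = γ * coordL 0 y v - α * coordL 1 y v := by
  simp [planeEnd, coordL_planeVec_one]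

/-- A trace-free 2×2 matrix squares to a scalar, here α² - βγ = -1. -/
lemma isComplexStructure_planeEnd {α β γ : EuclideanSpace ℝ (Fin 2) → ℝ}
    (hα : ∀ y, SmoothFn (𝓡 2) α y) (hβ : ∀ y, SmoothFn (𝓡 2) β y) (hγ : ∀ y, SmoothFn (𝓡 2) γ y)
    (h : ∀ y, β y * γ y = α y ^ 2 + 1) :
    IsComplexStructure (𝓡 2) fun y => planeEnd (α y) (β y) (γ y) y where
  sq y v := by
    refine coordL_ext ?_ ?_
    · rw [coordL_planeEnd_zero, coordL_planeEnd_zero, coordL_planeEnd_one, map_neg]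
      linear_combination -coordL 0 y v * h y
    · rw [coordL_planeEnd_one, coordL_planeEnd_zero, coordL_planeEnd_one, map_neg]
      linear_combination -coordL 1 y v * h y
  smooth y X hX := by
    rw [smoothVF_plane_iff] at hX ⊢
    intro a
    fin_cases a
    · refine SmoothFn.congr (((hα y).mul (hX 0)).sub ((hβ y).mul (hX 1))) ?_
      exact Filter.Eventually.of_forall fun z => coordL_planeEnd_zero _ _ _ _
    · refine SmoothFn.congr (((hγ y).mul (hX 0)).sub ((hα y).mul (hX 1))) ?_
      exact Filter.Eventually.of_forall fun z => coordL_planeEnd_one _ _ _ _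

end Plane

/-! ### The complex structure of the leaf space and the Higgs pair of a frame. -/

section LeafSpace

variable {E₃ : Type*} [NormedAddCommGroup E₃] [NormedSpace ℝ E₃] [FiniteDimensional ℝ E₃]
  {H₃ : Type*} [TopologicalSpace H₃] {I₃ : ModelWithCorners ℝ E₃ H₃}
  {P : Type*} [TopologicalSpace P] [ChartedSpace H₃ P] [IsManifold I₃ ∞ P]
  {π : P → EuclideanSpace ℝ (Fin 2)} {U : Set P} {W : WeylStructure I₃ U}
  {F : Fin 3 → Π q : P, TangentSpace I₃ q} {e : Fin 3 → Π q : P, TangentSpace I₃ q →L[ℝ] ℝ}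
  {κ : P → ℝ} {p : P}

/-- Numerator and denominator grow at the same rate c along X. The product rule is applied to (n/d)
· d = n, which avoids differentiating the inverse. -/
lemma dir_div_eq_zero {X : Π q : P, TangentSpace I₃ q} {n d : P → ℝ} {c : ℝ}
    (hn : SmoothFn I₃ n p) (hd : SmoothFn I₃ d p) (h0 : d p ≠ 0)
    (h1 : dir I₃ X n p = c * n p) (h2 : dir I₃ X d p = c * d p) :
    dir I₃ X (fun q => n q * (d q)⁻¹) p = 0 := by
  have hs := hn.mul (hd.inv h0)
  have h3 := dir_mul (X := X) hs hd
  rw [dir_congr (g := n), h1, h2] at h3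
  · have : d p * dir I₃ X (fun q => n q * (d q)⁻¹) p = 0 := by
      have h4 : n p * (d p)⁻¹ * d p = n p := inv_mul_cancel_right₀ h0 _
      linear_combination -h3 - c * h4
    exact (mul_eq_zero.1 this).resolve_left h0
  · filter_upwards [ContMDiffAt.continuousAt hd |>.eventually_ne h0] with q hq
      using inv_mul_cancel_right₀ hq _

variable (I₃ π F) in
/-- The coordinates of the projection of `F k` to the plane. -/
def leafCoeff (k : Fin 3) (a : Fin 2) : P → ℝ := dir I₃ (F k) fun q => π q a

variable (I₃ π F) in
/-- The determinant of the projections of `F 1` and `F 2` to the plane. -/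
def leafDet (q : P) : ℝ :=
  leafCoeff I₃ π F 1 0 q * leafCoeff I₃ π F 2 1 q - leafCoeff I₃ π F 1 1 q * leafCoeff I₃ π F 2 0 q

variable (I₃ π F) in
/-- A matrix entry of the complex structure for which `F 1 + i F 2` projects to type `(0,1)`. -/
def leafJ (a b : Fin 2) (q : P) : ℝ :=
  (leafCoeff I₃ π F 1 a q * leafCoeff I₃ π F 1 b q + leafCoeff I₃ π F 2 a q * leafCoeff I₃ π F 2 b q)
    * (leafDet I₃ π F q)⁻¹

variable (I₃ π F) in
/-- The coefficients of a tangent vector of the plane in terms of the projections of `F 1` and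
`F 2`. -/
def leafForm (k : Fin 3) (q : P) : TangentSpace (𝓡 2) (π q) →L[ℝ] ℝ :=
  -- Cramer's rule; only k = 1 and k = 2 are used, and the latter is the `else` branch.
  (leafDet I₃ π F q)⁻¹ • if k = 1
    then leafCoeff I₃ π F 2 1 q • coordL 0 (π q) - leafCoeff I₃ π F 2 0 q • coordL 1 (π q)
    else leafCoeff I₃ π F 1 0 q • coordL 1 (π q) - leafCoeff I₃ π F 1 1 q • coordL 0 (π q)

lemma leafForm_one (v : TangentSpace (𝓡 2) (π p)) : leafForm I₃ π F 1 p v = (leafDet I₃ π F p)⁻¹ *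
    (leafCoeff I₃ π F 2 1 p * coordL 0 (π p) v - leafCoeff I₃ π F 2 0 p * coordL 1 (π p) v) := by
  simp [leafForm]

lemma leafForm_two (v : TangentSpace (𝓡 2) (π p)) : leafForm I₃ π F 2 p v = (leafDet I₃ π F p)⁻¹ *
    (leafCoeff I₃ π F 1 0 p * coordL 1 (π p) v - leafCoeff I₃ π F 1 1 p * coordL 0 (π p) v) := by
  simp [leafForm]

lemma mvfderiv_coord (hπ : ContMDiffAt I₃ (𝓡 2) ∞ π p) (a : Fin 2) (v : TangentSpace I₃ p) :
    mvfderiv I₃ (fun q => π q a) p v = coordL a (π p) (mfderiv I₃ (𝓡 2) π p v) := by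
  have := mvfderiv_comp_apply (I := 𝓡 2) (I' := I₃) p (f := π)
    (g := fun z : EuclideanSpace ℝ (Fin 2) => EuclideanSpace.proj (𝕜 := ℝ) a z)
    ((EuclideanSpace.proj a : EuclideanSpace ℝ (Fin 2) →L[ℝ] ℝ).contMDiff.contMDiffAt.mdifferentiableAt
      (n := 1) (by simp)) (hπ.mdifferentiableAt (by simp)) v
  refine this.trans ?_
  simp only [mvfderiv, mfderiv_eq_fderiv]
  rw [ContinuousLinearMap.fderiv]
  rfl

lemma smoothFn_coord (hπ : ContMDiffAt I₃ (𝓡 2) ∞ π p) (a : Fin 2) :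
    SmoothFn I₃ (fun q => π q a) p :=
  (EuclideanSpace.proj a : EuclideanSpace ℝ (Fin 2) →L[ℝ] ℝ).contMDiff.contMDiffAt.comp p hπ

/-- `π` is a submersion on `U` whose fibres are tangent to `F 0`, where `F` is a frame satisfying the
structure equations. -/
structure LeafSpace (π : P → EuclideanSpace ℝ (Fin 2)) (W : WeylStructure I₃ U)
    (F : Fin 3 → Π q : P, TangentSpace I₃ q) (e : Fin 3 → Π q : P, TangentSpace I₃ q →L[ℝ] ℝ)
    (κ : P → ℝ) : Prop extends W.StructureEq F e κ where
  smooth_proj : ∀ p ∈ U, ContMDiffAt I₃ (𝓡 2) ∞ π p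
  vertical : ∀ p ∈ U, mfderiv I₃ (𝓡 2) π p (F 0 p) = 0
  surjective : ∀ p ∈ U, Function.Surjective (mfderiv I₃ (𝓡 2) π p)

namespace LeafSpace

variable (h : LeafSpace π W F e κ)
include h

lemma coordL_mfderiv (hp : p ∈ U) (a : Fin 2) (v : TangentSpace I₃ p) :
    coordL a (π p) (mfderiv I₃ (𝓡 2) π p v)
      = e 1 p v * leafCoeff I₃ π F 1 a p + e 2 p v * leafCoeff I₃ π F 2 a p := by
  conv_lhs => rw [h.expand p hp v]
  rw [Fin.sum_univ_three]
  simp only [map_add, map_smul, h.vertical p hp, smul_zero, zero_add, smul_eq_mul,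
    leafCoeff, dir, mvfderiv_coord (h.smooth_proj p hp)]

lemma smooth_leafCoeff (hp : p ∈ U) (k : Fin 3) (a : Fin 2) : SmoothFn I₃ (leafCoeff I₃ π F k a) p :=
  (smoothFn_coord (h.smooth_proj p hp) a).dir (h.smooth p hp k)

lemma smooth_leafDet (hp : p ∈ U) : SmoothFn I₃ (leafDet I₃ π F) p :=
  ((h.smooth_leafCoeff hp 1 0).mul (h.smooth_leafCoeff hp 2 1)).sub
    ((h.smooth_leafCoeff hp 1 1).mul (h.smooth_leafCoeff hp 2 0))

lemma leafDet_ne_zero (hp : p ∈ U) : leafDet I₃ π F p ≠ 0 := by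
  intro h0
  obtain ⟨v, hv⟩ := h.surjective p hp (planeVec (π p) 1 0)
  obtain ⟨w, hw⟩ := h.surjective p hp (planeVec (π p) 0 1)
  have h1 := h.coordL_mfderiv hp 0 v
  have h2 := h.coordL_mfderiv hp 1 v
  have h3 := h.coordL_mfderiv hp 0 w
  have h4 := h.coordL_mfderiv hp 1 w
  rw [hv] at h1 h2
  rw [hw] at h3 h4
  rw [coordL_planeVec_zero] at h1 h3
  rw [coordL_planeVec_one] at h2 h4
  rw [leafDet] at h0
  -- The identity matrix is the product of the matrix of components of v and w with the matrix of
  -- `leafCoeff`, so its determinant would be a multiple of `leafDet`.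
  have key : (1 : ℝ) = 0 := by
    linear_combination h1
      + (e 1 p v * leafCoeff I₃ π F 1 0 p + e 2 p v * leafCoeff I₃ π F 2 0 p) * h4
      - (e 1 p w * leafCoeff I₃ π F 1 0 p + e 2 p w * leafCoeff I₃ π F 2 0 p) * h2
      + (e 1 p v * e 2 p w - e 2 p v * e 1 p w) * h0
  norm_num at key

lemma smooth_leafJ (hp : p ∈ U) (a b : Fin 2) : SmoothFn I₃ (leafJ I₃ π F a b) p :=
  (((h.smooth_leafCoeff hp 1 a).mul (h.smooth_leafCoeff hp 1 b)).add
    ((h.smooth_leafCoeff hp 2 a).mul (h.smooth_leafCoeff hp 2 b))).mul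
    ((h.smooth_leafDet hp).inv (h.leafDet_ne_zero hp))

/-- Lagrange's identity |a|² |b|² = (a·b)² + det(a, b)², divided by the squared determinant. -/
lemma leafJ_mul (hp : p ∈ U) :
    leafJ I₃ π F 0 0 p * leafJ I₃ π F 1 1 p = leafJ I₃ π F 0 1 p ^ 2 + 1 := by
  have h0 := h.leafDet_ne_zero hp
  have h1 : leafDet I₃ π F p * (leafDet I₃ π F p)⁻¹ = 1 := mul_inv_cancel₀ h0
  simp only [leafJ]
  generalize (leafDet I₃ π F p)⁻¹ = d at *
  have h2 : 1 = (leafDet I₃ π F p * d) ^ 2 := by rw [h1]; norm_num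
  rw [h2, leafDet]
  ring

lemma leafForm_mfderiv (hp : p ∈ U) (v : TangentSpace I₃ p) :
    leafForm I₃ π F 1 p (mfderiv I₃ (𝓡 2) π p v) = e 1 p v ∧
      leafForm I₃ π F 2 p (mfderiv I₃ (𝓡 2) π p v) = e 2 p v := by
  have h0 := h.leafDet_ne_zero hp
  rw [leafForm_one, leafForm_two, h.coordL_mfderiv hp, h.coordL_mfderiv hp]
  constructor <;> rw [inv_mul_eq_iff_eq_mul₀ h0, leafDet] <;> ring

/-- Dual form of the statement that J turns dπ(F 1) into dπ(F 2) and dπ(F 2) into -dπ(F 1); it says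
that φ has type (1,0). -/
lemma leafForm_planeEnd (hp : p ∈ U) (v : TangentSpace (𝓡 2) (π p)) :
    leafForm I₃ π F 1 p (planeEnd (leafJ I₃ π F 0 1 p) (leafJ I₃ π F 0 0 p) (leafJ I₃ π F 1 1 p)
      (π p) v) = -leafForm I₃ π F 2 p v ∧
    leafForm I₃ π F 2 p (planeEnd (leafJ I₃ π F 0 1 p) (leafJ I₃ π F 0 0 p) (leafJ I₃ π F 1 1 p)
      (π p) v) = leafForm I₃ π F 1 p v := by
  have h1 : leafDet I₃ π F p * (leafDet I₃ π F p)⁻¹ = 1 := mul_inv_cancel₀ (h.leafDet_ne_zero hp)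
  simp only [leafForm_one, leafForm_two, coordL_planeEnd_zero, coordL_planeEnd_one, leafJ]
  generalize coordL 0 (π p) v = x
  generalize coordL 1 (π p) v = y
  generalize (leafDet I₃ π F p)⁻¹ = d at *
  rw [leafDet] at h1
  constructor
  · linear_combination d * (leafCoeff I₃ π F 1 1 p * x - leafCoeff I₃ π F 1 0 p * y) * h1
  · linear_combination d * (leafCoeff I₃ π F 2 1 p * x - leafCoeff I₃ π F 2 0 p * y) * h1

/-- The Higgs pair of the structure equations: the connection has the horizontal space spanned by
`F 1` and `F 2`, and `φ` is the form with `φ (F 1) = F 0` and `φ (F 2) = i F 0`. -/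
lemma exists_higgsPair {J : Π x, TangentSpace (𝓡 2) x →L[ℝ] TangentSpace (𝓡 2) x}
    (hJ : ∀ p ∈ U, J (π p)
      = planeEnd (leafJ I₃ π F 0 1 p) (leafJ I₃ π F 0 0 p) (leafJ I₃ π F 1 1 p) (π p)) :
    ∃ Φ : HiggsPair (𝓡 2) I₃ J π U, Φ.Adapted U F e := by
  have hproj : ∀ p ∈ U, ∀ x, mfderiv I₃ (𝓡 2) π p
      (leafForm I₃ π F 1 p x • F 1 p + leafForm I₃ π F 2 p x • F 2 p) = x := by
    intro p hp x
    obtain ⟨v, rfl⟩ := h.surjective p hp x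
    rw [(h.leafForm_mfderiv hp v).1, (h.leafForm_mfderiv hp v).2]
    conv_rhs => rw [h.expand p hp v]
    rw [Fin.sum_univ_three]
    simp only [map_add, map_smul, h.vertical p hp, smul_zero, zero_add]
  have hform : ∀ p ∈ U, ∀ X : (Π y, TangentSpace (𝓡 2) y), SmoothVF (𝓡 2) X (π p) →
      SmoothFn I₃ (fun q => leafForm I₃ π F 1 q (X (π q))) p ∧
      SmoothFn I₃ (fun q => leafForm I₃ π F 2 q (X (π q))) p := by
    intro p hp X hX
    have hc : ∀ a, SmoothFn I₃ (fun q => coordL a (π q) (X (π q))) p := fun a =>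
      ContMDiffAt.comp (g := fun z => coordL a z (X z)) p (smoothVF_plane_iff.1 hX a) (h.smooth_proj p hp)
    have hd := (h.smooth_leafDet hp).inv (h.leafDet_ne_zero hp)
    constructor
    · exact (hd.mul (((h.smooth_leafCoeff hp 2 1).mul (hc 0)).sub
        ((h.smooth_leafCoeff hp 2 0).mul (hc 1)))).congr
        (Filter.Eventually.of_forall fun q => leafForm_one _)
    · exact (hd.mul (((h.smooth_leafCoeff hp 1 0).mul (hc 1)).sub
        ((h.smooth_leafCoeff hp 1 1).mul (hc 0)))).congr
        (Filter.Eventually.of_forall fun q => leafForm_two _)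
  let Φ : HiggsPair (𝓡 2) I₃ J π U :=
    { hor := fun p => (leafForm I₃ π F 1 p).smulRight (F 1 p)
        + (leafForm I₃ π F 2 p).smulRight (F 2 p)
      re := fun p => (leafForm I₃ π F 1 p).smulRight (F 0 p)
      im := fun p => (leafForm I₃ π F 2 p).smulRight (F 0 p)
      proj_hor := hproj
      proj_re := fun p hp x => by
        rw [ContinuousLinearMap.smulRight_apply, map_smul, h.vertical p hp, smul_zero]
      proj_im := fun p hp x => by
        rw [ContinuousLinearMap.smulRight_apply, map_smul, h.vertical p hp, smul_zero]
      re_J := fun p hp x => by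
        simp only [ContinuousLinearMap.smulRight_apply]
        rw [hJ p hp, (h.leafForm_planeEnd hp x).1, neg_smul]
      im_J := fun p hp x => by
        simp only [ContinuousLinearMap.smulRight_apply]
        rw [hJ p hp, (h.leafForm_planeEnd hp x).2]
      smooth_hor := fun p hp X hX =>
        ((h.smooth p hp 1).smul (hform p hp X hX).1).add
          ((h.smooth p hp 2).smul (hform p hp X hX).2)
      smooth_re := fun p hp X hX => (h.smooth p hp 0).smul (hform p hp X hX).1
      smooth_im := fun p hp X hX => (h.smooth p hp 0).smul (hform p hp X hX).2 }
  refine ⟨Φ, ⟨h.toCoframe, subset_rfl, h.smooth_proj, fun p hp v => ?_, fun p hp v => ?_,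
    fun p hp v => ?_⟩⟩
  · change leafForm I₃ π F 1 p _ • F 1 p + leafForm I₃ π F 2 p _ • F 2 p = _
    rw [(h.leafForm_mfderiv hp v).1, (h.leafForm_mfderiv hp v).2]
  · change leafForm I₃ π F 1 p _ • F 0 p = _
    rw [(h.leafForm_mfderiv hp v).1]
  · change leafForm I₃ π F 2 p _ • F 0 p = _
    rw [(h.leafForm_mfderiv hp v).2]

/-- F 0 kills the coordinates of π, so F 0 (F k πᵃ) = [F 0, F k] πᵃ, and modulo F 0 the structure
equations give a scaling at rate ω(F 0) and a rotation at rate 2κ. -/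
lemma dir_leafCoeff (hp : p ∈ U) (a : Fin 2) :
    dir I₃ (F 0) (leafCoeff I₃ π F 1 a) p = W.weylForm p (F 0 p) * leafCoeff I₃ π F 1 a p
      - 2 * κ p * leafCoeff I₃ π F 2 a p ∧
    dir I₃ (F 0) (leafCoeff I₃ π F 2 a) p = W.weylForm p (F 0 p) * leafCoeff I₃ π F 2 a p
      + 2 * κ p * leafCoeff I₃ π F 1 a p := by
  have hs := smoothFn_coord (h.smooth_proj p hp) a
  have h0 : ∀ q ∈ U, dir I₃ (F 0) (fun q => π q a) q = 0 := fun q hq => by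
    rw [dir, mvfderiv_coord (h.smooth_proj q hq), h.vertical q hq, map_zero]
  have hk : ∀ k, dir I₃ (F k) (dir I₃ (F 0) fun q => π q a) p = 0 := fun k => by
    rw [dir_congr (g := fun _ => 0), dir_const]
    filter_upwards [h.isOpen.mem_nhds hp] with q hq using h0 q hq
  have hvert : mvfderiv I₃ (fun q => π q a) p (F 0 p) = 0 := h0 p hp
  constructor
  · have h1 := dir_bracket (h.smooth p hp 0) (h.smooth p hp 1) hs
    have h2 : mlieBracket I₃ (F 0) (F 1) p = _ := h.bracket_frame p hp 2
    rw [hk, dir, h2] at h1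
    simp only [map_sub, map_smul, smul_eq_mul] at h1
    change W.weylForm p (F 0 p) * leafCoeff I₃ π F 1 a p - W.weylForm p (F 1 p) *
      mvfderiv I₃ (fun q => π q a) p (F 0 p) - 2 * κ p * leafCoeff I₃ π F 2 a p
      = dir I₃ (F 0) (leafCoeff I₃ π F 1 a) p - 0 at h1
    rw [hvert] at h1
    linarith
  · have h1 := dir_bracket (h.smooth p hp 2) (h.smooth p hp 0) hs
    have h2 : mlieBracket I₃ (F 2) (F 0) p = _ := h.bracket_frame p hp 1
    rw [hk, dir, h2] at h1
    simp only [map_sub, map_smul, smul_eq_mul] at h1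
    change W.weylForm p (F 2 p) * mvfderiv I₃ (fun q => π q a) p (F 0 p) - W.weylForm p (F 0 p) *
      leafCoeff I₃ π F 2 a p - 2 * κ p * leafCoeff I₃ π F 1 a p
      = 0 - dir I₃ (F 0) (leafCoeff I₃ π F 2 a) p at h1
    rw [hvert] at h1
    linarith

/-- The inner products in the numerator and the determinant are invariant under the rotation and
both scale at rate 2ω(F 0). Thus the complex structure is the same all along a leaf. -/
lemma dir_leafJ (hp : p ∈ U) (a b : Fin 2) : dir I₃ (F 0) (leafJ I₃ π F a b) p = 0 := by
  have hs := h.smooth_leafCoeff hp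
  refine dir_div_eq_zero (c := 2 * W.weylForm p (F 0 p))
    (((hs 1 a).mul (hs 1 b)).add ((hs 2 a).mul (hs 2 b))) (h.smooth_leafDet hp)
    (h.leafDet_ne_zero hp) ?_ ?_
  · rw [dir_add ((hs 1 a).mul (hs 1 b)) ((hs 2 a).mul (hs 2 b)), dir_mul (hs 1 a) (hs 1 b),
      dir_mul (hs 2 a) (hs 2 b), (h.dir_leafCoeff hp a).1, (h.dir_leafCoeff hp a).2,
      (h.dir_leafCoeff hp b).1, (h.dir_leafCoeff hp b).2]
    ring
  · unfold leafDet
    rw [dir_sub ((hs 1 0).mul (hs 2 1)) ((hs 1 1).mul (hs 2 0)), dir_mul (hs 1 0) (hs 2 1),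
      dir_mul (hs 1 1) (hs 2 0), (h.dir_leafCoeff hp 0).1, (h.dir_leafCoeff hp 0).2,
      (h.dir_leafCoeff hp 1).1, (h.dir_leafCoeff hp 1).2]
    ring

/-- The functions `leafJ` are constant in the directions of the leaves. -/
lemma mvfderiv_leafJ (hp : p ∈ U) (a b : Fin 2) {v : TangentSpace I₃ p}
    (hv : mfderiv I₃ (𝓡 2) π p v = 0) : mvfderiv I₃ (leafJ I₃ π F a b) p v = 0 := by
  have h1 := (h.leafForm_mfderiv hp v).1
  have h2 := (h.leafForm_mfderiv hp v).2
  rw [hv, map_zero] at h1 h2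
  have h3 : mvfderiv I₃ (leafJ I₃ π F a b) p (F 0 p) = 0 := h.dir_leafJ hp a b
  rw [h.expand p hp v, Fin.sum_univ_three, ← h1, ← h2]
  simp [h3]

end LeafSpace

end LeafSpace

/-! ### The Weyl structure induced by the Higgs pair of a frame. -/

section LeafSpace

variable {E₃ : Type*} [NormedAddCommGroup E₃] [NormedSpace ℝ E₃] [FiniteDimensional ℝ E₃]
  {H₃ : Type*} [TopologicalSpace H₃] {I₃ : ModelWithCorners ℝ E₃ H₃}
  {P : Type*} [TopologicalSpace P] [ChartedSpace H₃ P] [IsManifold I₃ ∞ P]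
  {E₂ : Type*} [NormedAddCommGroup E₂] [NormedSpace ℝ E₂] [FiniteDimensional ℝ E₂]
  {H₂ : Type*} [TopologicalSpace H₂] {I₂ : ModelWithCorners ℝ E₂ H₂} [I₂.Boundaryless]
  {N : Type*} [TopologicalSpace N] [ChartedSpace H₂ N] [IsManifold I₂ ∞ N]
  {J : Π x : N, TangentSpace I₂ x →L[ℝ] TangentSpace I₂ x} {π : P → N} {U : Set P}
  {Φ : HiggsPair I₂ I₃ J π U} {W : WeylStructure I₃ U}
  {F : Fin 3 → Π q : P, TangentSpace I₃ q} {e : Fin 3 → Π q : P, TangentSpace I₃ q →L[ℝ] ℝ}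
  {κ : P → ℝ}

namespace HiggsPair.Adapted

lemma induces_of_structureEq (hΦ : Φ.Adapted U F e) (h : W.StructureEq F e κ) :
    Φ.Induces (F 0) W := by
  have h1 : ∀ p ∈ U, mlieBracket I₃ (F 2) (F 0) p = W.weylForm p (F 2 p) • F 0 p
      - W.weylForm p (F 0 p) • F 2 p - (2 * κ p) • F 1 p := fun p hp => h.bracket_frame p hp 1
  have h2 : ∀ p ∈ U, mlieBracket I₃ (F 0) (F 1) p = W.weylForm p (F 0 p) • F 1 p
      - W.weylForm p (F 1 p) • F 0 p - (2 * κ p) • F 2 p := fun p hp => h.bracket_frame p hp 2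
  refine hΦ.induces h.toIsOrthonormal ?_ ?_ ?_ ?_ ?_ <;> intro p hp
  · rw [h2 p hp]; simp [h.dual p hp]
  · rw [h1 p hp]; simp [h.dual p hp]
  · rw [h2 p hp]; simp [h.dual p hp]
  · rw [h1 p hp]; simp [h.dual p hp]
  · rw [h1 p hp, h2 p hp]; simp [h.dual p hp]

lemma regularSet_eq (hΦ : Φ.Adapted U F e) : Φ.regularSet = U := by
  refine Set.Subset.antisymm (fun p hp => hp.1) fun p hp => ⟨hp, fun h0 => ?_⟩
  have h1 := hΦ.re_proj p hp (F 1 p)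
  rw [h0, hΦ.dual p hp] at h1
  have h2 := congrArg (e 0 p) h1
  simp [hΦ.dual p hp] at h2

end HiggsPair.Adapted

end LeafSpace

/-! ### Descent to the plane from its product with an arc. -/

section Arc

/-- The product of the plane and the circle. -/
abbrev Tube := EuclideanSpace ℝ (Fin 2) × Circle

/-- The stereographic chart of the circle. -/
def arc : OpenPartialHomeomorph Circle (EuclideanSpace ℝ (Fin 1)) :=
  chartAt (EuclideanSpace ℝ (Fin 1)) (1 : Circle)

lemma one_mem_arc : (1 : Circle) ∈ arc.source := mem_chart_source _ _

lemma arc_target : arc.target = Set.univ := by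
  have := finrank_real_complex_fact'
  exact stereographic'_target _

lemma contMDiff_arc_symm : ContMDiff (𝓡 1) (𝓡 1) ∞ arc.symm := by
  rw [← contMDiffOn_univ, ← arc_target]
  exact contMDiffOn_chart_symm

/-- The product of the plane and an arc. -/
def tubeArc : Set Tube := Set.univ ×ˢ arc.source

lemma isOpen_tubeArc : IsOpen tubeArc := isOpen_univ.prod arc.open_source

/-- Stereographic projection parametrizes the fibre of `tubeArc` by a whole line, so vanishing fibre
derivatives make f constant on it; the point 1 of the circle serves as a global section. -/
lemma eq_of_fibre_derivative {f : Tube → ℝ}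
    (hf : ∀ q ∈ tubeArc, SmoothFn ((𝓡 2).prod (𝓡 1)) f q)
    (h : ∀ q ∈ tubeArc, ∀ v, mfderiv ((𝓡 2).prod (𝓡 1)) (𝓡 2) Prod.fst q v = 0 →
      mvfderiv ((𝓡 2).prod (𝓡 1)) f q v = 0) {q : Tube} (hq : q ∈ tubeArc) : f q = f (q.1, 1) := by
  let γ : EuclideanSpace ℝ (Fin 1) → Tube := fun t => (q.1, arc.symm t)
  have hγ : ContMDiff (𝓡 1) ((𝓡 2).prod (𝓡 1)) ∞ γ := contMDiff_const.prodMk contMDiff_arc_symm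
  have hγV : ∀ t, γ t ∈ tubeArc := fun t => ⟨trivial, arc.map_target (by rw [arc_target]; trivial)⟩
  have hd : ∀ t, MDifferentiableAt (𝓡 1) ((𝓡 2).prod (𝓡 1)) γ t := fun t =>
    hγ.mdifferentiableAt (by simp)
  have hc : ∀ t s, mvfderiv (𝓡 1) (f ∘ γ) t s = 0 := by
    intro t s
    have hft : MDifferentiableAt ((𝓡 2).prod (𝓡 1)) 𝓘(ℝ) f (γ t) :=
      (hf _ (hγV t)).mdifferentiableAt (by simp)
    refine (mvfderiv_comp_apply t hft (hd t) s).trans ?_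
    refine h _ (hγV t) _ ?_
    have h1 := mfderiv_comp_apply (I := 𝓡 1) (I' := (𝓡 2).prod (𝓡 1)) (I'' := 𝓡 2) t
      (g := (Prod.fst : Tube → _)) mdifferentiableAt_fst (hd t) s
    refine h1.symm.trans ?_
    have h2 : (Prod.fst : Tube → _) ∘ γ = fun _ => q.1 := rfl
    rw [h2, mfderiv_const]
    rfl
  have hdiff : Differentiable ℝ (f ∘ γ) := fun t =>
    (((hf _ (hγV t)).mdifferentiableAt (by simp)).comp t (hd t)).differentiableAt
  have h0 : ∀ t, fderiv ℝ (f ∘ γ) t = 0 := by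
    intro t
    ext s
    have := hc t s
    simp only [mvfderiv, mfderiv_eq_fderiv] at this
    exact this
  have h1 := is_const_of_fderiv_eq_zero hdiff h0 (arc q.2) (arc 1)
  simp only [Function.comp_apply, γ, arc.left_inv hq.2, arc.left_inv one_mem_arc] at h1
  exact h1

/-- The Higgs pair of a Weyl structure satisfying the structure equations on the product of the plane
and an arc. -/
lemma LeafSpace.exists_hitchin {W : WeylStructure ((𝓡 2).prod (𝓡 1)) tubeArc}
    {F : Fin 3 → Π q : Tube, TangentSpace ((𝓡 2).prod (𝓡 1)) q}
    {e : Fin 3 → Π q : Tube, TangentSpace ((𝓡 2).prod (𝓡 1)) q →L[ℝ] ℝ} {κ : Tube → ℝ}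
    (h : LeafSpace (Prod.fst : Tube → EuclideanSpace ℝ (Fin 2)) W F e κ) :
    ∃ (J : Π x, TangentSpace (𝓡 2) x →L[ℝ] TangentSpace (𝓡 2) x)
      (Φ : HiggsPair (𝓡 2) ((𝓡 2).prod (𝓡 1)) J (Prod.fst : Tube → _) tubeArc),
      IsComplexStructure (𝓡 2) J ∧ Φ.IsHitchin ∧ Φ.regularSet = tubeArc ∧ Φ.Induces (F 0) W := by
  -- The entries of J are read off along the section at 1; being constant on fibres, they agree with
  -- `leafJ` on all of `tubeArc`.
  let c : Fin 2 → Fin 2 → EuclideanSpace ℝ (Fin 2) → ℝ := fun a b y =>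
    leafJ ((𝓡 2).prod (𝓡 1)) Prod.fst F a b (y, 1)
  have hV : ∀ y : EuclideanSpace ℝ (Fin 2), (y, (1 : Circle)) ∈ tubeArc := fun y =>
    ⟨trivial, one_mem_arc⟩
  have hs : ∀ a b y, SmoothFn (𝓡 2) (c a b) y := fun a b y =>
    ContMDiffAt.comp (I' := (𝓡 2).prod (𝓡 1)) y (f := fun y => (y, (1 : Circle)))
      (g := leafJ ((𝓡 2).prod (𝓡 1)) Prod.fst F a b) (h.smooth_leafJ (hV y) a b)
      (contMDiffAt_id.prodMk contMDiffAt_const)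
  have hc : ∀ a b, ∀ q ∈ tubeArc, leafJ ((𝓡 2).prod (𝓡 1)) Prod.fst F a b q = c a b q.1 :=
    fun a b q hq => eq_of_fibre_derivative (fun q hq => h.smooth_leafJ hq a b)
      (fun q hq v hv => h.mvfderiv_leafJ hq a b hv) hq
  obtain ⟨Φ, hΦ⟩ := h.exists_higgsPair
    (J := fun y => planeEnd (c 0 1 y) (c 0 0 y) (c 1 1 y) y) fun p hp => by
      rw [hc _ _ p hp, hc _ _ p hp, hc _ _ p hp]
  exact ⟨_, Φ, isComplexStructure_planeEnd (hs 0 1) (hs 0 0) (hs 1 1)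
    fun y => h.leafJ_mul (hV y), hΦ.isHitchin subset_rfl h.toStructureEq, hΦ.regularSet_eq,
    hΦ.induces_of_structureEq h.toStructureEq⟩

end Arc

/-! ### The flow box theorem on a manifold. -/

section LeafChart

/-- The map from the flow box to the product of the plane and an arc. -/
def boxToTube : OpenPartialHomeomorph BoxSpace Tube :=
  (OpenPartialHomeomorph.refl _).prod arc.symm

lemma boxToTube_source : boxToTube.source = Set.univ := by
  change Set.univ ×ˢ arc.target = Set.univ
  rw [arc_target, Set.univ_prod_univ]

lemma boxToTube_target : boxToTube.target = tubeArc := rfl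

lemma contMDiff_boxToTube : ContMDiff 𝓘(ℝ, BoxSpace) ((𝓡 2).prod (𝓡 1)) ∞ boxToTube :=
  (contDiff_fst.contMDiff (𝕜 := ℝ) (n := ∞) (f := (Prod.fst : BoxSpace → _))).prodMk
    (contMDiff_arc_symm.comp (contDiff_snd.contMDiff (f := (Prod.snd : BoxSpace → _))))

lemma contMDiffOn_boxToTube_symm :
    ContMDiffOn ((𝓡 2).prod (𝓡 1)) 𝓘(ℝ, BoxSpace) ∞ boxToTube.symm tubeArc :=
  contMDiffOn_fst.prodMk_space
    (contMDiffOn_chart.comp contMDiffOn_snd fun _ hq => hq.2)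

variable {E : Type*} [NormedAddCommGroup E] [NormedSpace ℝ E] [FiniteDimensional ℝ E]
  {H : Type*} [TopologicalSpace H] {I : ModelWithCorners ℝ E H} [I.Boundaryless]
  {B : Type*} [TopologicalSpace B] [ChartedSpace H B] [IsManifold I ∞ B]
  {X : Π q : B, TangentSpace I q} {b : B}

variable (I b) in
/-- The chart at `b`, as a map to the model vector space. -/
def vectorChart : OpenPartialHomeomorph B E := (chartAt H b).transHomeomorph I.toHomeomorph

variable (I b) in
lemma mem_vectorChart : b ∈ (vectorChart I b).source := mem_chart_source H b

variable (I b) in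
lemma contMDiffOn_vectorChart :
    ContMDiffOn I 𝓘(ℝ, E) ∞ (vectorChart I b) (vectorChart I b).source :=
  contMDiffOn_extChartAt

variable (I b) in
lemma contMDiffOn_vectorChart_symm :
    ContMDiffOn 𝓘(ℝ, E) I ∞ (vectorChart I b).symm (vectorChart I b).target :=
  (contMDiffOn_extChartAt_symm b).mono fun x hx => by
    rw [extChartAt_target, I.range_eq_univ, Set.inter_univ]
    exact hx

/-- The flow box theorem on a manifold of dimension three. -/
lemma exists_leafChart (hE : Module.finrank ℝ E = 3) (hX : ∀ q, SmoothVF I X q) (hb : X b ≠ 0) :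
    ∃ f : OpenPartialHomeomorph B Tube, b ∈ f.source ∧ f.target = tubeArc ∧
      ContMDiffOn I ((𝓡 2).prod (𝓡 1)) ∞ f f.source ∧
      ContMDiffOn ((𝓡 2).prod (𝓡 1)) I ∞ f.symm f.target ∧
      ∀ q ∈ f.source, mfderiv I (𝓡 2) (fun q' => (f q').1) q (X q) = 0 := by
  let c := vectorChart I b
  have hc : ∀ q ∈ c.source, ContMDiffAt I 𝓘(ℝ, E) ∞ c q := fun q hq =>
    (contMDiffOn_vectorChart I b).contMDiffAt (c.open_source.mem_nhds hq)
  -- The field X in the chart, still parametrized by points of B; `w ∘ c.symm` is the vector field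
  -- on the model space to which the flow box theorem applies.
  let w : B → E := fun q => mfderiv I 𝓘(ℝ, E) c q (X q)
  have hw : ContMDiffOn I 𝓘(ℝ, E) ∞ w c.source := by
    intro q hq
    have h1 := ContMDiffAt.mfderiv_const (m := ∞) (hc q hq) (by simp)
    have h2 := ContMDiffAt.clm_apply_of_inCoordinates (b₁ := id) (b₂ := c) h1 (hX q) (hc q hq)
    exact ((contMDiff_snd_tangentBundle_modelSpace E 𝓘(ℝ, E)).contMDiffAt.comp q
      h2).contMDiffWithinAt
  have hv : ContDiffOn ℝ ∞ (w ∘ c.symm) c.target := by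
    rw [← contMDiffOn_iff_contDiffOn]
    exact hw.comp (contMDiffOn_vectorChart_symm I b) fun x hx => c.map_target hx
  have hcb : c b ∈ c.target := c.map_source (mem_vectorChart I b)
  have hvc : ∀ q ∈ c.source, (w ∘ c.symm) (c q) = w q := fun q hq => by
    rw [Function.comp_apply, c.left_inv hq]
  have hv0 : (w ∘ c.symm) (c b) ≠ 0 := by
    rw [hvc b (mem_vectorChart I b)]
    intro h0
    have hinv : (mfderiv I 𝓘(ℝ, E) c b).IsInvertible :=
      isInvertible_mfderiv_extChartAt (I := I) (mem_extChartAt_source b)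
    exact hb (hinv.injective (h0.trans (map_zero _).symm))
  obtain ⟨φ, hbφ, hφc, hφt, hφ, hφs, hφv⟩ :=
    exists_flowBox hE (c.open_target.mem_nhds hcb) hv hv0
  let f := (c.trans φ).trans boxToTube
  have hfs : f.source = c.source ∩ c ⁻¹' φ.source := by
    simp [f, boxToTube_source]
  -- The flow box has the whole parameter space as target, so that no point of the arc or of the
  -- plane is lost.
  have hft : f.target = tubeArc := by
    rw [OpenPartialHomeomorph.trans_target, boxToTube_target, OpenPartialHomeomorph.trans_target, hφt]
    refine Set.inter_eq_left.2 fun q _ => ⟨trivial, hφc (φ.map_target ?_)⟩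
    rw [hφt]
    trivial
  refine ⟨f, ?_, hft, ?_, ?_, ?_⟩
  · rw [hfs]
    exact ⟨mem_vectorChart I b, hbφ⟩
  · rw [hfs]
    exact contMDiff_boxToTube.comp_contMDiffOn (hφ.contMDiffOn.comp
      ((contMDiffOn_vectorChart I b).mono Set.inter_subset_left) fun q hq => hq.2)
  · rw [hft]
    refine (contMDiffOn_vectorChart_symm I b).comp
      (hφs.contMDiff.comp_contMDiffOn contMDiffOn_boxToTube_symm) fun q _ => hφc (φ.map_target ?_)
    rw [hφt]
    trivial
  · intro q hq
    rw [hfs] at hq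
    have hd : DifferentiableAt ℝ φ (c q) :=
      (hφ.contDiffAt (φ.open_source.mem_nhds hq.2)).differentiableAt (by simp)
    have h1 := mfderiv_comp_apply (I := I) (I' := 𝓘(ℝ, E)) (I'' := 𝓡 2) q
      (g := fun x => (φ x).1) (f := c) hd.fst.mdifferentiableAt
      ((hc q hq.1).mdifferentiableAt (by simp)) (X q)
    refine h1.trans ?_
    rw [mfderiv_eq_fderiv, fderiv.fst hd]
    have h2 := hφv (c q) hq.2
    rw [hvc q hq.1] at h2
    exact h2

end LeafChart

/-! ### From hyperCR Einstein–Weyl spaces to Hitchin fields. -/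

section WeylToHitchin

variable {E : Type*} [NormedAddCommGroup E] [NormedSpace ℝ E] [FiniteDimensional ℝ E]
  {H : Type*} [TopologicalSpace H] {I : ModelWithCorners ℝ E H} [I.Boundaryless]
  {B : Type*} [TopologicalSpace B] [ChartedSpace H B] [IsManifold I ∞ B]
  {W : WeylStructure I (Set.univ : Set B)}
  {D : (Π q : B, TangentSpace I q) → (Π q : B, TangentSpace I q →L[ℝ] TangentSpace I q)}
  {X : Π q : B, TangentSpace I q}

/-- A hyperCR Einstein–Weyl space arises locally from a Hitchin field. -/
theorem WeylStructure.IsHyperCRCongruence.exists_hitchin (hX : W.IsHyperCRCongruence D X)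
    (hE : Module.finrank ℝ E = 3) (hD : W.IsWeylConnection D) (b : B) :
    ∃ (J : Π x : EuclideanSpace ℝ (Fin 2), TangentSpace (𝓡 2) x →L[ℝ] TangentSpace (𝓡 2) x)
      (f : OpenPartialHomeomorph B Tube)
      (Φ : HiggsPair (𝓡 2) ((𝓡 2).prod (𝓡 1)) J (Prod.fst : Tube → _) f.target)
      (T : Π q : Tube, TangentSpace ((𝓡 2).prod (𝓡 1)) q)
      (W' : WeylStructure ((𝓡 2).prod (𝓡 1)) Φ.regularSet),
      IsComplexStructure (𝓡 2) J ∧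
      b ∈ f.source ∧
      ContMDiffOn I ((𝓡 2).prod (𝓡 1)) ∞ f f.source ∧
      ContMDiffOn ((𝓡 2).prod (𝓡 1)) I ∞ f.symm f.target ∧
      Φ.IsHitchin ∧ Φ.regularSet = f.target ∧
      IsVerticalGauge (𝓡 2) ((𝓡 2).prod (𝓡 1)) (Prod.fst : Tube → _) Φ.regularSet T ∧
      Φ.Induces T W' ∧
      ∀ q ∈ f.source,
        (∀ v w : TangentSpace I q, W'.g (f q) (mfderiv I ((𝓡 2).prod (𝓡 1)) f q v)
          (mfderiv I ((𝓡 2).prod (𝓡 1)) f q w) = W.g q v w) ∧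
        (∀ v : TangentSpace I q,
          W'.weylForm (f q) (mfderiv I ((𝓡 2).prod (𝓡 1)) f q v) = W.weylForm q v) ∧
        mfderiv I (𝓡 2) (fun q' => (f q').1) q (X q) = 0 := by
  obtain ⟨F, e, κ, h, rfl⟩ := hX.exists_structureEq hE hD
  have hF0 : F 0 b ≠ 0 := by
    intro h0
    have h1 := h.dual b trivial 0 0
    simp [h0] at h1
  obtain ⟨f, hbf, hft, hf, hfs, hfX⟩ := exists_leafChart hE (fun q => h.smooth q trivial 0) hF0
  have hm : f.MDifferentiable I ((𝓡 2).prod (𝓡 1)) :=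
    ⟨hf.mdifferentiableOn (by simp), hfs.mdifferentiableOn (by simp)⟩
  have hdim : Module.finrank ℝ (EuclideanSpace ℝ (Fin 2) × EuclideanSpace ℝ (Fin 1)) = 3 := by
    simp
  -- The structure is transported to `tubeArc` by pulling it back along the inverse of the leaf
  -- chart.
  obtain ⟨F', e', W', hW', hF', hg, hω⟩ := h.pullback (I' := (𝓡 2).prod (𝓡 1)) hdim
    (f := f.symm) isOpen_tubeArc
    (fun y hy => hfs.contMDiffAt (f.open_target.mem_nhds (hft ▸ hy))) (fun _ _ => trivial)
    fun y hy => ⟨hm.symm.mfderiv (hft ▸ hy : y ∈ f.target), rfl⟩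
  have hvert : ∀ y ∈ tubeArc, mfderiv ((𝓡 2).prod (𝓡 1)) (𝓡 2) Prod.fst y (F' 0 y) = 0 := by
    intro y hy
    have hy' : y ∈ f.target := hft ▸ hy
    have hq := f.map_target hy'
    have h1 := mfderiv_comp_apply (I := I) (I' := (𝓡 2).prod (𝓡 1)) (I'' := 𝓡 2) (f.symm y)
      (g := (Prod.fst : Tube → _)) (f := f) mdifferentiableAt_fst (hm.mdifferentiableAt hq)
      (F 0 (f.symm y))
    have h2 := h1.symm.trans (hfX _ hq)
    have h3 := DFunLike.congr_fun (hm.comp_symm_deriv hy') (F' 0 y)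
    change mfderiv I ((𝓡 2).prod (𝓡 1)) f (f.symm y)
      (mfderiv ((𝓡 2).prod (𝓡 1)) I f.symm y (F' 0 y)) = F' 0 y at h3
    rw [hF' y hy 0] at h3
    rw [h3, f.right_inv hy'] at h2
    exact h2
  have hleaf : LeafSpace (Prod.fst : Tube → EuclideanSpace ℝ (Fin 2)) W' F' e' _ :=
    { toStructureEq := hW'
      smooth_proj := fun _ _ => contMDiffAt_fst
      vertical := hvert
      surjective := fun y _ v => ⟨(v, 0), by rw [mfderiv_fst]; rfl⟩ }
  obtain ⟨J, Φ, hJ, hΦ, hreg, hI⟩ := hleaf.exists_hitchin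
  refine ⟨J, f, ?_⟩
  -- The type of the Higgs pair depends on `f.target`, so the target is replaced by `tubeArc` before
  -- the pair is supplied; `hreg` does the same for the domain of `W'`.
  rw [hft] at hfs ⊢
  refine ⟨Φ, F' 0, ?_⟩
  rw [hreg]
  refine ⟨W', hJ, hbf, hf, hfs, hΦ, rfl, ⟨fun p hp => hW'.smooth p hp 0, hvert, ?_⟩, hI, ?_⟩
  · intro p hp h0
    have h1 := hW'.dual p hp 0 0
    simp [h0] at h1
  · intro q hq
    have hfq : f q ∈ tubeArc := hft ▸ f.map_source hq
    have hinv : ∀ v, mfderiv ((𝓡 2).prod (𝓡 1)) I f.symm (f q)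
        (mfderiv I ((𝓡 2).prod (𝓡 1)) f q v) = v := fun v =>
      DFunLike.congr_fun (hm.symm_comp_deriv hq) v
    refine ⟨fun v w => ?_, fun v => ?_, hfX q hq⟩
    · refine (hg _ hfq _ _).trans ?_
      rw [hinv, hinv, f.left_inv hq]
    · refine (hω _ hfq _).trans ?_
      rw [hinv, f.left_inv hq]

end WeylToHitchin

end HyperCR

end

theorem mainTheorem6 :
    -- The Einstein--Weyl space defined by a solution of the `Diff(S¹)` Hitchin equations.
    (∀ (E₂ : Type*) [NormedAddCommGroup E₂] [NormedSpace ℝ E₂] [FiniteDimensional ℝ E₂]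
      (H₂ : Type*) [TopologicalSpace H₂] (I₂ : ModelWithCorners ℝ E₂ H₂) [I₂.Boundaryless]
      (N : Type*) [TopologicalSpace N] [ChartedSpace H₂ N] [IsManifold I₂ ∞ N] [T2Space N]
      (E₃ : Type*) [NormedAddCommGroup E₃] [NormedSpace ℝ E₃] [FiniteDimensional ℝ E₃]
      (H₃ : Type*) [TopologicalSpace H₃] (I₃ : ModelWithCorners ℝ E₃ H₃) [I₃.Boundaryless]
      (P : Type*) [TopologicalSpace P] [ChartedSpace H₃ P] [IsManifold I₃ ∞ P] [T2Space P]
      (J : Π x : N, TangentSpace I₂ x →L[ℝ] TangentSpace I₂ x) (π : P → N) (Ω : Set P)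
      (Φ : HyperCR.HiggsPair I₂ I₃ J π Ω) (T : Π q : P, TangentSpace I₃ q),
      Module.finrank ℝ E₂ = 2 → Module.finrank ℝ E₃ = 3 →
      HyperCR.IsComplexStructure I₂ J → HyperCR.IsCircleBundle I₂ I₃ π → IsOpen Ω →
      Φ.IsHitchin → HyperCR.IsVerticalGauge I₂ I₃ π Φ.regularSet T →
      IsOpen Φ.regularSet ∧
      (∃ W : HyperCR.WeylStructure I₃ Φ.regularSet, Φ.Induces T W) ∧
      ∀ W : HyperCR.WeylStructure I₃ Φ.regularSet, Φ.Induces T W →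
        (∃ D, W.IsWeylConnection D) ∧
        ∀ D, W.IsWeylConnection D →
          W.IsHyperCREinsteinWeyl D ∧
          ∃ X, W.IsHyperCRCongruence D X ∧
            ∀ p ∈ Φ.regularSet, mfderiv I₃ I₂ π p (X p) = 0) ∧
    -- Every hyperCR Einstein--Weyl space, with any of its hyperCR congruences, arises in this way.
    (∀ (E : Type*) [NormedAddCommGroup E] [NormedSpace ℝ E] [FiniteDimensional ℝ E]
      (H : Type*) [TopologicalSpace H] (I : ModelWithCorners ℝ E H) [I.Boundaryless]
      (B : Type*) [TopologicalSpace B] [ChartedSpace H B] [IsManifold I ∞ B] [T2Space B]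
      (W : HyperCR.WeylStructure I (Set.univ : Set B))
      (D : (Π q : B, TangentSpace I q) → (Π q : B, TangentSpace I q →L[ℝ] TangentSpace I q))
      (X : Π q : B, TangentSpace I q),
      Module.finrank ℝ E = 3 → W.IsWeylConnection D → W.IsHyperCREinsteinWeyl D →
      W.IsHyperCRCongruence D X →
      ∀ b : B, ∃ (N : Type) (_ : TopologicalSpace N)
        (_ : ChartedSpace (EuclideanSpace ℝ (Fin 2)) N) (_ : IsManifold (𝓡 2) ∞ N)
        (_ : T2Space N) (_ : SecondCountableTopology N) (_ : ConnectedSpace N)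
        (J : Π x : N, TangentSpace (𝓡 2) x →L[ℝ] TangentSpace (𝓡 2) x)
        (f : OpenPartialHomeomorph B (N × Circle))
        (Φ : HyperCR.HiggsPair (𝓡 2) ((𝓡 2).prod (𝓡 1)) J
          (Prod.fst : N × Circle → N) f.target)
        (T : Π q : N × Circle, TangentSpace ((𝓡 2).prod (𝓡 1)) q)
        (W' : HyperCR.WeylStructure ((𝓡 2).prod (𝓡 1)) Φ.regularSet),
        HyperCR.IsComplexStructure (𝓡 2) J ∧
        b ∈ f.source ∧
        ContMDiffOn I ((𝓡 2).prod (𝓡 1)) ∞ f f.source ∧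
        ContMDiffOn ((𝓡 2).prod (𝓡 1)) I ∞ f.symm f.target ∧
        Φ.IsHitchin ∧ Φ.regularSet = f.target ∧
        HyperCR.IsVerticalGauge (𝓡 2) ((𝓡 2).prod (𝓡 1)) (Prod.fst : N × Circle → N)
          Φ.regularSet T ∧
        Φ.Induces T W' ∧
        ∀ q ∈ f.source,
          (∀ v w : TangentSpace I q,
            W'.g (f q) (mfderiv I ((𝓡 2).prod (𝓡 1)) f q v)
              (mfderiv I ((𝓡 2).prod (𝓡 1)) f q w) = W.g q v w) ∧
          (∀ v : TangentSpace I q,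
            W'.weylForm (f q) (mfderiv I ((𝓡 2).prod (𝓡 1)) f q v) = W.weylForm q v) ∧
          mfderiv I (𝓡 2) (fun q' => (f q').1) q (X q) = 0) := by
  constructor
  · intro E₂ _ _ _ H₂ _ I₂ _ N _ _ _ _ E₃ _ _ _ H₃ _ I₃ _ P _ _ _ _ J π Ω Φ T h2 h3 hJ hπ hΩ hΦ hT
    obtain ⟨hW, hD⟩ := hΦ.isHyperCREinsteinWeyl h2 h3 hJ hπ.smooth hΩ hT
    refine ⟨Φ.isOpen_regularSet hΩ, hW, fun W hI => ⟨(hD W hI).1, fun D hWD => ?_⟩⟩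
    obtain ⟨hEW, hC⟩ := (hD W hI).2 D hWD
    exact ⟨hEW, T, hC, hT.vertical⟩
  · intro E _ _ _ H _ I _ B _ _ _ _ W D X hE hD _ hX b
    exact ⟨EuclideanSpace ℝ (Fin 2), inferInstance, inferInstance, inferInstance, inferInstance,
      inferInstance, inferInstance, hX.exists_hitchin hE hD b⟩
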